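/- **Model of computation.** Programs are random access machine programs over finitely many integer arrays (with addition, subtraction, multiplication, integer division, indirect addressing, branching on positivity and loops), and time is logarithmic cost: each operation costs the bit length of the integers it handles (equivalent to a word RAM with $O(\log n)$-bit words up to polylogarithmic factors). **3-OV Hypothesis.** For every $\varepsilon>0$ there is a $c$ such that no program, given three families $A,B,C$ of $n$ vectors in $\{0,1\}^d$ with $d\le c\log_2 n$, decides in time $O(n^{3-\varepsilon})$ whether there are $u\in A$, $v\in B$, $w\in C$ with $u_jv_jw_j=0$ for all $j\in\{1,\dots,d\}$. **Transformers.** An attention head with weight matrices $W_Q,W_K,W_V\in\mathbb R^{m\times m}$ maps $X\in\mathbb R^{N\times m}$ to $f(X)=\mathrm{softmax}\big((XW_Q)(XW_K)^{\top}\big)\,XW_V$, with softmax applied row-wise. An MLP with activation function $\sigma:\mathbb R\to\mathbb R$ and hidden dimension $d_{\rm hid}$ is a map $x\mapsto\big(\sigma\big((x^{\top}\ 1)W_1\big)\ \ 1\big)W_2$, with $\sigma$ applied entry-wise. A transformer with input length $N$, embedding and input dimension $m$, output dimension $1$, $L$ layers and $H$ heads in each layer maps $X^{(0)}=X\in\mathbb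 R^{N\times m}$ to $\Psi_O(X^{(L)})\in\mathbb R^{N\times 1}$, where $X^{(\ell)}=\Psi_\ell\big(X^{(\ell-1)}+\sum_{h=1}^H f_{\ell,h}(X^{(\ell-1)})\big)$ and the MLPs $\Psi_\ell:\mathbb R^m\to\mathbb R^m$ and $\Psi_O:\mathbb R^m\to\mathbb R$ are applied row-wise. **Gap-preserving activations.** A function $\sigma:\mathbb R\to\mathbb R$ is *gap-preserving* with constant $c^*\in\mathbb R$ if $\sigma(0)\ne\sigma(1)$ and, for all $x\le c^*-1$, $\sigma(x)\le\sigma(c^*-1)<\sigma(c^*)$. The sigmoid $1/(1+e^{-x})$ is continuous and gap-preserving with $c^*=0$. **Theorem.** Assume the 3-OV Hypothesis. There is an integer $a$ such that for every $k\in\mathbb N$ and $\varepsilon>0$ there are $c$ and $B$ such that the following holds. Let $m,L,H:\mathbb N\to\mathbb N$ be computable in time $O((N+1)^k)$, with $m(N)=\Theta(\log N)$ and, for all large $N$, $m(N)\ge c\log N$ and $1\le L(N),H(N)\le N^k$. Let $\sigma$ be continuous and gap-preserving with constant $c^*$. Then no program does the following for all large $N$ in time $O\big(L(N)\,H(N)\,N^{2-\varepsilon}\big)$: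 given any transformer with input length $N$, embedding and input dimension $m(N)$, output dimension $1$, $L(N)$ layers, $H(N)$ heads in each layer, and all MLPs of hidden dimension $a\,m(N)$ with activation function $\sigma$, and given any input $X$, output the value of the transformer on $X$ up to entry-wise additive error $\frac1{10N}$ (as fractions). Here every weight and every entry of $X$ is given exactly, as a quotient (with nonzero denominator) of two integer linear combinations of $1,c^*,\sigma(0),\sigma(1),\sigma(c^*-1),\sigma(c^*)$ with coefficients of absolute value at most $N^B$. In short: under the 3-OV Hypothesis, computing transformers with $m=\Theta(\log N)$ and $L,H=\mathrm{poly}(N)$ requires $LHN^{2-o(1)}$ time, even if the MLPs have hidden dimension $O(m)$ and a fixed continuous gap-preserving activation function. -/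

import Mathlib

/-! ### Random access machines with logarithmic cost

Programs are structured programs over finitely many integer arrays.  Array names are fixed in the
program text, indices are computed.  Every operation is charged the bit lengths of the integers
it handles (logarithmic cost), so that time agrees, up to factors polylogarithmic in the time,
with time on a word RAM with logarithmic word length. -/

/-- The memory: `s a i` is the content of cell `i` of the array `a`. -/
abbrev Memory : Type := ℕ → ℤ → ℤ

/-- Integer expressions; `get a e` is the content of cell `e` of the array `a`, and `div` is
division with remainder. -/
inductive RExpr : Type
  | const (z : ℤ) : RExpr
  | get (a : ℕ) (e : RExpr) : RExpr
  | add (e f : RExpr) : RExpr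
  | sub (e f : RExpr) : RExpr
  | mul (e f : RExpr) : RExpr
  | div (e f : RExpr) : RExpr

/-- The number of bits that are charged for handling the integer `z`. -/
def bitLen (z : ℤ) : ℕ := Nat.size z.natAbs + 1

def RExpr.eval (s : Memory) : RExpr → ℤ
  | .const z => z
  | .get a e => s a (e.eval s)
  | .add e f => e.eval s + f.eval s
  | .sub e f => e.eval s - f.eval s
  | .mul e f => e.eval s * f.eval s
  | .div e f => e.eval s / f.eval s

/-- The cost of an evaluation: the bit lengths of all intermediate values. -/
def RExpr.cost (s : Memory) : RExpr → ℕ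
  | .const z => bitLen z
  | .get a e => e.cost s + bitLen (s a (e.eval s))
  | .add e f => e.cost s + f.cost s + bitLen (e.eval s + f.eval s)
  | .sub e f => e.cost s + f.cost s + bitLen (e.eval s - f.eval s)
  | .mul e f => e.cost s + f.cost s + bitLen (e.eval s * f.eval s)
  | .div e f => e.cost s + f.cost s + bitLen (e.eval s / f.eval s)

/-- Programs; `set a i e` writes `e` into cell `i` of the array `a`, and `ite`, `loop` test whether
their first argument is positive. -/
inductive Program : Type
  | skip : Program
  | set (a : ℕ) (i e : RExpr) : Program
  | seq (p q : Program) : Program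
  | ite (e : RExpr) (p q : Program) : Program
  | loop (e : RExpr) (p : Program) : Program

/-- The memory `s` after the value `z` was written into cell `i` of the array `a`. -/
def Memory.write (s : Memory) (a : ℕ) (i z : ℤ) : Memory :=
  Function.update s a (Function.update (s a) i z)

/-- `Exec p s t s'`: started in the memory `s`, the program `p` halts after time `t` in `s'`. -/
inductive Exec : Program → Memory → ℕ → Memory → Prop
  | skip (s : Memory) : Exec .skip s 1 s
  | set (s : Memory) (a : ℕ) (i e : RExpr) :
      Exec (.set a i e) s (i.cost s + e.cost s + 1) (s.write a (i.eval s) (e.eval s))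
  | seq {p q : Program} {s s₁ s₂ : Memory} {t₁ t₂ : ℕ} :
      Exec p s t₁ s₁ → Exec q s₁ t₂ s₂ → Exec (.seq p q) s (t₁ + t₂) s₂
  | ite_pos {e : RExpr} {p q : Program} {s s' : Memory} {t : ℕ} :
      0 < e.eval s → Exec p s t s' → Exec (.ite e p q) s (e.cost s + t + 1) s'
  | ite_neg {e : RExpr} {p q : Program} {s s' : Memory} {t : ℕ} :
      ¬ 0 < e.eval s → Exec q s t s' → Exec (.ite e p q) s (e.cost s + t + 1) s'
  | loop_stop {e : RExpr} {p : Program} {s : Memory} :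
      ¬ 0 < e.eval s → Exec (.loop e p) s (e.cost s + 1) s
  | loop_step {e : RExpr} {p : Program} {s s₁ s₂ : Memory} {t₁ t₂ : ℕ} :
      0 < e.eval s → Exec p s t₁ s₁ → Exec (.loop e p) s₁ t₂ s₂ →
      Exec (.loop e p) s (e.cost s + t₁ + t₂ + 1) s₂

/-- Started in `s`, the program `p` halts within time `T`, in a memory that satisfies `post`. -/
def RunsWithin (p : Program) (s : Memory) (T : ℝ) (post : Memory → Prop) : Prop :=
  ∃ (t : ℕ) (s' : Memory), Exec p s t s' ∧ (t : ℝ) ≤ T ∧ post s'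

/-- The array with content `f 0, f 1, …` in the cells `0, 1, …` and `0` in the negative cells. -/
def arrayOf (f : ℕ → ℤ) : ℤ → ℤ
  | Int.ofNat x => f x
  | Int.negSucc _ => 0

/-- Concatenation of `n` blocks of length `len`, followed by zeros. -/
def blocks {n : ℕ} (len : ℕ) (f : Fin n → ℕ → ℤ) (x : ℕ) : ℤ :=
  if h : x / len < n then f ⟨x / len, h⟩ (x % len) else 0

/-- The finite sequence `l`, followed by zeros. -/
def listCells (l : List ℤ) (x : ℕ) : ℤ := l.getD x 0

/-- `f` is computed in time `O((N + 1) ^ k)`: the input `N` stands in cell `0` of the array `1`,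
the output in cell `0` of the array `0`. -/
def ComputableInTime (k : ℕ) (f : ℕ → ℕ) : Prop :=
  ∃ (p : Program) (C : ℝ), ∀ N : ℕ,
    RunsWithin p
      (fun a => match a with
        | 1 => arrayOf (listCells [(N : ℤ)])
        | _ => arrayOf (listCells []))
      (C * ((N : ℝ) + 1) ^ k) (fun s' => s' 0 0 = (f N : ℤ))

/-! ### The 3-OV Hypothesis -/

/-- Some `a ∈ A`, `b ∈ B`, `c ∈ C` have a zero among `a j, b j, c j` in every coordinate `j`. -/
def HasOrthogonalTriple {n d : ℕ} (A B C : Fin n → Fin d → Bool) : Prop :=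
  ∃ x y z : Fin n, ∀ j : Fin d, A x j = false ∨ B y j = false ∨ C z j = false

/-- A family of 0-1 vectors, stored vector by vector. -/
def vectorCells {n d : ℕ} (A : Fin n → Fin d → Bool) : ℕ → ℤ :=
  blocks d fun i => blocks 1 fun j _ => if A i j then 1 else 0

/-- The input of 3-OV: `n, d` in the array `1` and the three families in the arrays `2, 3, 4`. -/
def ovMemory {n d : ℕ} (A B C : Fin n → Fin d → Bool) : Memory := fun a =>
  match a with
  | 1 => arrayOf (listCells [(n : ℤ), (d : ℤ)])
  | 2 => arrayOf (vectorCells A)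
  | 3 => arrayOf (vectorCells B)
  | 4 => arrayOf (vectorCells C)
  | _ => arrayOf (listCells [])

/-- The program `p` decides 3-OV on `n` vectors of dimension at most `c log₂ n` in time `T n`, for
all large `n`; the answer (`1` for yes, `0` for no) is left in cell `0` of the array `0`. -/
def SolvesThreeOV (p : Program) (c : ℕ) (T : ℕ → ℝ) : Prop :=
  ∀ᶠ n : ℕ in Filter.atTop, ∀ d : ℕ, d ≤ c * Nat.log 2 n → ∀ A B C : Fin n → Fin d → Bool,
    RunsWithin p (ovMemory A B C) (T n) fun s' =>
      (HasOrthogonalTriple A B C ∧ s' 0 0 = 1) ∨ (¬ HasOrthogonalTriple A B C ∧ s' 0 0 = 0)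

/-- The 3-OV Hypothesis: for every `ε > 0` there is a `c` such that 3-OV on `n` vectors of
dimension at most `c log₂ n` cannot be decided in time `O(n ^ (3 - ε))`. -/
def ThreeOVHypothesis : Prop :=
  ∀ ε : ℝ, 0 < ε → ∃ c : ℕ, ¬ ∃ (p : Program) (K : ℝ),
    SolvesThreeOV p c fun n => K * (n : ℝ) ^ (3 - ε)

/-! ### Transformers -/

/-- The row-wise softmax. -/
noncomputable def softmaxRows {N : ℕ} (A : Matrix (Fin N) (Fin N) ℝ) :
    Matrix (Fin N) (Fin N) ℝ :=
  Matrix.of fun i j => Real.exp (A i j) / ∑ k, Real.exp (A i k)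

/-- A map on vectors, applied to every row of a matrix. -/
def rowWise {N m p : ℕ} (f : (Fin m → ℝ) → Fin p → ℝ) (X : Matrix (Fin N) (Fin m) ℝ) :
    Matrix (Fin N) (Fin p) ℝ :=
  Matrix.of fun i => f (X i)

/-- A self-attention head: its query, key and value embeddings. -/
structure AttentionHead (m : ℕ) where
  query : (Fin m → ℝ) → Fin m → ℝ
  key : (Fin m → ℝ) → Fin m → ℝ
  value : (Fin m → ℝ) → Fin m → ℝ

noncomputable def AttentionHead.apply {m N : ℕ} (f : AttentionHead m)
    (X : Matrix (Fin N) (Fin m) ℝ) : Matrix (Fin N) (Fin m) ℝ :=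
  softmaxRows (rowWise f.query X * (rowWise f.key X).transpose) * rowWise f.value X

/-- A transformer with `L` layers of `H` heads, input and embedding dimension `m`, output
dimension `dout`, and summation of the heads. -/
structure Transformer (m L H dout : ℕ) where
  head : Fin L → Fin H → AttentionHead m
  mlp : Fin L → (Fin m → ℝ) → Fin m → ℝ
  outMlp : (Fin m → ℝ) → Fin dout → ℝ

/-- The embedding `X^(ℓ)` after the first `ℓ` layers. -/
noncomputable def Transformer.embedding {m L H dout N : ℕ} (T : Transformer m L H dout)
    (X : Matrix (Fin N) (Fin m) ℝ) : ℕ → Matrix (Fin N) (Fin m) ℝ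
  | 0 => X
  | ℓ + 1 =>
    if h : ℓ < L then
      rowWise (T.mlp ⟨ℓ, h⟩)
        (T.embedding X ℓ + ∑ j : Fin H, (T.head ⟨ℓ, h⟩ j).apply (T.embedding X ℓ))
    else T.embedding X ℓ

noncomputable def Transformer.apply {m L H dout N : ℕ} (T : Transformer m L H dout)
    (X : Matrix (Fin N) (Fin m) ℝ) : Matrix (Fin N) (Fin dout) ℝ :=
  rowWise T.outMlp (T.embedding X L)

/-- The MLP `x ↦ (σ((xᵀ 1) W₁) 1) W₂` with hidden dimension `hid` and activation function `σ`. -/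
noncomputable def activationMlp {m hid p : ℕ} (σ : ℝ → ℝ) (W₁ : Matrix (Fin (m + 1)) (Fin hid) ℝ)
    (W₂ : Matrix (Fin (hid + 1)) (Fin p) ℝ) (x : Fin m → ℝ) : Fin p → ℝ :=
  Matrix.vecMul
    (Fin.snoc (α := fun _ => ℝ)
      (fun k => σ (Matrix.vecMul (Fin.snoc (α := fun _ => ℝ) x 1) W₁ k)) 1) W₂

/-- `σ` is gap-preserving, with the constant `c⋆ = cs`. -/
def GapPreservingAt (σ : ℝ → ℝ) (cs : ℝ) : Prop :=
  σ 0 ≠ σ 1 ∧ σ (cs - 1) < σ cs ∧ ∀ x : ℝ, x ≤ cs - 1 → σ x ≤ σ (cs - 1)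

/-! ### Transformers as inputs of programs

A real number is given to a program exactly, as a quotient of two integer linear forms in
`1, c⋆, σ(0), σ(1), σ(c⋆ - 1), σ(c⋆)`; in particular all rational numbers can be given. -/

structure RealCode where
  num : Fin 6 → ℤ
  den : Fin 6 → ℤ

noncomputable def baseReals (σ : ℝ → ℝ) (cs : ℝ) : Fin 6 → ℝ :=
  ![1, cs, σ 0, σ 1, σ (cs - 1), σ cs]

noncomputable def RealCode.value (x : RealCode) (σ : ℝ → ℝ) (cs : ℝ) : ℝ :=
  (∑ i, (x.num i : ℝ) * baseReals σ cs i) / ∑ i, (x.den i : ℝ) * baseReals σ cs i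

/-- The denominator is not zero, and all coefficients are at most `M` in absolute value. -/
def RealCode.Valid (x : RealCode) (σ : ℝ → ℝ) (cs : ℝ) (M : ℕ) : Prop :=
  ∑ i, (x.den i : ℝ) * baseReals σ cs i ≠ 0 ∧
    ∀ i, (x.num i).natAbs ≤ M ∧ (x.den i).natAbs ≤ M

/-- A number occupies twelve cells. -/
def RealCode.cells (x : RealCode) : ℕ → ℤ :=
  listCells (List.ofFn x.num ++ List.ofFn x.den)

/-- A matrix of numbers, stored row by row. -/
def matrixCells {n p : ℕ} (W : Matrix (Fin n) (Fin p) RealCode) : ℕ → ℤ :=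
  blocks (p * 12) fun i => blocks 12 fun j => (W i j).cells

/-- The weights of a transformer with output dimension `1`, with embeddings given by weight
matrices, and with MLPs of hidden dimension `hid`. -/
structure TransformerCode (m L H hid : ℕ) where
  query : Fin L → Fin H → Matrix (Fin m) (Fin m) RealCode
  key : Fin L → Fin H → Matrix (Fin m) (Fin m) RealCode
  value : Fin L → Fin H → Matrix (Fin m) (Fin m) RealCode
  w₁ : Fin L → Matrix (Fin (m + 1)) (Fin hid) RealCode
  w₂ : Fin L → Matrix (Fin (hid + 1)) (Fin m) RealCode
  out₁ : Matrix (Fin (m + 1)) (Fin hid) RealCode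
  out₂ : Matrix (Fin (hid + 1)) (Fin 1) RealCode

/-- The real matrix that is given by a matrix of codes. -/
noncomputable def realMatrix {n p : ℕ} (σ : ℝ → ℝ) (cs : ℝ)
    (W : Matrix (Fin n) (Fin p) RealCode) : Matrix (Fin n) (Fin p) ℝ :=
  W.map fun x => x.value σ cs

/-- The transformer with these weights and the activation function `σ` in all of its MLPs. -/
noncomputable def TransformerCode.transformer {m L H hid : ℕ} (T : TransformerCode m L H hid)
    (σ : ℝ → ℝ) (cs : ℝ) : Transformer m L H 1 where
  head ℓ h :=
    { query := fun x => Matrix.vecMul x (realMatrix σ cs (T.query ℓ h))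
      key := fun x => Matrix.vecMul x (realMatrix σ cs (T.key ℓ h))
      value := fun x => Matrix.vecMul x (realMatrix σ cs (T.value ℓ h)) }
  mlp ℓ := activationMlp σ (realMatrix σ cs (T.w₁ ℓ)) (realMatrix σ cs (T.w₂ ℓ))
  outMlp := activationMlp σ (realMatrix σ cs T.out₁) (realMatrix σ cs T.out₂)

/-- All entries of the matrix are valid codes. -/
def ValidMatrix {n p : ℕ} (σ : ℝ → ℝ) (cs : ℝ) (M : ℕ)
    (W : Matrix (Fin n) (Fin p) RealCode) : Prop :=
  ∀ i j, (W i j).Valid σ cs M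

def TransformerCode.Valid {m L H hid : ℕ} (T : TransformerCode m L H hid)
    (σ : ℝ → ℝ) (cs : ℝ) (M : ℕ) : Prop :=
  (∀ ℓ h, ValidMatrix σ cs M (T.query ℓ h) ∧ ValidMatrix σ cs M (T.key ℓ h) ∧
      ValidMatrix σ cs M (T.value ℓ h)) ∧
    (∀ ℓ, ValidMatrix σ cs M (T.w₁ ℓ) ∧ ValidMatrix σ cs M (T.w₂ ℓ)) ∧
    ValidMatrix σ cs M T.out₁ ∧ ValidMatrix σ cs M T.out₂

/-- The memory that holds the transformer `T` and its input `X`, with the dimensions in the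
array `1`. -/
def transformerMemory {N m L H hid : ℕ} (T : TransformerCode m L H hid)
    (X : Matrix (Fin N) (Fin m) RealCode) : Memory := fun a =>
  match a with
  | 1 => arrayOf (listCells [(N : ℤ), (m : ℤ), (L : ℤ), (H : ℤ), (hid : ℤ)])
  | 2 => arrayOf (matrixCells X)
  | 3 => arrayOf (blocks (H * (m * (m * 12))) fun ℓ => blocks (m * (m * 12)) fun h =>
      matrixCells (T.query ℓ h))
  | 4 => arrayOf (blocks (H * (m * (m * 12))) fun ℓ => blocks (m * (m * 12)) fun h =>
      matrixCells (T.key ℓ h))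
  | 5 => arrayOf (blocks (H * (m * (m * 12))) fun ℓ => blocks (m * (m * 12)) fun h =>
      matrixCells (T.value ℓ h))
  | 6 => arrayOf (blocks ((m + 1) * (hid * 12)) fun ℓ => matrixCells (T.w₁ ℓ))
  | 7 => arrayOf (blocks ((hid + 1) * (m * 12)) fun ℓ => matrixCells (T.w₂ ℓ))
  | 8 => arrayOf (matrixCells T.out₁)
  | 9 => arrayOf (matrixCells T.out₂)
  | _ => arrayOf (listCells [])

/-- On input length `N`, the program `p` computes, in time `t` and up to the entry-wise additive
error `1 / (10 N)`, all transformers with embedding and input dimension `m`, output dimension `1`,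
`L` layers, `H` heads in each layer and MLPs of hidden dimension `hid` with activation function
`σ`, whose weights and inputs have codes with coefficients at most `M`.  Entry `i` of the output
is left as a fraction in the cells `2 i` (numerator) and `2 i + 1` of the array `0`. -/
def ComputesTransformers (p : Program) (σ : ℝ → ℝ) (cs : ℝ) (M N m L H hid : ℕ) (t : ℝ) : Prop :=
  ∀ (T : TransformerCode m L H hid) (X : Matrix (Fin N) (Fin m) RealCode),
    T.Valid σ cs M → ValidMatrix σ cs M X →
    RunsWithin p (transformerMemory T X) t fun s' => ∀ i : Fin N,
      0 < s' 0 (2 * (i : ℤ) + 1) ∧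
      |(s' 0 (2 * (i : ℤ)) : ℝ) / (s' 0 (2 * (i : ℤ) + 1) : ℝ) -
          (T.transformer σ cs).apply (realMatrix σ cs X) i 0| ≤ 1 / (10 * (N : ℝ))

/-! ### Bit lengths -/

/-! The proof is a reduction from 3-OV. A token `i ≥ 2` carries a vector of `A` and a vector of `B`,
and a head carries a vector of `C` in its query weights. The logit of token `j ≥ 2` seen from token
`i` is `-2N` times the number of common ones of the three vectors. Token `0` is a decoy with logit
`-N`. An orthogonal triple has logit `0` and draws the attention away from the decoy; without one,
and as long as nothing was found before, all other logits are at most `-2N` and the decoy keeps all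
but a fraction `N exp(-N)`. Values are `1` everywhere except at the decoy, so the sum `r` of the
head outputs is at least `1/2` after a hit and negligible otherwise. One transformer thus tests
about `N² L H` triples.

The outcome has to survive all layers. It is kept in a flag (coordinate `3`), which is close to `1`
before a hit and at most `0` afterwards. The new flag is the normalised activation at `c⋆ - 2r`: for
`r ≥ 1/2` the argument is at most `c⋆ - 1`, where gap preservation gives a value at most `0`, and
for small `r` continuity at `c⋆` gives a value near `1`. Token `1` has logit `4N - 8N · flag`, at
most `-2N` while the flag is at least `3/4` and at least `4N` after a hit, so every later layer sees
the hit again. The error of the flag does not accumulate, because each layer only uses that the flag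
is in the right range. All remaining coordinates except the accumulator `4` are `0` or `1` and are
restored exactly from `σ(0)` and `σ(1)`. This is `embedding_searchCode`, and `apply_searchCode` for
the output.

For the count, let `N` be the integer part of `n^(1/q)` with `q = 2k + 6`, and cut `A`, `B` into
groups of `N - 2` vectors and `C` into groups of `L H`. There are `O(n³ / (N² L H))` triples of
groups (`numRuns_add_one_le`), every triple of vectors occurs in one of them (`exists_runHits_iff`),
and runs of time `O(L H N^(2-ε))` add up to `n³ / N^ε` times polylogarithmic factors, hence to
`O(n^(3 - ε/(2q)))` (`solver_time_le`).

The rest turns this into a program with a proved cost. The given programs run in private arrays,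
with a fresh residue class of cells for each run, so that no memory has to be cleared
(`Exec.relocate`). The weights are written by closed arithmetic formulas in the position of the cell
(`Entry.eval_arrayE`). Outputs may be huge numbers, but their bit lengths are bounded by the running
time that produced them (`Exec.sum_bitLen_le`). -/

theorem natAbs_lt_two_pow_bitLen (z : ℤ) : z.natAbs < 2 ^ (bitLen z - 1) := by
  simpa [bitLen] using Nat.lt_size_self z.natAbs

theorem one_le_bitLen (z : ℤ) : 1 ≤ bitLen z := by simp [bitLen]

theorem bitLen_le_of_natAbs_lt {z : ℤ} {b : ℕ} (h : z.natAbs < 2 ^ b) : bitLen z ≤ b + 1 := by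
  simpa [bitLen] using Nat.size_le.2 h

theorem bitLen_mul_le (x y : ℤ) : bitLen (x * y) ≤ bitLen x + bitLen y := by
  have hx := natAbs_lt_two_pow_bitLen x
  have hy := natAbs_lt_two_pow_bitLen y
  have h1 := one_le_bitLen x
  have h2 := one_le_bitLen y
  have : (x * y).natAbs < 2 ^ ((bitLen x - 1) + (bitLen y - 1)) := by
    rw [Int.natAbs_mul, pow_add]
    exact Nat.mul_lt_mul'' hx hy
  have := bitLen_le_of_natAbs_lt this
  omega

theorem bitLen_add_le (x y : ℤ) : bitLen (x + y) ≤ bitLen x + bitLen y := by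
  have hx := natAbs_lt_two_pow_bitLen x
  have hy := natAbs_lt_two_pow_bitLen y
  have h1 := one_le_bitLen x
  have h2 := one_le_bitLen y
  have : (x + y).natAbs < 2 ^ ((bitLen x - 1) + (bitLen y - 1)) := by
    rw [pow_add]
    calc (x + y).natAbs ≤ x.natAbs + y.natAbs := Int.natAbs_add_le x y
      -- Passing from the sum to a product gives addition the same bound as multiplication, so all
      -- operations can be treated alike.
      _ < (x.natAbs + 1) * (y.natAbs + 1) := by nlinarith [Nat.zero_le (x.natAbs * y.natAbs)]
      _ ≤ _ := Nat.mul_le_mul hx hy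
  have := bitLen_le_of_natAbs_lt this
  omega

theorem bitLen_neg (x : ℤ) : bitLen (-x) = bitLen x := by simp [bitLen]

theorem bitLen_sub_le (x y : ℤ) : bitLen (x - y) ≤ bitLen x + bitLen y := by
  rw [sub_eq_add_neg, ← bitLen_neg y]
  exact bitLen_add_le x (-y)

theorem RExpr.bitLen_eval_le_cost (s : Memory) (e : RExpr) : bitLen (e.eval s) ≤ e.cost s := by
  cases e <;> simp [RExpr.eval, RExpr.cost]

/-! ### Cost bounds for expressions over bounded memories -/

/-- The first six arrays contain only numbers of absolute value at most `2 ^ β`. -/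
def LowBounded (β : ℕ) (s : Memory) : Prop := ∀ a i, a < 6 → (s a i).natAbs ≤ 2 ^ β

/-- The expression reads only the first six arrays. -/
def RExpr.IsLow : RExpr → Prop
  | .const _ => True
  | .get a e => a < 6 ∧ e.IsLow
  | .add e f => e.IsLow ∧ f.IsLow
  | .sub e f => e.IsLow ∧ f.IsLow
  | .mul e f => e.IsLow ∧ f.IsLow
  | .div e f => e.IsLow ∧ f.IsLow

/-- The exponent in the bound for the value of an expression over a bounded memory. -/
def RExpr.deg : RExpr → ℕ
  | .const z => Nat.size z.natAbs
  | .get _ _ => 1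
  | .add e f => e.deg + f.deg + 1
  | .sub e f => e.deg + f.deg + 1
  | .mul e f => e.deg + f.deg
  | .div e _ => e.deg

/-- The factor in the bound for the cost of an expression over a bounded memory. -/
def RExpr.weight : RExpr → ℕ
  | .const z => Nat.size z.natAbs + 2
  | .get _ e => e.weight + 3
  | .add e f => e.weight + f.weight + (e.deg + f.deg + 1 + 2)
  | .sub e f => e.weight + f.weight + (e.deg + f.deg + 1 + 2)
  | .mul e f => e.weight + f.weight + (e.deg + f.deg + 2)
  | .div e f => e.weight + f.weight + (e.deg + 2)

/-- A sum at most doubles the larger bound; since `β ≥ 1`, the factor `2` is absorbed by one more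
`β` in the exponent. This is the `+ 1` in `RExpr.deg`. -/
theorem add_le_two_pow_mul {β a b x y : ℕ} (hβ : 1 ≤ β) (hx : x ≤ 2 ^ (β * a))
    (hy : y ≤ 2 ^ (β * b)) : x + y ≤ 2 ^ (β * (a + b + 1)) := by
  have h1 : 2 ^ (β * a) ≤ 2 ^ (β * (a + b)) := Nat.pow_le_pow_right (by norm_num) (by gcongr; omega)
  have h2 : 2 ^ (β * b) ≤ 2 ^ (β * (a + b)) := Nat.pow_le_pow_right (by norm_num) (by gcongr; omega)
  have h3 : 2 ^ (β * (a + b) + 1) ≤ 2 ^ (β * (a + b + 1)) :=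
    Nat.pow_le_pow_right (by norm_num) (by nlinarith)
  rw [pow_succ] at h3
  omega

theorem RExpr.natAbs_eval_le {β : ℕ} (hβ : 1 ≤ β) {s : Memory} (hs : LowBounded β s) (e : RExpr)
    (he : e.IsLow) : (e.eval s).natAbs ≤ 2 ^ (β * e.deg) := by
  induction e with
  | const z =>
    refine (Nat.lt_size_self z.natAbs).le.trans ?_
    exact Nat.pow_le_pow_right (by norm_num) (by simp only [RExpr.deg]; nlinarith)
  | get a e ih => simpa [RExpr.deg, RExpr.eval] using hs a (e.eval s) he.1
  | add e f ihe ihf =>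
    exact (Int.natAbs_add_le _ _).trans (add_le_two_pow_mul hβ (ihe he.1) (ihf he.2))
  | sub e f ihe ihf =>
    exact (Int.natAbs_sub_le _ _).trans (add_le_two_pow_mul hβ (ihe he.1) (ihf he.2))
  | mul e f ihe ihf =>
    simp only [RExpr.eval, RExpr.deg, Int.natAbs_mul, mul_add, pow_add]
    exact Nat.mul_le_mul (ihe he.1) (ihf he.2)
  | div e f ihe ihf =>
    exact (Int.natAbs_ediv_le_natAbs _ _).trans (ihe he.1)

theorem bitLen_le_of_natAbs_le_two_pow {β D : ℕ} (hβ : 1 ≤ β) {z : ℤ}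
    (h : z.natAbs ≤ 2 ^ (β * D)) : bitLen z ≤ β * (D + 2) := by
  have : z.natAbs < 2 ^ (β * D + 1) := h.trans_lt (Nat.pow_lt_pow_right (by norm_num) (by omega))
  have := bitLen_le_of_natAbs_lt this
  nlinarith

theorem RExpr.cost_le {β : ℕ} (hβ : 1 ≤ β) {s : Memory} (hs : LowBounded β s) (e : RExpr)
    (he : e.IsLow) : e.cost s ≤ β * e.weight := by
  have key := fun f hf => bitLen_le_of_natAbs_le_two_pow hβ (RExpr.natAbs_eval_le hβ hs f hf)
  induction e with
  | const z => simpa [RExpr.eval, RExpr.cost, RExpr.weight, RExpr.deg] using key (.const z) he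
  | get a e ih =>
    have := key (.get a e) he
    have := ih he.2
    simp only [RExpr.eval, RExpr.cost, RExpr.weight, RExpr.deg] at *
    nlinarith
  | add e f ihe ihf =>
    have := key (.add e f) he
    have := ihe he.1
    have := ihf he.2
    simp only [RExpr.eval, RExpr.cost, RExpr.weight, RExpr.deg] at *
    nlinarith
  | sub e f ihe ihf =>
    have := key (.sub e f) he
    have := ihe he.1
    have := ihf he.2
    simp only [RExpr.eval, RExpr.cost, RExpr.weight, RExpr.deg] at *
    nlinarith
  | mul e f ihe ihf =>
    have := key (.mul e f) he
    have := ihe he.1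
    have := ihf he.2
    simp only [RExpr.eval, RExpr.cost, RExpr.weight, RExpr.deg] at *
    nlinarith
  | div e f ihe ihf =>
    have := key (.div e f) he
    have := ihe he.1
    have := ihf he.2
    simp only [RExpr.eval, RExpr.cost, RExpr.weight, RExpr.deg] at *
    nlinarith

/-! ### Verification of programs -/

theorem Memory.write_apply (s : Memory) (a : ℕ) (i z : ℤ) (b : ℕ) (j : ℤ) :
    s.write a i z b j = if b = a ∧ j = i then z else s b j := by
  unfold Memory.write
  by_cases hb : b = a
  · subst hb
    by_cases hj : j = i
    · subst hj; simp
    · simp [hj]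
  · simp [hb]

theorem Memory.write_apply_of_ne (s : Memory) {a b : ℕ} (i z : ℤ) (h : b ≠ a) :
    s.write a i z b = s b := by
  simp [Memory.write, h]

theorem LowBounded.write {β : ℕ} {s : Memory} (hs : LowBounded β s) {a : ℕ} {i z : ℤ}
    (h : 6 ≤ a ∨ z.natAbs ≤ 2 ^ β) : LowBounded β (s.write a i z) := by
  intro b j hb
  rw [Memory.write_apply]
  split_ifs with h'
  · rcases h with h | h
    · omega
    · exact h
  · exact hs b j hb

/-- Started in `s`, the program `p` halts within time `T`, in a memory that satisfies `post`. -/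
def HaltsIn (p : Program) (s : Memory) (T : ℕ) (post : Memory → Prop) : Prop :=
  ∃ t s', Exec p s t s' ∧ t ≤ T ∧ post s'

theorem HaltsIn.mono {p : Program} {s : Memory} {T T' : ℕ} {post post' : Memory → Prop}
    (h : HaltsIn p s T post) (hT : T ≤ T') (hp : ∀ s', post s' → post' s') :
    HaltsIn p s T' post' := by
  obtain ⟨t, s', h1, h2, h3⟩ := h
  exact ⟨t, s', h1, h2.trans hT, hp s' h3⟩

theorem HaltsIn.seq {p q : Program} {s : Memory} {T₁ T₂ : ℕ} {mid post : Memory → Prop}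
    (h : HaltsIn p s T₁ mid) (h' : ∀ s', mid s' → HaltsIn q s' T₂ post) :
    HaltsIn (.seq p q) s (T₁ + T₂) post := by
  obtain ⟨t, s', h1, h2, h3⟩ := h
  obtain ⟨t', s'', h4, h5, h6⟩ := h' s' h3
  exact ⟨_, s'', .seq h1 h4, Nat.add_le_add h2 h5, h6⟩

theorem haltsIn_skip {s : Memory} {post : Memory → Prop} (h : post s) :
    HaltsIn .skip s 1 post := ⟨1, s, .skip s, le_rfl, h⟩

theorem haltsIn_set {s : Memory} {T a : ℕ} {i e : RExpr} {post : Memory → Prop}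
    (hT : i.cost s + e.cost s + 1 ≤ T) (h : post (s.write a (i.eval s) (e.eval s))) :
    HaltsIn (.set a i e) s T post := ⟨_, _, .set s a i e, hT, h⟩

theorem haltsIn_set_low {β : ℕ} (hβ : 1 ≤ β) {s : Memory} (hs : LowBounded β s) {a : ℕ}
    {i e : RExpr} {post : Memory → Prop} (hi : i.IsLow) (he : e.IsLow)
    (h : post (s.write a (i.eval s) (e.eval s))) :
    HaltsIn (.set a i e) s (β * (i.weight + e.weight + 1)) post := by
  refine haltsIn_set ?_ h
  have := RExpr.cost_le hβ hs i hi
  have := RExpr.cost_le hβ hs e he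
  nlinarith

theorem haltsIn_ite {s : Memory} {T : ℕ} {e : RExpr} {p q : Program} {post : Memory → Prop}
    (hp : 0 < e.eval s → HaltsIn p s T post) (hq : ¬ 0 < e.eval s → HaltsIn q s T post) :
    HaltsIn (.ite e p q) s (e.cost s + T + 1) post := by
  by_cases h : 0 < e.eval s
  · obtain ⟨t, s', h1, h2, h3⟩ := hp h
    exact ⟨_, s', .ite_pos h h1, by omega, h3⟩
  · obtain ⟨t, s', h1, h2, h3⟩ := hq h
    exact ⟨_, s', .ite_neg h h1, by omega, h3⟩

/-- A loop with a known number `n - i` of remaining rounds. -/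
theorem haltsIn_loop {e : RExpr} {p : Program} {n κ : ℕ} (I : ℕ → Memory → Prop) (c : ℕ → ℕ)
    (hpos : ∀ i s, I i s → (0 < e.eval s ↔ i < n)) (hcost : ∀ i s, I i s → e.cost s ≤ κ)
    (hbody : ∀ i s, i < n → I i s → HaltsIn p s (c i) (I (i + 1))) (j : ℕ) :
    ∀ i s, i + j = n → I i s →
      HaltsIn (.loop e p) s (∑ l ∈ Finset.Ico i n, (c l + (κ + 1)) + (κ + 1)) (I n) := by
  induction j with
  | zero =>
    intro i s hi hI
    obtain rfl : i = n := by omega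
    have h := hpos i s hI
    have hc := hcost i s hI
    exact ⟨_, s, Exec.loop_stop (by simp [h]), by simpa using hc, hI⟩
  | succ j ih =>
    intro i s hi hI
    have hin : i < n := by omega
    obtain ⟨t, s', h1, h2, h3⟩ := hbody i s hin hI
    obtain ⟨t', s'', h4, h5, h6⟩ := ih (i + 1) s' (by omega) h3
    have hc := hcost i s hI
    refine ⟨_, s'', .loop_step ((hpos i s hI).2 hin) h1 h4, ?_, h6⟩
    rw [Finset.sum_eq_sum_Ico_succ_bot hin]
    omega

/-- The scalar variable `v`. -/
def RExpr.var (v : ℤ) : RExpr := .get 5 (.const v)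

/-- Assignment to the scalar variable `v`. -/
def Program.assign (v : ℤ) (e : RExpr) : Program := .set 5 (.const v) e

/-- `for v = 0, …, e - 1 do p`. -/
def Program.forLoop (v : ℤ) (e : RExpr) (p : Program) : Program :=
  .seq (.assign v (.const 0))
    (.loop (.sub e (.var v)) (.seq p (.assign v (.add (.var v) (.const 1)))))

theorem RExpr.isLow_var (v : ℤ) : (RExpr.var v).IsLow := by simp [RExpr.var, RExpr.IsLow]

@[simp] theorem RExpr.eval_var (v : ℤ) (s : Memory) : (RExpr.var v).eval s = s 5 v := rfl

/-- The overhead for one round of a `for` loop. -/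
def forWeight (v : ℤ) (e : RExpr) : ℕ :=
  (RExpr.sub e (.var v)).weight + (RExpr.const v).weight +
    (RExpr.add (.var v) (.const 1)).weight + (RExpr.const 0).weight + 2

/-- The invariant of the next round is demanded after the counter has been incremented, so the body
has to leave the counter alone. The cost `c i` may depend on the round, because reading an output
costs its unpredictable bit length. -/
theorem haltsIn_forLoop {β : ℕ} (hβ : 1 ≤ β) {v : ℤ} {e : RExpr} (he : e.IsLow) {p : Program}
    {n : ℕ} (I : ℕ → Memory → Prop) (c : ℕ → ℕ) {s : Memory} (hs : LowBounded β s)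
    (hlow : ∀ i s, I i s → LowBounded β s) (hv : ∀ i s, I i s → s 5 v = i)
    (hn : ∀ i s, I i s → e.eval s = n)
    (h0 : I 0 (s.write 5 v 0))
    (hbody : ∀ i s, i < n → I i s → HaltsIn p s (c i)
      fun s' => LowBounded β s' ∧ s' 5 v = i ∧ I (i + 1) (s'.write 5 v ((i : ℤ) + 1))) :
    HaltsIn (.forLoop v e p) s
      (∑ l ∈ Finset.range n, (c l + β * forWeight v e) + β * forWeight v e) (I n) := by
  have hloop := haltsIn_loop (e := .sub e (.var v))
    (p := .seq p (.assign v (.add (.var v) (.const 1)))) (n := n)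
    (κ := β * (RExpr.sub e (.var v)).weight) I
    (fun i => c i + β * ((RExpr.const v).weight + (RExpr.add (.var v) (.const 1)).weight + 1))
    (by
      intro i s hI
      simp only [RExpr.eval, RExpr.eval_var, hn i s hI, hv i s hI]
      omega)
    (by
      intro i s hI
      exact RExpr.cost_le hβ (hlow i s hI) _ ⟨he, RExpr.isLow_var v⟩)
    (by
      intro i s hin hI
      refine (hbody i s hin hI).seq ?_
      rintro s' ⟨h1, h2, h3⟩
      refine haltsIn_set_low hβ h1 (by simp [RExpr.IsLow])
        ⟨RExpr.isLow_var v, by simp [RExpr.IsLow]⟩ ?_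
      simpa [RExpr.eval, h2] using h3)
    n 0 (s.write 5 v 0) (by omega) h0
  have hset : HaltsIn (.assign v (.const 0)) s
      (β * ((RExpr.const v).weight + (RExpr.const 0).weight + 1)) (fun s' => s' = s.write 5 v 0) :=
    haltsIn_set_low hβ hs (by simp [RExpr.IsLow]) (by simp [RExpr.IsLow]) (by simp [RExpr.eval])
  refine (hset.seq (fun s' hs' => by subst hs'; exact hloop)).mono ?_ (fun _ h => h)
  rw [← Nat.Ico_zero_eq_range]
  have : ∀ l, c l + β * ((RExpr.const v).weight + (RExpr.add (.var v) (.const 1)).weight + 1) +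
      (β * (RExpr.sub e (.var v)).weight + 1) ≤ c l + β * forWeight v e := by
    intro l
    unfold forWeight
    nlinarith
  have h2 := Finset.sum_le_sum (s := Finset.Ico 0 n) (fun l _ => this l)
  have h3 : β * ((RExpr.const v).weight + (RExpr.const 0).weight + 1) +
      (β * (RExpr.sub e (.var v)).weight + 1) ≤ β * forWeight v e := by
    unfold forWeight
    nlinarith
  omega

/-- The bit lengths of the final contents of some cells are paid for by the running time. -/
theorem Exec.sum_bitLen_le {p : Program} {s s' : Memory} {t : ℕ} (h : Exec p s t s') (b : ℕ)
    (F : Finset ℤ) : ∑ i ∈ F, bitLen (s' b i) ≤ ∑ i ∈ F, bitLen (s b i) + t := by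
  induction h with
  | skip s => omega
  | set s a i e =>
    -- A written value was evaluated in the same step, so its bit length has been charged.
    have hcost := RExpr.bitLen_eval_le_cost s e
    have : ∀ j ∈ F, bitLen (s.write a (i.eval s) (e.eval s) b j) ≤
        bitLen (s b j) + if j = i.eval s then bitLen (e.eval s) else 0 := by
      intro j _
      rw [Memory.write_apply]
      split_ifs <;> omega
    refine (Finset.sum_le_sum this).trans ?_
    rw [Finset.sum_add_distrib, Finset.sum_ite_eq']
    split_ifs <;> omega
  | seq _ _ ih1 ih2 => omega
  | ite_pos _ _ ih => omega
  | ite_neg _ _ ih => omega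
  | loop_stop _ => omega
  | loop_step _ _ _ ih1 ih2 => omega

/-! ### Running programs in a private part of the memory -/

/-- Cell `e` of a private array in the current generation. -/
def RExpr.cellIndex (e : RExpr) : RExpr := .add (.mul e (.var 1)) (.var 2)

/-- The expression `e` over private arrays. -/
def RExpr.relocate : RExpr → RExpr
  | .const z => .const z
  | .get a e => .get (a + 6) e.relocate.cellIndex
  | .add e f => .add e.relocate f.relocate
  | .sub e f => .sub e.relocate f.relocate
  | .mul e f => .mul e.relocate f.relocate
  | .div e f => .div e.relocate f.relocate

/-- The program `p` over private arrays. -/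
def Program.relocate : Program → Program
  | .skip => .skip
  | .set a i e => .set (a + 6) i.relocate.cellIndex e.relocate
  | .seq p q => .seq p.relocate q.relocate
  | .ite e p q => .ite e.relocate p.relocate q.relocate
  | .loop e p => .loop e.relocate p.relocate

/-- The private memory of generation `g`. -/
def view (G g : ℤ) (s : Memory) : Memory := fun a i => s (a + 6) (i * G + g)

/-- Generations are residue classes modulo `G`, so cells of different generations never collide. -/
theorem mul_add_eq_mul_add {G g g' i j : ℤ} (hg : 0 ≤ g) (hgG : g < G) (hg' : 0 ≤ g')
    (hgG' : g' < G) (h : i * G + g = j * G + g') : i = j ∧ g = g' := by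
  have h1 : (i * G + g) % G = g := by
    rw [add_comm, Int.add_mul_emod_self_right, Int.emod_eq_of_lt hg hgG]
  have h2 : (j * G + g') % G = g' := by
    rw [add_comm, Int.add_mul_emod_self_right, Int.emod_eq_of_lt hg' hgG']
  have h3 : g = g' := by rw [← h1, h, h2]
  subst h3
  refine ⟨?_, rfl⟩
  have : i * G = j * G := by omega
  exact mul_right_cancel₀ (by omega) this

theorem view_write {G g : ℤ} (hg : 0 ≤ g) (hgG : g < G) (s : Memory) (a : ℕ) (i z : ℤ) :
    view G g (s.write (a + 6) (i * G + g) z) = (view G g s).write a i z := by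
  funext b j
  simp only [view, Memory.write_apply]
  have : (b + 6 = a + 6 ∧ j * G + g = i * G + g) ↔ (b = a ∧ j = i) := by
    constructor
    · rintro ⟨h1, h2⟩
      exact ⟨by omega, (mul_add_eq_mul_add hg hgG hg hgG h2).1⟩
    · rintro ⟨rfl, rfl⟩
      exact ⟨rfl, rfl⟩
  simp only [this]

theorem view_write_of_ne {G g g' : ℤ} (hg : 0 ≤ g) (hgG : g < G) (hg' : 0 ≤ g') (hgG' : g' < G)
    (h : g' ≠ g) (s : Memory) (a : ℕ) (i z : ℤ) :
    view G g' (s.write a (i * G + g) z) = view G g' s := by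
  funext b j
  simp only [view, Memory.write_apply]
  rw [if_neg]
  rintro ⟨_, h2⟩
  exact h (mul_add_eq_mul_add hg' hgG' hg hgG h2).2

theorem view_write_low {G g : ℤ} (s : Memory) {a : ℕ} (ha : a < 6) (i z : ℤ) :
    view G g (s.write a i z) = view G g s := by
  funext b j
  simp only [view, Memory.write_apply]
  rw [if_neg]
  omega

theorem RExpr.eval_relocate {G g : ℤ} {s : Memory} (hG : s 5 1 = G) (hg : s 5 2 = g) (e : RExpr) :
    e.relocate.eval s = e.eval (view G g s) := by
  induction e with
  | const z => rfl
  | get a e ih =>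
    simp [RExpr.relocate, RExpr.eval, RExpr.cellIndex, view, ih, hG, hg]
  | _ e f ihe ihf => simp [RExpr.relocate, RExpr.eval, ihe, ihf]

theorem RExpr.cost_cellIndex_le {G g : ℤ} {s : Memory} (hG : s 5 1 = G) (hg : s 5 2 = g)
    (e : RExpr) : e.cellIndex.cost s ≤
      e.cost s + 2 * bitLen (e.eval s) + (5 + 3 * bitLen G + 2 * bitLen g) := by
  have h1 := bitLen_mul_le (e.eval s) G
  have h2 := bitLen_add_le (e.eval s * G) g
  have h3 : bitLen 1 = 2 := by simp [bitLen]
  have h4 : bitLen 2 = 3 := by simp [bitLen, Nat.size, Nat.binaryRec]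
  simp only [RExpr.cellIndex, RExpr.cost, RExpr.var, RExpr.eval, hG, hg, h3, h4]
  omega

/-- The summand `2 * bitLen` on the left makes the induction work: it is kept in reserve for the
case that the value is used as an address, when multiplying by `G` and adding `g` costs twice its
bit length and a constant. -/
theorem RExpr.cost_relocate_le {G g : ℤ} {s : Memory} (hG : s 5 1 = G) (hg : s 5 2 = g) {F : ℕ}
    (hF : 8 + 3 * bitLen G + 2 * bitLen g ≤ F) (e : RExpr) :
    e.relocate.cost s + 2 * bitLen (e.eval (view G g s)) ≤ F * e.cost (view G g s) := by
  induction e with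
  | const z =>
    simp only [RExpr.relocate, RExpr.cost, RExpr.eval]
    nlinarith [one_le_bitLen z]
  | get a e ih =>
    have h1 := RExpr.cost_cellIndex_le hG hg e.relocate
    have h2 := one_le_bitLen ((RExpr.get a e).eval (view G g s))
    have h3 : (e.relocate.cellIndex).eval s = e.eval (view G g s) * G + g := by
      simp [RExpr.cellIndex, RExpr.eval, RExpr.eval_relocate hG hg, hG, hg]
    rw [RExpr.eval_relocate hG hg] at h1
    simp only [RExpr.relocate, RExpr.cost, RExpr.eval, h3] at *
    change _ + bitLen (view G g s a (e.eval (view G g s))) + _ ≤ _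
    nlinarith
  | add e f ihe ihf =>
    have h2 := one_le_bitLen ((RExpr.add e f).eval (view G g s))
    simp only [RExpr.relocate, RExpr.cost, RExpr.eval, RExpr.eval_relocate hG hg] at *
    nlinarith
  | sub e f ihe ihf =>
    have h2 := one_le_bitLen ((RExpr.sub e f).eval (view G g s))
    simp only [RExpr.relocate, RExpr.cost, RExpr.eval, RExpr.eval_relocate hG hg] at *
    nlinarith
  | mul e f ihe ihf =>
    have h2 := one_le_bitLen ((RExpr.mul e f).eval (view G g s))
    simp only [RExpr.relocate, RExpr.cost, RExpr.eval, RExpr.eval_relocate hG hg] at *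
    nlinarith
  | div e f ihe ihf =>
    have h2 := one_le_bitLen ((RExpr.div e f).eval (view G g s))
    simp only [RExpr.relocate, RExpr.cost, RExpr.eval, RExpr.eval_relocate hG hg] at *
    nlinarith

/-- The memories differ only in generation `g` of the private arrays. -/
def SameOutside (G g : ℤ) (s s' : Memory) : Prop :=
  (∀ a < 6, s' a = s a) ∧ ∀ g', 0 ≤ g' → g' < G → g' ≠ g → view G g' s' = view G g' s

theorem SameOutside.trans {G g : ℤ} {s s' s'' : Memory} (h : SameOutside G g s s')
    (h' : SameOutside G g s' s'') : SameOutside G g s s'' :=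
  ⟨fun a ha => (h'.1 a ha).trans (h.1 a ha),
    fun g' h1 h2 h3 => (h'.2 g' h1 h2 h3).trans (h.2 g' h1 h2 h3)⟩

theorem SameOutside.refl (G g : ℤ) (s : Memory) : SameOutside G g s s :=
  ⟨fun _ _ => rfl, fun _ _ _ _ => rfl⟩

theorem SameOutside.write {G g : ℤ} (hg0 : 0 ≤ g) (hgG : g < G) (s : Memory) (a : ℕ) (i z : ℤ) :
    SameOutside G g s (s.write (a + 6) (i * G + g) z) :=
  ⟨fun _ hb => Memory.write_apply_of_ne s _ _ (by omega),
    fun _ h1 h2 h3 => view_write_of_ne hg0 hgG h1 h2 h3 s _ _ _⟩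

/-- A relocated program simulates the original step by step: its reads and writes stay in its own
generation and arrays, and each charge grows by a factor of at most `F`, the price of an address
computation. -/
theorem Exec.relocate {G g : ℤ} (hg0 : 0 ≤ g) (hgG : g < G) {F : ℕ}
    (hF : 8 + 3 * bitLen G + 2 * bitLen g ≤ F) {p : Program} {v v' : Memory} {t : ℕ}
    (h : Exec p v t v') : ∀ s : Memory, view G g s = v → s 5 1 = G → s 5 2 = g →
      ∃ t' s', Exec p.relocate s t' s' ∧ t' ≤ F * t ∧ view G g s' = v' ∧ SameOutside G g s s' := by
  have hF1 : 1 ≤ F := by omega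
  induction h with
  | skip v =>
    intro s hs hG hg
    exact ⟨1, s, .skip s, by omega, hs, .refl G g s⟩
  | set v a i e =>
    intro s hs hG hg
    subst hs
    refine ⟨_, _, .set s (a + 6) i.relocate.cellIndex e.relocate, ?_, ?_, ?_⟩
    · have h1 := RExpr.cost_cellIndex_le hG hg i.relocate
      rw [RExpr.eval_relocate hG hg] at h1
      have h2 := RExpr.cost_relocate_le hG hg hF i
      have h3 := RExpr.cost_relocate_le hG hg hF e
      nlinarith
    · simp only [RExpr.cellIndex, RExpr.eval, RExpr.eval_relocate hG hg, RExpr.eval_var, hG, hg]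
      exact view_write hg0 hgG s a _ _
    · simp only [RExpr.cellIndex, RExpr.eval, RExpr.eval_relocate hG hg, RExpr.eval_var, hG, hg]
      exact .write hg0 hgG s a _ _
  | seq _ _ ih1 ih2 =>
    intro s hs hG hg
    obtain ⟨t1, s1, h1, h2, h3, h4⟩ := ih1 s hs hG hg
    obtain ⟨t2, s2, h5, h6, h7, h8⟩ := ih2 s1 h3 (by rw [h4.1 5 (by omega), hG])
      (by rw [h4.1 5 (by omega), hg])
    exact ⟨_, s2, .seq h1 h5, by rw [mul_add]; omega, h7, h4.trans h8⟩
  | @ite_pos e p q v v' t hpos _ ih =>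
    intro s hs hG hg
    obtain ⟨t1, s1, h1, h2, h3, h4⟩ := ih s hs hG hg
    subst hs
    have hc := RExpr.cost_relocate_le hG hg hF e
    refine ⟨_, s1, .ite_pos (by rwa [RExpr.eval_relocate hG hg]) h1, ?_, h3, h4⟩
    nlinarith
  | @ite_neg e p q v v' t hpos _ ih =>
    intro s hs hG hg
    obtain ⟨t1, s1, h1, h2, h3, h4⟩ := ih s hs hG hg
    subst hs
    have hc := RExpr.cost_relocate_le hG hg hF e
    refine ⟨_, s1, .ite_neg (by rwa [RExpr.eval_relocate hG hg]) h1, ?_, h3, h4⟩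
    nlinarith
  | loop_stop hpos =>
    rename_i e p v
    intro s hs hG hg
    subst hs
    have hc := RExpr.cost_relocate_le hG hg hF e
    refine ⟨_, s, Exec.loop_stop (by rwa [RExpr.eval_relocate hG hg]), ?_, rfl, .refl G g s⟩
    nlinarith
  | @loop_step e p v v1 v2 t1 t2 hpos _ _ ih1 ih2 =>
    intro s hs hG hg
    obtain ⟨t1, s1, h1, h2, h3, h4⟩ := ih1 s hs hG hg
    obtain ⟨t2, s2, h5, h6, h7, h8⟩ := ih2 s1 h3 (by rw [h4.1 5 (by omega), hG])
      (by rw [h4.1 5 (by omega), hg])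
    subst hs
    have hc := RExpr.cost_relocate_le hG hg hF e
    refine ⟨_, s2, .loop_step (by rwa [RExpr.eval_relocate hG hg]) h1 h5, ?_, h7, h4.trans h8⟩
    nlinarith

/-! ### The weights -/

/-- The indicator of a proposition. -/
def ind (P : Prop) [Decidable P] : ℤ := if P then 1 else 0

/-- The code whose twelve cells are `f 0, …, f 11`. -/
def codeOf (f : ℕ → ℤ) : RealCode := ⟨fun i => f i, fun i => f (i + 6)⟩

/-- The cells of the code of the integer `z`. -/
def intCell (z : ℤ) (t : ℕ) : ℤ := ind (t = 0) * z + ind (t = 6)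

/-- Coordinates: `0` is the constant `1`, `1` and `2` mark the tokens `0` (decoy) and `1` (memory of
earlier hits), `3` is the flag, `4` an accumulator, then come `d` coordinates of `A` and `d` of `B`.
The block of `B` is empty for the two special tokens, whose logits must not depend on it. -/
def inputEntry (d : ℕ) (A B : ℕ → ℤ → ℤ) (i k : ℕ) : ℤ :=
  ind (k = 0) + ind (k = 1) * ind (i = 0) + ind (k = 2) * ind (i = 1) + ind (k = 3) +
    ind (4 < k) * ind (k < 5 + d) * A i ((k : ℤ) - 5) +
    ind (1 < i) * ind (4 + d < k) * ind (k < 5 + 2 * d) * B i ((k : ℤ) - 5 - d)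

/-- The query is `-2N A C` on the block of `A`, `-N` in coordinate `1` and `4N - 8N · flag` in
coordinate `2`; the constants `-N` and `4N` come from the coordinate that is always `1`. -/
def queryEntry (d N : ℕ) (C : ℤ → ℤ) (r c : ℕ) : ℤ :=
  ind (r = c) * ind (4 < c) * ind (c < 5 + d) * (-2 * N * C ((c : ℤ) - 5)) -
    ind (r = 0) * ind (c = 1) * N + ind (r = 0) * ind (c = 2) * (4 * N) -
    ind (r = 3) * ind (c = 2) * (8 * N)

/-- The block of `B` is moved onto the block of `A`, so that the scalar product with the query
counts common ones. -/
def keyEntry (d r c : ℕ) : ℤ :=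
  ind (r = c) * (ind (c = 1) + ind (c = 2)) + ind (r = c + d) * ind (4 < c) * ind (c < 5 + d)

/-- The difference of coordinates `0` and `1` is `1` at every token but the decoy. -/
def valueEntry (r c : ℕ) : ℤ := (ind (r = 0) - ind (r = 1)) * ind (c = 4)

/-- Row `m` holds the biases, and cell `1` of a code is the coefficient of `c⋆`. Hidden unit `3`
receives `c⋆ - 2 x₄`; every other unit copies its coordinate. -/
def w₁Cell (m r c t : ℕ) : ℤ :=
  intCell (ind (r = c) * (1 - ind (c = 3)) - 2 * ind (r = 4) * ind (c = 3)) t +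
    ind (t = 1) * ind (r = m) * ind (c = 3)

/-- Affine renormalisation of the activations. Cells `2` to `5` and `8` to `11` are the coefficients
of `σ(0), σ(1), σ(c⋆ - 1), σ(c⋆)` in numerator and denominator: the denominator is `σ(c⋆) - σ(c⋆ -
1)` in column `3` and `σ(1) - σ(0)` elsewhere. Column `4` vanishes, which resets the accumulator. -/
def w₂Cell (m r c t : ℕ) : ℤ :=
  ind (t = 0) * ind (r = c) * (1 - ind (c = 4)) -
    ind (t = 2) * ind (r = m) * (1 - ind (c = 3)) * (1 - ind (c = 4)) -
    ind (t = 4) * ind (r = m) * ind (c = 3) +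
    (ind (t = 9) - ind (t = 8)) * (1 - ind (c = 3)) + (ind (t = 11) - ind (t = 10)) * ind (c = 3)

/-- Only hidden unit `0` is used; it receives `c⋆ - 1` plus the flag. -/
def out₁Cell (m r c t : ℕ) : ℤ :=
  intCell (ind (r = 3) * ind (c = 0) - ind (r = m) * ind (c = 0)) t +
    ind (t = 1) * ind (r = m) * ind (c = 0)

def out₂Cell (m r t : ℕ) : ℤ :=
  ind (t = 0) * ind (r = 0) - ind (t = 4) * ind (r = m) + ind (t = 11) - ind (t = 10)

/-- The transformer that searches `A` and `B` for partners of the vectors `C ℓ h`. -/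
def searchCode (m L H N d : ℕ) (C : ℕ → ℕ → ℤ → ℤ) : TransformerCode m L H m where
  query ℓ h := Matrix.of fun r c => codeOf (intCell (queryEntry d N (C ℓ h) r c))
  key _ _ := Matrix.of fun r c => codeOf (intCell (keyEntry d r c))
  value _ _ := Matrix.of fun r c => codeOf (intCell (valueEntry r c))
  w₁ _ := Matrix.of fun r c => codeOf (w₁Cell m r c)
  w₂ _ := Matrix.of fun r c => codeOf (w₂Cell m r c)
  out₁ := Matrix.of fun r c => codeOf (out₁Cell m r c)
  out₂ := Matrix.of fun r _ => codeOf (out₂Cell m r)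

def searchInput (N m d : ℕ) (A B : ℕ → ℤ → ℤ) : Matrix (Fin N) (Fin m) RealCode :=
  Matrix.of fun i k => codeOf (intCell (inputEntry d A B i k))

/-! ### Values and validity of the codes -/

theorem ind_of {P : Prop} [Decidable P] (h : P) : ind P = 1 := if_pos h
theorem ind_not {P : Prop} [Decidable P] (h : ¬ P) : ind P = 0 := if_neg h

theorem codeOf_intCell_value (z : ℤ) (σ : ℝ → ℝ) (cs : ℝ) :
    (codeOf (intCell z)).value σ cs = z := by
  simp [RealCode.value, codeOf, Fin.sum_univ_succ, baseReals, intCell, ind]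

theorem codeOf_w₁Cell_value (m r c : ℕ) (σ : ℝ → ℝ) (cs : ℝ) :
    (codeOf (w₁Cell m r c)).value σ cs =
      ((ind (r = c) : ℤ) : ℝ) * (if c = 3 then 0 else 1) -
        ((ind (r = 4) : ℤ) : ℝ) * (if c = 3 then 2 else 0) +
        ((ind (r = m) : ℤ) : ℝ) * (if c = 3 then cs else 0) := by
  simp [RealCode.value, codeOf, Fin.sum_univ_succ, baseReals, w₁Cell, intCell, ind]
  split_ifs <;> simp

theorem codeOf_out₁Cell_value (m r c : ℕ) (σ : ℝ → ℝ) (cs : ℝ) :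
    (codeOf (out₁Cell m r c)).value σ cs =
      ((ind (r = 3) : ℤ) : ℝ) * (ind (c = 0) : ℤ) +
        ((ind (r = m) : ℤ) : ℝ) * ((ind (c = 0) : ℤ) * (cs - 1)) := by
  simp [RealCode.value, codeOf, Fin.sum_univ_succ, baseReals, out₁Cell, intCell, ind]
  split_ifs <;> simp <;> ring

theorem codeOf_w₂Cell_value (m r c : ℕ) (σ : ℝ → ℝ) (cs : ℝ) :
    (codeOf (w₂Cell m r c)).value σ cs =
      if c = 3 then (((ind (r = 3) : ℤ) : ℝ) - ((ind (r = m) : ℤ) : ℝ) * σ (cs - 1)) /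
        (σ cs - σ (cs - 1))
      else if c = 4 then 0
      else (((ind (r = c) : ℤ) : ℝ) - ((ind (r = m) : ℤ) : ℝ) * σ 0) / (σ 1 - σ 0) := by
  by_cases h3 : c = 3
  · subst h3
    simp [RealCode.value, codeOf, Fin.sum_univ_succ, baseReals, w₂Cell, ind]
    congr 1 <;> ring
  · by_cases h4 : c = 4
    · subst h4
      simp [RealCode.value, codeOf, Fin.sum_univ_succ, baseReals, w₂Cell, ind]
    · simp [RealCode.value, codeOf, Fin.sum_univ_succ, baseReals, w₂Cell, ind, h3, h4]
      congr 1 <;> ring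

theorem codeOf_out₂Cell_value (m r : ℕ) (σ : ℝ → ℝ) (cs : ℝ) :
    (codeOf (out₂Cell m r)).value σ cs =
      (((ind (r = 0) : ℤ) : ℝ) - ((ind (r = m) : ℤ) : ℝ) * σ (cs - 1)) /
        (σ cs - σ (cs - 1)) := by
  simp [RealCode.value, codeOf, Fin.sum_univ_succ, baseReals, out₂Cell, ind]
  congr 1 <;> ring

theorem codeOf_intCell_valid {z : ℤ} {σ : ℝ → ℝ} {cs : ℝ} {M : ℕ} (hM : 1 ≤ M)
    (hz : z.natAbs ≤ M) : (codeOf (intCell z)).Valid σ cs M := by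
  refine ⟨?_, fun i => ?_⟩
  · simp [codeOf, baseReals, intCell, ind]
  · fin_cases i <;> simp [codeOf, intCell, ind, hz, hM]

/-- The largest coefficient is the `8N` of the query weights. The two kinds of nonconstant
denominators are nonzero by the two strictness conditions of gap preservation. -/
theorem searchCode_valid {m L H N d M : ℕ} {C : ℕ → ℕ → ℤ → ℤ} {σ : ℝ → ℝ} {cs : ℝ}
    (hσ : GapPreservingAt σ cs) (hC : ∀ ℓ h k, C ℓ h k = 0 ∨ C ℓ h k = 1) (hM : 8 * N ≤ M)
    (hM4 : 4 ≤ M) : (searchCode m L H N d C).Valid σ cs M := by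
  have h01 : σ 1 - σ 0 ≠ 0 := sub_ne_zero.2 hσ.1.symm
  have hcs : σ cs - σ (cs - 1) ≠ 0 := sub_ne_zero.2 hσ.2.1.ne'
  refine ⟨fun ℓ h => ⟨fun r c => ?_, fun r c => ?_, fun r c => ?_⟩, fun ℓ => ⟨fun r c => ?_,
    fun r c => ?_⟩, fun r c => ?_, fun r c => ?_⟩
  · refine codeOf_intCell_valid (by omega) ?_
    rcases hC ℓ h ((c : ℕ) - 5) with h | h <;> simp only [queryEntry, ind, h] <;>
      split_ifs <;> omega
  · refine codeOf_intCell_valid (by omega) ?_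
    simp only [keyEntry, ind]
    split_ifs <;> omega
  · refine codeOf_intCell_valid (by omega) ?_
    simp only [valueEntry, ind]
    split_ifs <;> omega
  · refine ⟨?_, fun i => ?_⟩
    · simp [searchCode, codeOf, baseReals, w₁Cell, intCell, ind]
    · fin_cases i <;> simp [searchCode, codeOf, w₁Cell, intCell, ind] <;> (try split_ifs) <;> (try simp) <;> omega
  · refine ⟨?_, fun i => ?_⟩
    · by_cases h3 : (c : ℕ) = 3
      · simp [searchCode, codeOf, Fin.sum_univ_succ, baseReals, w₂Cell, ind, h3]
        contrapose! hcs
        linarith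
      · simp [searchCode, codeOf, Fin.sum_univ_succ, baseReals, w₂Cell, ind, h3]
        contrapose! h01
        linarith
    · fin_cases i <;> simp [searchCode, codeOf, w₂Cell, ind] <;> (try split_ifs) <;> (try simp) <;> omega
  · refine ⟨?_, fun i => ?_⟩
    · simp [searchCode, codeOf, baseReals, out₁Cell, intCell, ind]
    · fin_cases i <;> simp [searchCode, codeOf, out₁Cell, intCell, ind] <;> (try split_ifs) <;> (try simp) <;> omega
  · refine ⟨?_, fun i => ?_⟩
    · simp [searchCode, codeOf, Fin.sum_univ_succ, baseReals, out₂Cell, ind]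
      contrapose! hcs
      linarith
    · fin_cases i <;> simp [searchCode, codeOf, out₂Cell, ind] <;> (try split_ifs) <;> (try simp) <;> omega

theorem ind_mem_Icc (P : Prop) [Decidable P] : ind P ∈ Set.Icc 0 1 := by
  unfold ind
  split_ifs <;> simp

theorem mul_mem_Icc_zero_one {x y : ℤ} (hx : x ∈ Set.Icc 0 1) (hy : y ∈ Set.Icc 0 1) :
    x * y ∈ Set.Icc 0 1 :=
  ⟨mul_nonneg hx.1 hy.1, mul_le_one₀ hx.2 hy.1 hy.2⟩

theorem searchInput_valid {N m d M : ℕ} {A B : ℕ → ℤ → ℤ} {σ : ℝ → ℝ} {cs : ℝ}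
    (hA : ∀ i k, A i k = 0 ∨ A i k = 1) (hB : ∀ i k, B i k = 0 ∨ B i k = 1) (hM : 6 ≤ M) :
    ValidMatrix σ cs M (searchInput N m d A B) := by
  intro i k
  refine codeOf_intCell_valid (by omega) ?_
  have ha : A i ((k : ℕ) - 5) ∈ Set.Icc 0 1 := by
    rcases hA i ((k : ℕ) - 5) with h | h <;> simp [h]
  have hb : B i ((k : ℕ) - 5 - d) ∈ Set.Icc 0 1 := by
    rcases hB i ((k : ℕ) - 5 - d) with h | h <;> simp [h]
  obtain ⟨h1, h1'⟩ := ind_mem_Icc ((k : ℕ) = 0)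
  obtain ⟨h2, h2'⟩ := mul_mem_Icc_zero_one (ind_mem_Icc ((k : ℕ) = 1)) (ind_mem_Icc ((i : ℕ) = 0))
  obtain ⟨h3, h3'⟩ := mul_mem_Icc_zero_one (ind_mem_Icc ((k : ℕ) = 2)) (ind_mem_Icc ((i : ℕ) = 1))
  obtain ⟨h4, h4'⟩ := ind_mem_Icc ((k : ℕ) = 3)
  obtain ⟨h5, h5'⟩ := mul_mem_Icc_zero_one (mul_mem_Icc_zero_one (ind_mem_Icc (4 < (k : ℕ)))
    (ind_mem_Icc ((k : ℕ) < 5 + d))) ha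
  obtain ⟨h6, h6'⟩ := mul_mem_Icc_zero_one (mul_mem_Icc_zero_one (mul_mem_Icc_zero_one
    (ind_mem_Icc (1 < (i : ℕ))) (ind_mem_Icc (4 + d < (k : ℕ))))
    (ind_mem_Icc ((k : ℕ) < 5 + 2 * d))) hb
  unfold inputEntry
  omega

/-! ### Sums against indicators -/

/-- A finite sequence, continued by zeros. -/
def extendZero {m : ℕ} (x : Fin m → ℝ) (r : ℕ) : ℝ := if h : r < m then x ⟨r, h⟩ else 0

@[simp] theorem extendZero_fin {m : ℕ} (x : Fin m → ℝ) (r : Fin m) : extendZero x r = x r := by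
  simp [extendZero]

theorem sum_mul_ind {m : ℕ} (x : Fin m → ℝ) (a : ℕ) (y : ℝ) :
    ∑ r : Fin m, x r * (((ind ((r : ℕ) = a) : ℤ) : ℝ) * y) = extendZero x a * y := by
  unfold extendZero
  split_ifs with h
  · rw [Finset.sum_eq_single ⟨a, h⟩]
    · simp [ind]
    · intro b _ hb
      have : (b : ℕ) ≠ a := fun h' => hb (Fin.ext h')
      simp [ind, this]
    · simp
  · rw [zero_mul]
    refine Finset.sum_eq_zero fun r _ => ?_
    have : (r : ℕ) ≠ a := fun h' => h (h' ▸ r.2)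
    simp [ind, this]

@[simp] theorem extendZero_self {m : ℕ} (x : Fin m → ℝ) : extendZero x m = 0 := by
  simp [extendZero]

/-! ### The perceptrons -/

/-- The activation function, normalised to `0` at `cs - 1` and `1` at `cs`. -/
noncomputable def gapNorm (σ : ℝ → ℝ) (cs z : ℝ) : ℝ := (σ z - σ (cs - 1)) / (σ cs - σ (cs - 1))

theorem gapNorm_nonpos {σ : ℝ → ℝ} {cs : ℝ} (hσ : GapPreservingAt σ cs) {z : ℝ}
    (hz : z ≤ cs - 1) : gapNorm σ cs z ≤ 0 :=
  div_nonpos_of_nonpos_of_nonneg (sub_nonpos.2 (hσ.2.2 z hz)) (sub_nonneg.2 hσ.2.1.le)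

theorem exists_abs_gapNorm_sub_one_le {σ : ℝ → ℝ} {cs : ℝ} (hc : Continuous σ)
    (hσ : GapPreservingAt σ cs) {η : ℝ} (hη : 0 < η) :
    ∃ δ > 0, ∀ z, |z - cs| ≤ δ → |gapNorm σ cs z - 1| ≤ η := by
  have hcs : σ cs - σ (cs - 1) ≠ 0 := sub_ne_zero.2 hσ.2.1.ne'
  have hcont : ContinuousAt (gapNorm σ cs) cs := by
    unfold gapNorm
    fun_prop
  obtain ⟨δ, hδ, h⟩ := Metric.continuousAt_iff.1 hcont η hη
  refine ⟨δ / 2, by positivity, fun z hz => ?_⟩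
  have := h (x := z) (by rw [Real.dist_eq]; linarith)
  rw [Real.dist_eq] at this
  have h1 : gapNorm σ cs cs = 1 := div_self hcs
  rw [h1] at this
  exact this.le

theorem activationMlp_apply {m hid p : ℕ} (σ : ℝ → ℝ) (W₁ : Matrix (Fin (m + 1)) (Fin hid) ℝ)
    (W₂ : Matrix (Fin (hid + 1)) (Fin p) ℝ) (x : Fin m → ℝ) (c : Fin p) :
    activationMlp σ W₁ W₂ x c =
      ∑ k, σ (∑ r, x r * W₁ r.castSucc k + W₁ (Fin.last m) k) * W₂ k.castSucc c +
        W₂ (Fin.last hid) c := by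
  simp [activationMlp, Matrix.vecMul, dotProduct, Fin.sum_univ_castSucc]

/-- Each hidden unit serves one coordinate. Nothing is known about `σ` between `0` and `1`, so
coordinates can be copied only when they are exactly `0` or `1`; the flag and the accumulator are
exempt because the new values do not copy them. -/
theorem mlp_searchCode_apply {m L H N d : ℕ} {C : ℕ → ℕ → ℤ → ℤ} {σ : ℝ → ℝ} {cs : ℝ}
    (hσ : GapPreservingAt σ cs) (hm : 5 ≤ m) (ℓ : Fin L) (x : Fin m → ℝ) (c : Fin m)
    (hx : (c : ℕ) ≠ 3 → (c : ℕ) ≠ 4 → x c = 0 ∨ x c = 1) :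
    ((searchCode m L H N d C).transformer σ cs).mlp ℓ x c =
      if (c : ℕ) = 3 then gapNorm σ cs (cs - 2 * extendZero x 4)
      else if (c : ℕ) = 4 then 0 else x c := by
  have h01 : σ 1 - σ 0 ≠ 0 := sub_ne_zero.2 hσ.1.symm
  have hu : ∀ k : Fin m, ∑ r : Fin m, x r * (realMatrix σ cs ((searchCode m L H N d C).w₁ ℓ))
      r.castSucc k + (realMatrix σ cs ((searchCode m L H N d C).w₁ ℓ)) (Fin.last m) k =
        if (k : ℕ) = 3 then cs - 2 * extendZero x 4 else x k := by
    intro k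
    have hk : m ≠ k := k.2.ne'
    have h4 : m ≠ 4 := by omega
    simp only [realMatrix, searchCode, Matrix.map_apply, Matrix.of_apply, codeOf_w₁Cell_value,
      Fin.val_castSucc, Fin.val_last, mul_add, mul_sub, Finset.sum_add_distrib,
      Finset.sum_sub_distrib, sum_mul_ind, extendZero_fin, extendZero_self]
    split_ifs with h3 <;> simp [ind, hk, h4] <;> ring
  change activationMlp _ _ _ _ _ = _
  rw [activationMlp_apply]
  simp only [hu]
  simp only [realMatrix, searchCode, Matrix.map_apply, Matrix.of_apply, codeOf_w₂Cell_value,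
      Fin.val_castSucc, Fin.val_last]
  have hk : m ≠ c := c.2.ne'
  have hm3 : m ≠ 3 := by omega
  by_cases h3 : (c : ℕ) = 3
  · have := sum_mul_ind (fun k : Fin m => σ (if (k : ℕ) = 3 then cs - 2 * extendZero x 4 else x k))
      3 (1 / (σ cs - σ (cs - 1)))
    simp only [h3, if_true, sub_div, mul_sub, Finset.sum_sub_distrib, mul_div_assoc, hm3]
    have h' := sum_mul_ind
      (fun k : Fin m => σ (if (k : ℕ) = 3 then cs - 2 * extendZero x 4 else x k)) m
      (σ (cs - 1) / (σ cs - σ (cs - 1)))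
    rw [h', extendZero_self]
    simp only [mul_one_div] at this
    rw [this]
    have : 3 < m := by omega
    simp [extendZero, gapNorm, ind, this, sub_div]
    ring
  · by_cases h4 : (c : ℕ) = 4
    · simp [h4]
    · have := sum_mul_ind (fun k : Fin m => σ (if (k : ℕ) = 3 then cs - 2 * extendZero x 4 else x k))
        c (1 / (σ 1 - σ 0))
      simp only [h3, h4, if_false, sub_div, mul_sub, Finset.sum_sub_distrib, mul_div_assoc]
      have h' := sum_mul_ind
        (fun k : Fin m => σ (if (k : ℕ) = 3 then cs - 2 * extendZero x 4 else x k)) m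
        (σ 0 / (σ 1 - σ 0))
      rw [h', extendZero_self]
      simp only [mul_one_div] at this
      rw [this, extendZero_fin]
      rcases hx h3 h4 with h | h <;> simp [ind, hk, h3, h]
      field_simp
      ring

/-- The shift sends a flag at most `0` into the range below `cs - 1` and a flag near `1` close to
`cs`, so the normalised activation separates the two cases again. -/
theorem outMlp_searchCode_apply {m L H N d : ℕ} {C : ℕ → ℕ → ℤ → ℤ} {σ : ℝ → ℝ} {cs : ℝ}
    (hm : 5 ≤ m) (x : Fin m → ℝ) (c : Fin 1) :
    ((searchCode m L H N d C).transformer σ cs).outMlp x c =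
      gapNorm σ cs (cs - 1 + extendZero x 3) := by
  have hm3 : m ≠ 3 := by omega
  have hm0 : m ≠ 0 := by omega
  have hu : ∀ k : Fin m, ∑ r : Fin m, x r * (realMatrix σ cs (searchCode m L H N d C).out₁)
      r.castSucc k + (realMatrix σ cs (searchCode m L H N d C).out₁) (Fin.last m) k =
        if (k : ℕ) = 0 then cs - 1 + extendZero x 3 else 0 := by
    intro k
    simp only [realMatrix, searchCode, Matrix.map_apply, Matrix.of_apply, codeOf_out₁Cell_value,
      Fin.val_castSucc, Fin.val_last, mul_add, Finset.sum_add_distrib, sum_mul_ind,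
      extendZero_self]
    split_ifs with h0 <;> simp [ind, h0, hm3]
    ring
  change activationMlp _ _ _ _ _ = _
  rw [activationMlp_apply]
  simp only [hu]
  simp only [realMatrix, searchCode, Matrix.map_apply, Matrix.of_apply, codeOf_out₂Cell_value,
      Fin.val_castSucc, Fin.val_last]
  have := sum_mul_ind (fun k : Fin m => σ (if (k : ℕ) = 0 then cs - 1 + extendZero x 3 else 0))
    0 (1 / (σ cs - σ (cs - 1)))
  simp only [sub_div, mul_sub, Finset.sum_sub_distrib, mul_div_assoc]
  have h' := sum_mul_ind
    (fun k : Fin m => σ (if (k : ℕ) = 0 then cs - 1 + extendZero x 3 else 0)) m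
    (σ (cs - 1) / (σ cs - σ (cs - 1)))
  rw [h', extendZero_self]
  simp only [mul_one_div] at this
  rw [this]
  have : 0 < m := by omega
  simp [extendZero, gapNorm, ind, hm0, this, sub_div]
  ring

/-! ### Sharp softmax -/

/-- The weight of position `j` under the softmax. -/
noncomputable def softmaxWeight {N : ℕ} (l : Fin N → ℝ) (j : Fin N) : ℝ :=
  Real.exp (l j) / ∑ k, Real.exp (l k)

theorem sum_exp_pos {N : ℕ} (l : Fin N → ℝ) (j : Fin N) : 0 < ∑ k, Real.exp (l k) :=
  Finset.sum_pos (fun _ _ => Real.exp_pos _) ⟨j, Finset.mem_univ j⟩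

/-- Only the term `k` of the denominator is kept. -/
theorem softmaxWeight_le_exp_sub {N : ℕ} (l : Fin N → ℝ) (j k : Fin N) :
    softmaxWeight l j ≤ Real.exp (l j - l k) := by
  rw [Real.exp_sub, softmaxWeight]
  exact div_le_div_of_nonneg_left (Real.exp_pos _).le (Real.exp_pos _)
    (Finset.single_le_sum (fun i _ => (Real.exp_pos (l i)).le) (Finset.mem_univ k))

theorem sum_softmaxWeight {N : ℕ} (l : Fin N → ℝ) (j : Fin N) : ∑ k, softmaxWeight l k = 1 := by
  simp only [softmaxWeight, ← Finset.sum_div]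
  exact div_self (sum_exp_pos l j).ne'

theorem softmaxWeight_le_one {N : ℕ} (l : Fin N → ℝ) (j : Fin N) : softmaxWeight l j ≤ 1 := by
  simpa using softmaxWeight_le_exp_sub l j j

theorem one_sub_softmaxWeight_le {N : ℕ} (l : Fin N → ℝ) (j : Fin N) {g : ℝ}
    (h : ∀ k, k ≠ j → l k ≤ l j - g) : 1 - softmaxWeight l j ≤ N * Real.exp (-g) := by
  have h1 := sum_softmaxWeight l j
  rw [← Finset.add_sum_erase _ _ (Finset.mem_univ j)] at h1
  have h2 : ∑ k ∈ Finset.univ.erase j, softmaxWeight l k ≤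
      ∑ _k ∈ Finset.univ.erase j, Real.exp (-g) := by
    refine Finset.sum_le_sum fun k hk => (softmaxWeight_le_exp_sub l k j).trans ?_
    have := h k (Finset.ne_of_mem_erase hk)
    exact Real.exp_le_exp.2 (by linarith)
  have h3 : ∑ _k ∈ Finset.univ.erase j, Real.exp (-g) ≤ N * Real.exp (-g) := by
    rw [Finset.sum_const, nsmul_eq_mul]
    refine mul_le_mul_of_nonneg_right ?_ (Real.exp_pos _).le
    exact_mod_cast (Finset.card_le_univ _).trans (by simp)
  linarith

/-! ### One layer -/

/-- The rows of `Y` agree with the input outside the coordinates `3` and `4`, and are `0` in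
coordinate `4`. -/
def KeepsInput {N m : ℕ} (d : ℕ) (A B : ℕ → ℤ → ℤ) (Y : Matrix (Fin N) (Fin m) ℝ) : Prop :=
  ∀ (i : Fin N) (c : Fin m), (c : ℕ) ≠ 3 → Y i c = if (c : ℕ) = 4 then 0 else
    (((ind ((c : ℕ) = 0) + ind ((c : ℕ) = 1) * ind ((i : ℕ) = 0) +
      ind ((c : ℕ) = 2) * ind ((i : ℕ) = 1) +
      ind (4 < (c : ℕ)) * ind ((c : ℕ) < 5 + d) * A i ((c : ℤ) - 5) +
      ind (1 < (i : ℕ)) * ind (4 + d < (c : ℕ)) * ind ((c : ℕ) < 5 + 2 * d) *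
        B i ((c : ℤ) - 5 - d) : ℤ)) : ℝ)

theorem keepsInput_searchInput {N m d : ℕ} {A B : ℕ → ℤ → ℤ} {σ : ℝ → ℝ} {cs : ℝ} :
    KeepsInput d A B (realMatrix σ cs (searchInput N m d A B)) := by
  intro i c hc
  simp only [realMatrix, searchInput, Matrix.map_apply, Matrix.of_apply, codeOf_intCell_value, inputEntry]
  split_ifs with h <;> simp [ind, hc, h]

section Layer

variable {N m L H d : ℕ} {A B : ℕ → ℤ → ℤ} {C : ℕ → ℕ → ℤ → ℤ} {σ : ℝ → ℝ} {cs : ℝ}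
  {Y : Matrix (Fin N) (Fin m) ℝ}

/-- The summands of an entry live on disjoint sets of coordinates, so at most one of them is
nonzero. -/
theorem KeepsInput.zero_or_one (hY : KeepsInput d A B Y) (hA : ∀ i k, A i k = 0 ∨ A i k = 1)
    (hB : ∀ i k, B i k = 0 ∨ B i k = 1) (i : Fin N) (c : Fin m) (h3 : (c : ℕ) ≠ 3)
    (h4 : (c : ℕ) ≠ 4) : Y i c = 0 ∨ Y i c = 1 := by
  rw [hY i c h3, if_neg h4]
  have hcast : ∀ z : ℤ, z = 0 ∨ z = 1 → (z : ℝ) = 0 ∨ (z : ℝ) = 1 := by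
    rintro z (rfl | rfl) <;> simp
  refine hcast _ ?_
  rcases lt_or_ge (c : ℕ) 5 with hc | hc
  · have h1 : ¬ 4 < (c : ℕ) := by omega
    have h2 : ¬ 4 + d < (c : ℕ) := by omega
    simp only [ind, h1, h2, if_false]
    split_ifs <;> simp <;> omega
  · have h1 : (c : ℕ) ≠ 0 := by omega
    have h2 : (c : ℕ) ≠ 1 := by omega
    have h5 : (c : ℕ) ≠ 2 := by omega
    simp only [ind, h1, h2, h5, if_false]
    rcases lt_or_ge (c : ℕ) (5 + d) with hc' | hc'
    · have h6 : ¬ 4 + d < (c : ℕ) := by omega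
      have := hA i ((c : ℤ) - 5)
      have h7 : 4 < (c : ℕ) := by omega
      simpa [h6, hc', h7] using this
    · have h6 : ¬ (c : ℕ) < 5 + d := by omega
      simp only [h6, if_false]
      rcases hB i ((c : ℤ) - 5 - d) with h | h <;> rw [h] <;> split_ifs <;> simp

theorem KeepsInput.extend_zero (hY : KeepsInput d A B Y) (hm : 5 ≤ m) (i : Fin N) :
    extendZero (Y i) 0 = 1 := by
  have h : 0 < m := by omega
  simp [extendZero, h, hY i ⟨0, h⟩, ind]

theorem KeepsInput.extend_one (hY : KeepsInput d A B Y) (hm : 5 ≤ m) (i : Fin N) :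
    extendZero (Y i) 1 = (ind ((i : ℕ) = 0) : ℤ) := by
  have h : 1 < m := by omega
  simp [extendZero, h, hY i ⟨1, h⟩, ind]

theorem KeepsInput.extend_two (hY : KeepsInput d A B Y) (hm : 5 ≤ m) (i : Fin N) :
    extendZero (Y i) 2 = (ind ((i : ℕ) = 1) : ℤ) := by
  have h : 2 < m := by omega
  simp [extendZero, h, hY i ⟨2, h⟩, ind]
  omega

theorem KeepsInput.apply_left (hY : KeepsInput d A B Y) (i : Fin N) (c : Fin m)
    (h1 : 4 < (c : ℕ)) (h2 : (c : ℕ) < 5 + d) : Y i c = A i ((c : ℤ) - 5) := by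
  have h3 : (c : ℕ) ≠ 3 := by omega
  have h4 : (c : ℕ) ≠ 4 := by omega
  have h5 : (c : ℕ) ≠ 0 := by omega
  have h6 : (c : ℕ) ≠ 1 := by omega
  have h7 : (c : ℕ) ≠ 2 := by omega
  have h8 : ¬ 4 + d < (c : ℕ) := by omega
  simp [hY i c h3, ind, h1, h2, h4, h5, h6, h7, h8]

theorem KeepsInput.extend_right (hY : KeepsInput d A B Y) (hm : 2 * d + 5 ≤ m) (i : Fin N) (c : ℕ)
    (h1 : 4 < c) (h2 : c < 5 + d) :
    extendZero (Y i) (c + d) = (ind (1 < (i : ℕ)) * B i ((c : ℤ) - 5) : ℤ) := by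
  have h3 : c + d ≠ 3 := by omega
  have h4 : c + d ≠ 4 := by omega
  have h5 : c + d ≠ 0 := by omega
  have h6 : c + d ≠ 1 := by omega
  have h7 : c + d ≠ 2 := by omega
  have h8 : ¬ c + d < 5 + d := by omega
  have h9 : 4 + d < c + d := by omega
  have h10 : c + d < 5 + 2 * d := by omega
  have h : c + d < m := by omega
  have h11 : (c : ℤ) + d - 5 - d = c - 5 := by ring
  simp [extendZero, h, hY i ⟨c + d, h⟩ h3, ind, h4, h6, h7, h8, h9, h10, h11]
  omega

/-- The logit of position `j` seen from position `i`. -/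
noncomputable def logit (σ : ℝ → ℝ) (cs : ℝ) (T : TransformerCode m L H m)
    (Y : Matrix (Fin N) (Fin m) ℝ) (ℓ : Fin L) (h : Fin H) (i j : Fin N) : ℝ :=
  ∑ c, Matrix.vecMul (Y i) (realMatrix σ cs (T.query ℓ h)) c *
    Matrix.vecMul (Y j) (realMatrix σ cs (T.key ℓ h)) c

theorem head_apply (T : TransformerCode m L H m) (ℓ : Fin L) (h : Fin H) (i : Fin N) (c : Fin m) :
    (((T.transformer σ cs).head ℓ h).apply Y) i c =
      ∑ j, softmaxWeight (logit σ cs T Y ℓ h i) j *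
        Matrix.vecMul (Y j) (realMatrix σ cs (T.value ℓ h)) c := by
  simp [AttentionHead.apply, Matrix.mul_apply, softmaxRows, rowWise, softmaxWeight, logit,
    TransformerCode.transformer]

theorem vecMul_query (ℓ : Fin L) (h : Fin H) (x : Fin m → ℝ) (c : Fin m) :
    Matrix.vecMul x (realMatrix σ cs ((searchCode m L H N d C).query ℓ h)) c =
      x c * ((ind (4 < (c : ℕ)) * ind ((c : ℕ) < 5 + d) *
        (-2 * N * C ℓ h ((c : ℤ) - 5)) : ℤ)) -
      extendZero x 0 * (ind ((c : ℕ) = 1) * N : ℤ) +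
      extendZero x 0 * (ind ((c : ℕ) = 2) * (4 * N) : ℤ) -
      extendZero x 3 * (ind ((c : ℕ) = 2) * (8 * N) : ℤ) := by
  simp only [Matrix.vecMul, dotProduct, realMatrix, searchCode, Matrix.map_apply, Matrix.of_apply]
  simp only [codeOf_intCell_value, queryEntry, mul_assoc (ind (_ = _))]
  simp only [Int.cast_add, Int.cast_sub, mul_add, mul_sub, Finset.sum_add_distrib,
    Finset.sum_sub_distrib]
  simp only [Int.cast_mul (ind (_ = _)), sum_mul_ind, extendZero_fin]

theorem vecMul_key (ℓ : Fin L) (h : Fin H) (x : Fin m → ℝ) (c : Fin m) :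
    Matrix.vecMul x (realMatrix σ cs ((searchCode m L H N d C).key ℓ h)) c =
      x c * (ind ((c : ℕ) = 1) + ind ((c : ℕ) = 2) : ℤ) +
      extendZero x (c + d) * (ind (4 < (c : ℕ)) * ind ((c : ℕ) < 5 + d) : ℤ) := by
  simp only [Matrix.vecMul, dotProduct, realMatrix, searchCode, Matrix.map_apply, Matrix.of_apply]
  simp only [codeOf_intCell_value, keyEntry, mul_assoc (ind (_ = _ + _))]
  simp only [Int.cast_add, mul_add, Finset.sum_add_distrib, Int.cast_mul (ind (_ = _)),
    sum_mul_ind, extendZero_fin]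

theorem vecMul_value (ℓ : Fin L) (h : Fin H) (x : Fin m → ℝ) (c : Fin m) :
    Matrix.vecMul x (realMatrix σ cs ((searchCode m L H N d C).value ℓ h)) c =
      (extendZero x 0 - extendZero x 1) * (ind ((c : ℕ) = 4) : ℤ) := by
  simp only [Matrix.vecMul, dotProduct, realMatrix, searchCode, Matrix.map_apply, Matrix.of_apply]
  simp only [codeOf_intCell_value, valueEntry, sub_mul]
  simp only [Int.cast_sub, mul_sub, Finset.sum_sub_distrib, Int.cast_mul, sum_mul_ind]

/-- The values are `1` off the decoy and the softmax weights sum to `1`, so the head outputs the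
attention that is not paid to the decoy. -/
theorem KeepsInput.head_apply (hY : KeepsInput d A B Y) (hm : 5 ≤ m) (ℓ : Fin L) (h : Fin H)
    (i : Fin N) (z : Fin N) (hz : (z : ℕ) = 0) (c : Fin m) :
    ((((searchCode m L H N d C).transformer σ cs).head ℓ h).apply Y) i c =
      (1 - softmaxWeight (logit σ cs (searchCode m L H N d C) Y ℓ h i) z) *
        (ind ((c : ℕ) = 4) : ℤ) := by
  rw [_root_.head_apply]
  simp only [vecMul_value, hY.extend_zero hm, hY.extend_one hm, ← mul_assoc, ← Finset.sum_mul]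
  congr 1
  simp only [mul_sub, Finset.sum_sub_distrib, mul_one, sum_softmaxWeight _ z]
  congr 1
  rw [Finset.sum_eq_single z]
  · simp [ind, hz]
  · intro j _ hj
    have : (j : ℕ) ≠ 0 := fun h' => hj (Fin.ext (h'.trans hz.symm))
    simp [ind, this]
  · simp

/-- The coordinates of the scalar product split into the decoy term, the memory term and the count
of common ones; all other coordinates of the key vanish. -/
theorem KeepsInput.logit_apply (hY : KeepsInput d A B Y) (hm : 2 * d + 5 ≤ m) (ℓ : Fin L)
    (h : Fin H) (i j : Fin N) :
    logit σ cs (searchCode m L H N d C) Y ℓ h i j =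
      -(N * (ind ((j : ℕ) = 0) : ℤ)) +
      (4 * N - 8 * N * extendZero (Y i) 3) * (ind ((j : ℕ) = 1) : ℤ) +
      ∑ c : Fin m, ((ind (4 < (c : ℕ)) * ind ((c : ℕ) < 5 + d) * ind (1 < (j : ℕ)) * (-2 * N *
        (A i ((c : ℤ) - 5) * B j ((c : ℤ) - 5) * C ℓ h ((c : ℤ) - 5))) : ℤ) : ℝ) := by
  have hterm : ∀ c : Fin m,
      Matrix.vecMul (Y i) (realMatrix σ cs ((searchCode m L H N d C).query ℓ h)) c *
      Matrix.vecMul (Y j) (realMatrix σ cs ((searchCode m L H N d C).key ℓ h)) c =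
      Y j c * ((ind ((c : ℕ) = 1) : ℤ) * (-N : ℝ)) +
      Y j c * ((ind ((c : ℕ) = 2) : ℤ) * (4 * N - 8 * N * extendZero (Y i) 3)) +
      ((ind (4 < (c : ℕ)) * ind ((c : ℕ) < 5 + d) * ind (1 < (j : ℕ)) * (-2 * N *
        (A i ((c : ℤ) - 5) * B j ((c : ℤ) - 5) * C ℓ h ((c : ℤ) - 5))) : ℤ) : ℝ) := by
    intro c
    rw [vecMul_query, vecMul_key, hY.extend_zero (by omega)]
    by_cases hc : 4 < (c : ℕ) ∧ (c : ℕ) < 5 + d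
    · have h1 : (c : ℕ) ≠ 1 := by omega
      have h2 : (c : ℕ) ≠ 2 := by omega
      rw [hY.extend_right hm j c hc.1 hc.2, hY.apply_left i c hc.1 hc.2]
      simp only [ind_of hc.1, ind_of hc.2, ind_not h1, ind_not h2]
      push_cast
      ring
    · have : ind (4 < (c : ℕ)) * ind ((c : ℕ) < 5 + d) = 0 := by
        simp only [ind]
        split_ifs <;> simp_all
      rw [this]
      by_cases h1 : (c : ℕ) = 1
      · have h2 : (c : ℕ) ≠ 2 := by omega
        simp only [ind_of h1, ind_not h2]
        push_cast
        ring
      · by_cases h2 : (c : ℕ) = 2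
        · simp only [ind_of h2, ind_not h1]
          push_cast
          ring
        · simp only [ind_not h1, ind_not h2]
          push_cast
          ring
  rw [logit, Finset.sum_congr rfl fun c _ => hterm c, Finset.sum_add_distrib,
    Finset.sum_add_distrib, sum_mul_ind, sum_mul_ind, hY.extend_one (by omega),
    hY.extend_two (by omega)]
  ring

/-- The vectors `A i`, some `B j` and `C ℓ h` have no common `1`. -/
def HitsAt (N d : ℕ) (A B : ℕ → ℤ → ℤ) (C : ℤ → ℤ) (i : ℕ) : Prop :=
  ∃ j, 2 ≤ j ∧ j < N ∧ ∀ k : ℕ, k < d → A i k * B j k * C k = 0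

theorem logit_zero (hY : KeepsInput d A B Y) (hm : 2 * d + 5 ≤ m) (ℓ : Fin L)
    (h : Fin H) (i j : Fin N) (hj : (j : ℕ) = 0) :
    logit σ cs (searchCode m L H N d C) Y ℓ h i j = -N := by
  rw [hY.logit_apply hm, Finset.sum_eq_zero]
  · simp [ind, hj]
  · simp [ind, hj]

theorem logit_one (hY : KeepsInput d A B Y) (hm : 2 * d + 5 ≤ m) (ℓ : Fin L)
    (h : Fin H) (i j : Fin N) (hj : (j : ℕ) = 1) :
    logit σ cs (searchCode m L H N d C) Y ℓ h i j = 4 * N - 8 * N * extendZero (Y i) 3 := by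
  rw [hY.logit_apply hm, Finset.sum_eq_zero]
  · simp [ind, hj]
  · simp [ind, hj]

theorem logit_eq_zero (hY : KeepsInput d A B Y) (hm : 2 * d + 5 ≤ m) (ℓ : Fin L)
    (h : Fin H) (i j : Fin N) (hj : 2 ≤ (j : ℕ))
    (hit : ∀ k : ℕ, k < d → A i k * B j k * C ℓ h k = 0) :
    logit σ cs (searchCode m L H N d C) Y ℓ h i j = 0 := by
  have h0 : (j : ℕ) ≠ 0 := by omega
  have h1 : (j : ℕ) ≠ 1 := by omega
  rw [hY.logit_apply hm, Finset.sum_eq_zero]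
  · simp [ind, h0, h1]
  · intro c _
    by_cases hc : 4 < (c : ℕ) ∧ (c : ℕ) < 5 + d
    · have := hit ((c : ℕ) - 5) (by omega)
      rw [Nat.cast_sub (by omega)] at this
      push_cast at this
      rw [this]
      simp
    · have : ind (4 < (c : ℕ)) * ind ((c : ℕ) < 5 + d) = 0 := by
        simp only [ind]
        split_ifs <;> simp_all
      rw [this]
      simp

/-- The number of common ones is an integer, so one common coordinate already pushes the logit a
full `N` below the decoy. -/
theorem logit_le (hY : KeepsInput d A B Y) (hm : 2 * d + 5 ≤ m)
    (hA : ∀ i k, A i k = 0 ∨ A i k = 1) (hB : ∀ i k, B i k = 0 ∨ B i k = 1)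
    (hC : ∀ ℓ h k, C ℓ h k = 0 ∨ C ℓ h k = 1) (ℓ : Fin L)
    (h : Fin H) (i j : Fin N) (hj : 2 ≤ (j : ℕ)) {k : ℕ} (hk : k < d)
    (hit : A i k * B j k * C ℓ h k ≠ 0) :
    logit σ cs (searchCode m L H N d C) Y ℓ h i j ≤ -(2 * N) := by
  have h0 : (j : ℕ) ≠ 0 := by omega
  have h1 : (j : ℕ) ≠ 1 := by omega
  have hk' : k + 5 < m := by omega
  rw [hY.logit_apply hm]
  -- No summand is positive, and the one at coordinate `k + 5` equals `-2N`.
  have hle : ∀ c : Fin m, ((ind (4 < (c : ℕ)) * ind ((c : ℕ) < 5 + d) * ind (1 < (j : ℕ)) *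
      (-2 * N * (A i ((c : ℤ) - 5) * B j ((c : ℤ) - 5) * C ℓ h ((c : ℤ) - 5))) : ℤ) : ℝ) ≤
      if c = ⟨k + 5, hk'⟩ then -(2 * (N : ℝ)) else 0 := by
    intro c
    split_ifs with hc
    · subst hc
      have hprod : A i k * B j k * C ℓ h k = 1 := by
        rcases hA i k with a | a <;> rcases hB j k with b | b <;> rcases hC ℓ h k with c | c <;>
          simp [a, b, c] at hit ⊢
      have h2 : (((⟨k + 5, hk'⟩ : Fin m) : ℕ) : ℤ) - 5 = k := by simp
      rw [h2, hprod]
      have h4 : 1 < (j : ℕ) := by omega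
      simp [ind, h4, hk, add_comm 5 d]
    · have : A i ((c : ℤ) - 5) * B j ((c : ℤ) - 5) * C ℓ h ((c : ℤ) - 5) ∈ Set.Icc (0 : ℤ) 1 := by
        rcases hA i ((c : ℤ) - 5) with a | a <;> rcases hB j ((c : ℤ) - 5) with b | b <;>
          rcases hC ℓ h ((c : ℤ) - 5) with c | c <;> simp [a, b, c]
      have hi := mul_mem_Icc_zero_one (mul_mem_Icc_zero_one (ind_mem_Icc (4 < (c : ℕ)))
        (ind_mem_Icc ((c : ℕ) < 5 + d))) (ind_mem_Icc (1 < (j : ℕ)))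
      have h5 := mul_nonneg hi.1 (mul_nonneg (Nat.cast_nonneg (α := ℤ) N) this.1)
      have : (ind (4 < (c : ℕ)) * ind ((c : ℕ) < 5 + d) * ind (1 < (j : ℕ)) *
        (-2 * N * (A i ((c : ℤ) - 5) * B j ((c : ℤ) - 5) * C ℓ h ((c : ℤ) - 5))) : ℤ) ≤ 0 := by
        linarith
      exact_mod_cast this
  refine (add_le_add_right (Finset.sum_le_sum fun c _ => hle c) _).trans ?_
  simp [ind, h0, h1]

end Layer

/-! ### The whole transformer -/

section Transformer

variable {N m L H d : ℕ} {A B : ℕ → ℤ → ℤ} {C : ℕ → ℕ → ℤ → ℤ} {σ : ℝ → ℝ} {cs : ℝ}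

/-- `r` lies close to the number of heads that attend to something else than position `0`. -/
theorem layer_apply {Y : Matrix (Fin N) (Fin m) ℝ} (hσ : GapPreservingAt σ cs)
    (hA : ∀ i k, A i k = 0 ∨ A i k = 1) (hB : ∀ i k, B i k = 0 ∨ B i k = 1)
    (hY : KeepsInput d A B Y) (hm : 5 ≤ m) (ℓ : Fin L) (z : Fin N) (hz : (z : ℕ) = 0) (i : Fin N)
    (c : Fin m) :
    rowWise (((searchCode m L H N d C).transformer σ cs).mlp ℓ)
        (Y + ∑ j : Fin H, (((searchCode m L H N d C).transformer σ cs).head ℓ j).apply Y) i c =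
      if (c : ℕ) = 3 then gapNorm σ cs (cs - 2 * ∑ h : Fin H,
        (1 - softmaxWeight (logit σ cs (searchCode m L H N d C) Y ℓ h i) z))
      else if (c : ℕ) = 4 then 0 else Y i c := by
  have hrow : ∀ c : Fin m, (Y + ∑ j : Fin H,
      (((searchCode m L H N d C).transformer σ cs).head ℓ j).apply Y) i c = Y i c +
      (∑ h : Fin H, (1 - softmaxWeight (logit σ cs (searchCode m L H N d C) Y ℓ h i) z)) *
        (ind ((c : ℕ) = 4) : ℤ) := by
    intro c
    rw [Matrix.add_apply, Matrix.sum_apply, Finset.sum_mul]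
    congr 1
    exact Finset.sum_congr rfl fun h _ => hY.head_apply hm ℓ h i z hz c
  change (((searchCode m L H N d C).transformer σ cs).mlp ℓ) (fun c => _) c = _
  rw [mlp_searchCode_apply hσ hm]
  · have h4 : 4 < m := by omega
    have hY4 : Y i ⟨4, h4⟩ = 0 := by rw [hY i ⟨4, h4⟩ (by simp)]; simp
    split_ifs with hc hc'
    · simp only [extendZero, h4, dif_pos, hrow, hY4]
      simp [ind]
    · rfl
    · rw [hrow]
      simp [ind, hc']
  · intro h3 h4
    rw [hrow]
    simpa [ind, h4] using hY.zero_or_one hA hB i c h3 h4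

/-- Induction on the layer. The hypothesis on the flag is needed only through `flag ≤ 0` or `flag ≥
3/4`, which decides the logit of token `1`; the conclusion `|flag - 1| ≤ η` is produced afresh in
every layer from `2 H N exp(-N) ≤ δ`, so the bound is the same for every depth. -/
theorem embedding_searchCode (hσ : GapPreservingAt σ cs)
    (hA : ∀ i k, A i k = 0 ∨ A i k = 1) (hB : ∀ i k, B i k = 0 ∨ B i k = 1)
    (hC : ∀ ℓ h k, C ℓ h k = 0 ∨ C ℓ h k = 1) (hm : 2 * d + 5 ≤ m) (hH : 1 ≤ H) (hN : 3 ≤ N)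
    {η δ : ℝ} (hη : 0 ≤ η) (hη' : η ≤ 1 / 4) (hδ : ∀ z, |z - cs| ≤ δ → |gapNorm σ cs z - 1| ≤ η)
    (hNδ : 2 * (H * (N * Real.exp (-N))) ≤ δ) (ℓ : ℕ) (hℓ : ℓ ≤ L) :
    KeepsInput d A B (((searchCode m L H N d C).transformer σ cs).embedding
        (realMatrix σ cs (searchInput N m d A B)) ℓ) ∧
      ∀ i : Fin N,
        ((∃ ℓ' < ℓ, ∃ h < H, HitsAt N d A B (C ℓ' h) i) →
          extendZero (((searchCode m L H N d C).transformer σ cs).embedding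
            (realMatrix σ cs (searchInput N m d A B)) ℓ i) 3 ≤ 0) ∧
        ((¬ ∃ ℓ' < ℓ, ∃ h < H, HitsAt N d A B (C ℓ' h) i) →
          |extendZero (((searchCode m L H N d C).transformer σ cs).embedding
            (realMatrix σ cs (searchInput N m d A B)) ℓ i) 3 - 1| ≤ η) := by
  have h3 : 3 < m := by omega
  have hNpos : (0 : ℝ) < N := by exact_mod_cast (by omega : 0 < N)
  induction ℓ with
  | zero =>
    refine ⟨keepsInput_searchInput, fun i => ⟨by simp, fun _ => ?_⟩⟩
    have : extendZero (realMatrix σ cs (searchInput N m d A B) i) 3 = 1 := by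
      simp only [extendZero, h3, dif_pos, realMatrix, searchInput, Matrix.map_apply,
        Matrix.of_apply, codeOf_intCell_value, inputEntry]
      simp [ind]
      omega
    simp [Transformer.embedding, this, hη]
  | succ ℓ ih =>
    have hℓ' : ℓ < L := by omega
    obtain ⟨hY, hflag⟩ := ih hℓ'.le
    simp only [Transformer.embedding, hℓ', dif_pos]
    set Y := ((searchCode m L H N d C).transformer σ cs).embedding
      (realMatrix σ cs (searchInput N m d A B)) ℓ with hYdef
    have hz : ((⟨0, by omega⟩ : Fin N) : ℕ) = 0 := rfl
    have hlayer := layer_apply (L := L) (H := H) (C := C) hσ hA hB hY (by omega) ⟨ℓ, hℓ'⟩ _ hz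
    refine ⟨fun i c hc => ?_, fun i => ?_⟩
    · rw [hlayer, if_neg hc]
      split_ifs with h4
      · rfl
      · rw [hY i c hc, if_neg h4]
    · have h3' : extendZero (rowWise (((searchCode m L H N d C).transformer σ cs).mlp ⟨ℓ, hℓ'⟩)
          (Y + ∑ j : Fin H,
            (((searchCode m L H N d C).transformer σ cs).head ⟨ℓ, hℓ'⟩ j).apply Y) i) 3 =
          gapNorm σ cs (cs - 2 * ∑ h : Fin H, (1 - softmaxWeight
            (logit σ cs (searchCode m L H N d C) Y ⟨ℓ, hℓ'⟩ h i) ⟨0, by omega⟩)) := by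
        simp only [extendZero, h3, dif_pos]
        rw [hlayer]
        simp
      rw [h3']
      have hexp : Real.exp (-(N : ℝ)) ≤ 1 / 2 := by
        have h2 : (2 : ℝ) ≤ Real.exp N := by
          have := Real.add_one_le_exp (N : ℝ)
          have : (3 : ℝ) ≤ N := by exact_mod_cast hN
          linarith
        rw [Real.exp_neg, one_div]
        exact inv_anti₀ (by norm_num) h2
      -- A single nonnegative logit leaves the decoy of that head at most `exp(-N) ≤ 1/2`, and the
      -- other heads contribute nonnegative amounts.
      have hbig : ∀ (h : Fin H) (j : Fin N), 0 ≤
          logit σ cs (searchCode m L H N d C) Y ⟨ℓ, hℓ'⟩ h i j → 1 / 2 ≤ ∑ h : Fin H,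
          (1 - softmaxWeight (logit σ cs (searchCode m L H N d C) Y ⟨ℓ, hℓ'⟩ h i)
            ⟨0, by omega⟩) := by
        intro h j hj
        have h1 := softmaxWeight_le_exp_sub
          (logit σ cs (searchCode m L H N d C) Y ⟨ℓ, hℓ'⟩ h i) ⟨0, by omega⟩ j
        rw [logit_zero hY hm _ _ _ _ hz] at h1
        have h2 : Real.exp (-(N : ℝ) -
            logit σ cs (searchCode m L H N d C) Y ⟨ℓ, hℓ'⟩ h i j) ≤ Real.exp (-(N : ℝ)) :=
          Real.exp_le_exp.2 (by linarith)
        refine le_trans ?_ (Finset.single_le_sum (f := fun h => 1 - softmaxWeight (logit σ cs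
          (searchCode m L H N d C) Y ⟨ℓ, hℓ'⟩ h i) ⟨0, by omega⟩)
          (fun h _ => sub_nonneg.2 (softmaxWeight_le_one _ _)) (Finset.mem_univ h))
        linarith
      constructor
      · rintro ⟨ℓ', hlt, h, hh, hit⟩
        refine gapNorm_nonpos hσ ?_
        suffices 1 / 2 ≤ ∑ h : Fin H, (1 - softmaxWeight
            (logit σ cs (searchCode m L H N d C) Y ⟨ℓ, hℓ'⟩ h i) ⟨0, by omega⟩) by linarith
        rcases Nat.lt_succ_iff_lt_or_eq.1 hlt with hlt | rfl
        -- An earlier hit is seen through token `1`; any head serves, and head `0` exists since `1 ≤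
        -- H`.
        · have hf := (hflag i).1 ⟨ℓ', hlt, h, hh, hit⟩
          refine hbig ⟨0, by omega⟩ ⟨1, by omega⟩ ?_
          rw [logit_one hY hm _ _ _ _ rfl]
          nlinarith
        · obtain ⟨j, hj2, hjN, hk⟩ := hit
          refine hbig ⟨h, hh⟩ ⟨j, hjN⟩ ?_
          rw [logit_eq_zero hY hm _ _ _ _ hj2 hk]
      · intro hno
        have hno' : ¬ ∃ ℓ' < ℓ, ∃ h < H, HitsAt N d A B (C ℓ' h) i := by
          rintro ⟨ℓ', hlt, hrest⟩
          exact hno ⟨ℓ', by omega, hrest⟩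
        have hf := abs_le.1 ((hflag i).2 hno')
        apply hδ
        -- Without a hit the decoy leads every other token by at least `N`: token `1` since the flag
        -- is at least `1 - η ≥ 3/4`, the others by `logit_le`.
        have hsum : ∑ h : Fin H, (1 - softmaxWeight (logit σ cs (searchCode m L H N d C) Y
            ⟨ℓ, hℓ'⟩ h i) ⟨0, by omega⟩) ≤ ∑ _h : Fin H, (N * Real.exp (-N) : ℝ) := by
          refine Finset.sum_le_sum fun h _ => one_sub_softmaxWeight_le _ _ fun j hj => ?_
          have hj0 : (j : ℕ) ≠ 0 := fun h' => hj (Fin.ext h')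
          rw [logit_zero hY hm _ _ _ _ hz]
          by_cases hj1 : (j : ℕ) = 1
          · rw [logit_one hY hm _ _ _ _ hj1]
            nlinarith
          · have hnot : ¬ ∀ k : ℕ, k < d → A i k * B j k * C ℓ h k = 0 := fun hk =>
              hno ⟨ℓ, by omega, h, h.2, j, by omega, j.2, hk⟩
            push Not at hnot
            obtain ⟨k, hk, hne⟩ := hnot
            have := logit_le (σ := σ) (cs := cs) hY hm hA hB hC ⟨ℓ, hℓ'⟩ h i j (by omega) hk hne
            linarith
        have hnonneg : 0 ≤ ∑ h : Fin H, (1 - softmaxWeight (logit σ cs (searchCode m L H N d C) Y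
            ⟨ℓ, hℓ'⟩ h i) ⟨0, by omega⟩) :=
          Finset.sum_nonneg fun h _ => sub_nonneg.2 (softmaxWeight_le_one _ _)
        simp only [Finset.sum_const, Finset.card_univ, Fintype.card_fin, nsmul_eq_mul] at hsum
        rw [abs_le]
        constructor <;> linarith

/-- The threshold for `N` depends only on `σ`, `cs` and `k`, since the only asymptotic requirement
is `2 N^(k+1) exp(-N) < δ`. It is uniform in the vectors and in the number of layers. -/
theorem apply_searchCode (hc : Continuous σ) (hσ : GapPreservingAt σ cs) (k : ℕ) :
    ∀ᶠ N : ℕ in Filter.atTop, ∀ (m L H d : ℕ) (A B : ℕ → ℤ → ℤ) (C : ℕ → ℕ → ℤ → ℤ),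
      (∀ i k, A i k = 0 ∨ A i k = 1) → (∀ i k, B i k = 0 ∨ B i k = 1) →
      (∀ ℓ h k, C ℓ h k = 0 ∨ C ℓ h k = 1) → 2 * d + 5 ≤ m → 1 ≤ H → H ≤ N ^ k →
      ∀ i : Fin N,
        ((∃ ℓ < L, ∃ h < H, HitsAt N d A B (C ℓ h) i) →
          ((searchCode m L H N d C).transformer σ cs).apply
            (realMatrix σ cs (searchInput N m d A B)) i 0 ≤ 0) ∧
        ((¬ ∃ ℓ < L, ∃ h < H, HitsAt N d A B (C ℓ h) i) →
          3 / 4 ≤ ((searchCode m L H N d C).transformer σ cs).apply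
            (realMatrix σ cs (searchInput N m d A B)) i 0) := by
  -- Continuity at `cs` is used twice: `η` is the accuracy of the flag that the output perceptron
  -- tolerates, and `δ` the accuracy of the head sum that yields such a flag in each layer.
  obtain ⟨η, hη, hη1⟩ := exists_abs_gapNorm_sub_one_le hc hσ (η := 1 / 4) (by norm_num)
  obtain ⟨δ, hδ, hδ1⟩ := exists_abs_gapNorm_sub_one_le hc hσ (η := min η (1 / 4)) (by positivity)
  have hlim : Filter.Tendsto (fun N : ℕ => 2 * ((N : ℝ) ^ (k + 1) * Real.exp (-N)))
      Filter.atTop (nhds (2 * 0)) :=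
    ((Real.tendsto_pow_mul_exp_neg_atTop_nhds_zero (k + 1)).comp
      tendsto_natCast_atTop_atTop).const_mul 2
  rw [mul_zero] at hlim
  filter_upwards [hlim.eventually (gt_mem_nhds hδ), Filter.eventually_ge_atTop 3] with N hNδ hN
  intro m L H d A B C hA hB hC hm hH hHk i
  have hNδ' : 2 * (H * (N * Real.exp (-N))) ≤ δ := by
    have h1 : (H : ℝ) ≤ (N : ℝ) ^ k := by exact_mod_cast hHk
    have h2 : (H : ℝ) * (N * Real.exp (-N)) ≤ (N : ℝ) ^ k * (N * Real.exp (-N)) := by gcongr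
    rw [pow_succ] at hNδ
    nlinarith
  obtain ⟨-, hflag⟩ := embedding_searchCode hσ hA hB hC hm hH hN (by positivity)
    (min_le_right η (1 / 4)) hδ1 hNδ' L le_rfl
  have hout : ((searchCode m L H N d C).transformer σ cs).apply
      (realMatrix σ cs (searchInput N m d A B)) i 0 = gapNorm σ cs (cs - 1 + extendZero
        (((searchCode m L H N d C).transformer σ cs).embedding
          (realMatrix σ cs (searchInput N m d A B)) L i) 3) :=
    outMlp_searchCode_apply (by omega) _ 0
  rw [hout]
  constructor
  · intro hyes
    have := (hflag i).1 hyes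
    exact gapNorm_nonpos hσ (by linarith)
  · intro hno
    have h1 := ((hflag i).2 hno).trans (min_le_left _ _)
    have h2 := abs_le.1 (hη1 _ (by
      have : cs - 1 + extendZero (((searchCode m L H N d C).transformer σ cs).embedding
          (realMatrix σ cs (searchInput N m d A B)) L i) 3 - cs = extendZero
          (((searchCode m L H N d C).transformer σ cs).embedding
          (realMatrix σ cs (searchInput N m d A B)) L i) 3 - 1 := by ring
      rw [this]
      exact h1))
    linarith

end Transformer

/-! ### Cells of the encodings -/

theorem codeOf_cells (f : ℕ → ℤ) {t : ℕ} (ht : t < 12) : (codeOf f).cells t = f t := by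
  interval_cases t <;> simp [RealCode.cells, codeOf, listCells, List.ofFn_succ]

/-- Replacing the family over `Fin n` by a function of natural numbers removes dependent indices, so
that nested blocks become iterated quotients and remainders of the position. -/
theorem blocks_eq {n : ℕ} {len : ℕ} (hlen : 0 < len) (f : Fin n → ℕ → ℤ) (g : ℕ → ℕ → ℤ)
    (hfg : ∀ i x, x < len → f i x = g i x) (x : ℕ) :
    blocks len f x = if x < n * len then g (x / len) (x % len) else 0 := by
  unfold blocks
  simp only [Nat.div_lt_iff_lt_mul hlen]
  split_ifs with h
  · exact hfg _ _ (Nat.mod_lt _ hlen)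
  · rfl

theorem matrixCells_codeOf {n p : ℕ} (hp : 0 < p) (f : ℕ → ℕ → ℕ → ℤ) (x : ℕ) :
    matrixCells (Matrix.of fun (i : Fin n) (j : Fin p) => codeOf (f i j)) x =
      if x < n * (p * 12) then f (x / 12 / p) (x / 12 % p) (x % 12) else 0 := by
  unfold matrixCells
  rw [blocks_eq (by omega) _ (fun i y => f i (y / 12) (y % 12))]
  · rw [Nat.mod_mul_left_div_self, Nat.mod_mul_left_mod, mul_comm p 12, Nat.div_div_eq_div_mul]
  · intro i y hy
    rw [blocks_eq (by omega) _ (fun j t => f i j t), if_pos hy]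
    intro j t ht
    exact codeOf_cells _ ht

theorem blocks_matrixCells_codeOf {k n p : ℕ} (hn : 0 < n) (hp : 0 < p)
    (f : ℕ → ℕ → ℕ → ℕ → ℤ) (x : ℕ) :
    blocks (n * (p * 12)) (fun h : Fin k =>
      matrixCells (Matrix.of fun (i : Fin n) (j : Fin p) => codeOf (f h i j))) x =
      if x < k * (n * (p * 12)) then
        f (x / 12 / p / n) (x / 12 / p % n) (x / 12 % p) (x % 12) else 0 := by
  rw [blocks_eq (by positivity) _ (fun h y => f h (y / 12 / p) (y / 12 % p) (y % 12))]
  · have h1 : n * (p * 12) = n * p * 12 := by ring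
    rw [h1, Nat.mod_mul_left_div_self, Nat.mod_mul_left_mod, Nat.mod_mul_left_div_self,
      Nat.mod_mul_left_mod, Nat.div_div_eq_div_mul, Nat.div_div_eq_div_mul,
      show 12 * p * n = n * p * 12 by ring]
  · intro h y hy
    rw [matrixCells_codeOf hp, if_pos hy]

theorem blocks_blocks_matrixCells_codeOf {k' k n p : ℕ} (hk : 0 < k) (hn : 0 < n) (hp : 0 < p)
    (f : ℕ → ℕ → ℕ → ℕ → ℕ → ℤ) (x : ℕ) :
    blocks (k * (n * (p * 12))) (fun ℓ : Fin k' => blocks (n * (p * 12)) fun h : Fin k =>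
      matrixCells (Matrix.of fun (i : Fin n) (j : Fin p) => codeOf (f ℓ h i j))) x =
      if x < k' * (k * (n * (p * 12))) then
        f (x / 12 / p / n / k) (x / 12 / p / n % k) (x / 12 / p % n) (x / 12 % p) (x % 12)
      else 0 := by
  rw [blocks_eq (by positivity) _ (fun ℓ y =>
    f ℓ (y / 12 / p / n) (y / 12 / p % n) (y / 12 % p) (y % 12))]
  · have h1 : k * (n * (p * 12)) = k * n * p * 12 := by ring
    rw [h1, Nat.mod_mul_left_div_self, Nat.mod_mul_left_mod, Nat.mod_mul_left_div_self,
      Nat.mod_mul_left_mod, Nat.mod_mul_left_div_self, Nat.mod_mul_left_mod,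
      Nat.div_div_eq_div_mul, Nat.div_div_eq_div_mul, Nat.div_div_eq_div_mul,
      show x / (k * n * p * 12) = x / 12 / p / n / k by
        rw [Nat.div_div_eq_div_mul, Nat.div_div_eq_div_mul, Nat.div_div_eq_div_mul]
        congr 1
        ring]
    simp only [Nat.div_div_eq_div_mul, mul_assoc]
  · intro h y hy
    rw [blocks_matrixCells_codeOf hn hp, if_pos hy]

/-! ### Arithmetic expressions for the cells -/

namespace RExpr

/-- The remainder. -/
def rem (u v : RExpr) : RExpr := .sub u (.mul v (.div u v))

/-- The indicator of `u = v`. -/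
def eqInd (u v : RExpr) : RExpr :=
  .div (.const 1) (.add (.const 1) (.mul (.sub u v) (.sub u v)))

/-- The indicator of `u < v`, for nonnegative `u` and `v`. -/
def ltInd (u v : RExpr) : RExpr :=
  .sub (.const 1) (.div (.const 1) (.add (.const 1) (.div v (.add u (.const 1)))))

variable {s : Memory} {u v : RExpr}

theorem eval_rem : (rem u v).eval s = u.eval s % v.eval s := by
  simp [rem, eval, Int.emod_def]

theorem one_ediv_eq_zero {z : ℤ} (h : 2 ≤ z) : (1 : ℤ) / z = 0 :=
  Int.ediv_eq_zero_of_lt (by norm_num) (by omega)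

theorem eval_eqInd : (eqInd u v).eval s = ind (u.eval s = v.eval s) := by
  simp only [eqInd, eval, ind]
  split_ifs with h
  · simp [h]
  -- For `u ≠ v` the denominator `1 + (u - v)²` is at least `2`, and the integer quotient is `0`.
  · refine one_ediv_eq_zero ?_
    have : 0 < (u.eval s - v.eval s) * (u.eval s - v.eval s) :=
      mul_self_pos.2 (sub_ne_zero.2 h)
    omega

theorem eval_ltInd {a b : ℕ} (hu : u.eval s = a) (hv : v.eval s = b) :
    (ltInd u v).eval s = ind (a < b) := by
  simp only [ltInd, eval, ind, hu, hv]
  split_ifs with h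
  -- `u < v` holds exactly if the quotient of `v` by `u + 1` is at least `1`.
  · have h1 : (1 : ℤ) ≤ (b : ℤ) / ((a : ℤ) + 1) := by
      rw [Int.le_ediv_iff_mul_le (by positivity)]
      omega
    rw [one_ediv_eq_zero (by omega)]
    norm_num
  · rw [Int.ediv_eq_zero_of_lt (a := (b : ℤ)) (by positivity) (by omega)]
    norm_num

theorem isLow_const (z : ℤ) : (const z).IsLow := trivial
theorem IsLow.add (hu : u.IsLow) (hv : v.IsLow) : (RExpr.add u v).IsLow := ⟨hu, hv⟩
theorem IsLow.sub (hu : u.IsLow) (hv : v.IsLow) : (RExpr.sub u v).IsLow := ⟨hu, hv⟩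
theorem IsLow.mul (hu : u.IsLow) (hv : v.IsLow) : (RExpr.mul u v).IsLow := ⟨hu, hv⟩
theorem IsLow.div (hu : u.IsLow) (hv : v.IsLow) : (RExpr.div u v).IsLow := ⟨hu, hv⟩
theorem IsLow.rem (hu : u.IsLow) (hv : v.IsLow) : (RExpr.rem u v).IsLow := ⟨hu, hv, hu, hv⟩

theorem eval_rem_nat {a b : ℕ} (hu : u.eval s = a) (hv : v.eval s = b) :
    (rem u v).eval s = ((a % b : ℕ) : ℤ) := by
  rw [eval_rem, hu, hv, Int.natCast_mod]

theorem eval_div_nat {a b : ℕ} (hu : u.eval s = a) (hv : v.eval s = b) :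
    (div u v).eval s = ((a / b : ℕ) : ℤ) := by
  simp [eval, hu, hv]

theorem eval_mul_nat {a b : ℕ} (hu : u.eval s = a) (hv : v.eval s = b) :
    (mul u v).eval s = ((a * b : ℕ) : ℤ) := by
  simp [eval, hu, hv]

theorem eval_add_nat {a b : ℕ} (hu : u.eval s = a) (hv : v.eval s = b) :
    (add u v).eval s = ((a + b : ℕ) : ℤ) := by
  simp [eval, hu, hv]

end RExpr

open RExpr in
/-- Coordinate `k` of vector number `u` (modulo the number of vectors) of the family in the
array `a`. -/
def vectorExpr (a : ℕ) (u k : RExpr) : RExpr :=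
  get a (add (mul (rem u (get 1 (const 0))) (get 1 (const 1))) k)

/-- Coordinate `k` of vector number `u` (modulo the number `n` of vectors) of the family stored
in `w`. -/
def vectorAt (w : ℤ → ℤ) (n d u : ℕ) (k : ℤ) : ℤ := w ((u % n : ℕ) * d + k)

theorem eval_vectorExpr {s : Memory} {a n d b : ℕ} {u k : RExpr} (hn : s 1 0 = n) (hd : s 1 1 = d)
    (hu : u.eval s = b) : (vectorExpr a u k).eval s = vectorAt (s a) n d b (k.eval s) := by
  simp only [vectorExpr, RExpr.eval, vectorAt, RExpr.eval_rem, hu, hn, hd, Int.natCast_mod]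

namespace Entry

open RExpr

def intE (z t : RExpr) : RExpr := add (mul (eqInd t (const 0)) z) (eqInd t (const 6))

def inputE (i k : RExpr) : RExpr :=
  add (add (add (add (add (eqInd k (const 0)) (mul (eqInd k (const 1)) (eqInd i (const 0))))
    (mul (eqInd k (const 2)) (eqInd i (const 1)))) (eqInd k (const 3)))
    (mul (mul (ltInd (const 4) k) (ltInd k (add (const 5) (get 1 (const 1)))))
      (vectorExpr 2 (add (var 11) i) (sub k (const 5)))))
    (mul (mul (mul (ltInd (const 1) i) (ltInd (add (const 4) (get 1 (const 1))) k))
      (ltInd k (add (const 5) (mul (const 2) (get 1 (const 1))))))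
      (vectorExpr 3 (add (var 12) i) (sub (sub k (const 5)) (get 1 (const 1)))))

def queryE (ℓ h r c : RExpr) : RExpr :=
  sub (add (sub
    (mul (mul (mul (eqInd r c) (ltInd (const 4) c)) (ltInd c (add (const 5) (get 1 (const 1)))))
      (mul (mul (const (-2)) (var 0))
        (vectorExpr 4 (add (var 13) (add (mul ℓ (var 5)) h)) (sub c (const 5)))))
    (mul (mul (eqInd r (const 0)) (eqInd c (const 1))) (var 0)))
    (mul (mul (eqInd r (const 0)) (eqInd c (const 2))) (mul (const 4) (var 0))))
    (mul (mul (eqInd r (const 3)) (eqInd c (const 2))) (mul (const 8) (var 0)))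

def keyE (r c : RExpr) : RExpr :=
  add (mul (eqInd r c) (add (eqInd c (const 1)) (eqInd c (const 2))))
    (mul (mul (eqInd r (add c (get 1 (const 1)))) (ltInd (const 4) c))
      (ltInd c (add (const 5) (get 1 (const 1)))))

def valueE (r c : RExpr) : RExpr :=
  mul (sub (eqInd r (const 0)) (eqInd r (const 1))) (eqInd c (const 4))

def w₁E (r c t : RExpr) : RExpr :=
  add (intE (sub (mul (eqInd r c) (sub (const 1) (eqInd c (const 3))))
    (mul (mul (const 2) (eqInd r (const 4))) (eqInd c (const 3)))) t)
    (mul (mul (eqInd t (const 1)) (eqInd r (var 3))) (eqInd c (const 3)))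

def w₂E (r c t : RExpr) : RExpr :=
  add (add (sub (sub
    (mul (mul (eqInd t (const 0)) (eqInd r c)) (sub (const 1) (eqInd c (const 4))))
    (mul (mul (mul (eqInd t (const 2)) (eqInd r (var 3))) (sub (const 1) (eqInd c (const 3))))
      (sub (const 1) (eqInd c (const 4)))))
    (mul (mul (eqInd t (const 4)) (eqInd r (var 3))) (eqInd c (const 3))))
    (mul (sub (eqInd t (const 9)) (eqInd t (const 8))) (sub (const 1) (eqInd c (const 3)))))
    (mul (sub (eqInd t (const 11)) (eqInd t (const 10))) (eqInd c (const 3)))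

def out₁E (r c t : RExpr) : RExpr :=
  add (intE (sub (mul (eqInd r (const 3)) (eqInd c (const 0)))
    (mul (eqInd r (var 3)) (eqInd c (const 0)))) t)
    (mul (mul (eqInd t (const 1)) (eqInd r (var 3))) (eqInd c (const 0)))

def out₂E (r t : RExpr) : RExpr :=
  sub (add (sub (mul (eqInd t (const 0)) (eqInd r (const 0)))
    (mul (eqInd t (const 4)) (eqInd r (var 3)))) (eqInd t (const 11))) (eqInd t (const 10))

section Eval

theorem ind_natCast_eq (a b : ℕ) : ind ((a : ℤ) = b) = ind (a = b) := by simp [ind]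
theorem ind_natCast_eq_zero (a : ℕ) : ind ((a : ℤ) = 0) = ind (a = 0) := by simp [ind]
theorem ind_natCast_eq_one (a : ℕ) : ind ((a : ℤ) = 1) = ind (a = 1) := by simp [ind]
theorem ind_natCast_eq_literal (a : ℕ) :
    ind ((a : ℤ) = 2) = ind (a = 2) ∧ ind ((a : ℤ) = 3) = ind (a = 3) ∧
    ind ((a : ℤ) = 4) = ind (a = 4) ∧ ind ((a : ℤ) = 6) = ind (a = 6) ∧
    ind ((a : ℤ) = 8) = ind (a = 8) ∧ ind ((a : ℤ) = 9) = ind (a = 9) ∧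
    ind ((a : ℤ) = 10) = ind (a = 10) ∧ ind ((a : ℤ) = 11) = ind (a = 11) :=
  ⟨ind_natCast_eq a 2, ind_natCast_eq a 3, ind_natCast_eq a 4, ind_natCast_eq a 6,
    ind_natCast_eq a 8, ind_natCast_eq a 9, ind_natCast_eq a 10, ind_natCast_eq a 11⟩
theorem ind_natCast_eq_add (a b c : ℕ) : ind ((a : ℤ) = b + c) = ind (a = b + c) := by
  rw [← ind_natCast_eq, Nat.cast_add]

variable {s : Memory} {n d N m L H o₁ o₂ o₃ : ℕ} {ie ke re ce te le he ze : RExpr}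
  {i k r c t ℓ h : ℕ}

theorem eval_intE {x : ℤ} (hz : ze.eval s = x) (ht : te.eval s = t) :
    (intE ze te).eval s = intCell x t := by
  simp only [intE, eval, eval_eqInd, hz, ht, ind_natCast_eq_zero, ind_natCast_eq_literal, intCell]

theorem eval_inputE (hn : s 1 0 = n) (hd : s 1 1 = d) (h₁ : s 5 11 = o₁) (h₂ : s 5 12 = o₂)
    (hi : ie.eval s = i) (hk : ke.eval s = k) :
    (inputE ie ke).eval s = inputEntry d (fun i => vectorAt (s 2) n d (o₁ + i))
      (fun i => vectorAt (s 3) n d (o₂ + i)) i k := by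
  have hd' : (get 1 (const 1)).eval s = d := hd
  have e1 : (ltInd (const 4) ke).eval s = ind (4 < k) := eval_ltInd rfl hk
  have e2 : (ltInd ke (add (const 5) (get 1 (const 1)))).eval s = ind (k < 5 + d) :=
    eval_ltInd hk (eval_add_nat rfl hd')
  have e3 : (ltInd (add (const 4) (get 1 (const 1))) ke).eval s = ind (4 + d < k) :=
    eval_ltInd (eval_add_nat rfl hd') hk
  have e4 : (ltInd ke (add (const 5) (mul (const 2) (get 1 (const 1))))).eval s =
      ind (k < 5 + 2 * d) :=
    eval_ltInd hk (eval_add_nat rfl (eval_mul_nat rfl hd'))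
  have e5 : (ltInd (const 1) ie).eval s = ind (1 < i) := eval_ltInd rfl hi
  have e6 := eval_vectorExpr (a := 2) (k := sub ke (const 5)) hn hd
    (eval_add_nat (u := var 11) (v := ie) h₁ hi)
  have e7 := eval_vectorExpr (a := 3) (k := sub (sub ke (const 5)) (get 1 (const 1))) hn hd
    (eval_add_nat (u := var 12) (v := ie) h₂ hi)
  simp only [inputE, eval, eval_eqInd, e1, e2, e3, e4, e5, e6, e7, hi, hk, hd,
    ind_natCast_eq_zero, ind_natCast_eq_one, ind_natCast_eq_literal, inputEntry]

theorem eval_queryE (hn : s 1 0 = n) (hd : s 1 1 = d) (h₃ : s 5 13 = o₃) (hN : s 5 0 = N)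
    (hH : s 5 5 = H) (hl : le.eval s = ℓ) (hh : he.eval s = h) (hr : re.eval s = r)
    (hc : ce.eval s = c) :
    (queryE le he re ce).eval s =
      queryEntry d N (vectorAt (s 4) n d (o₃ + (ℓ * H + h))) r c := by
  have hd' : (get 1 (const 1)).eval s = d := hd
  have e1 : (ltInd (const 4) ce).eval s = ind (4 < c) := eval_ltInd rfl hc
  have e2 : (ltInd ce (add (const 5) (get 1 (const 1)))).eval s = ind (c < 5 + d) :=
    eval_ltInd hc (eval_add_nat rfl hd')
  have e3 := eval_vectorExpr (a := 4) (k := sub ce (const 5)) hn hd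
    (eval_add_nat (u := var 13) h₃ (eval_add_nat (eval_mul_nat (v := var 5) hl hH) hh))
  simp only [queryE, eval, eval_eqInd, e1, e2, e3, hr, hc, hN, eval_var, ind_natCast_eq,
    ind_natCast_eq_zero, ind_natCast_eq_one, ind_natCast_eq_literal, queryEntry]

theorem eval_keyE (hd : s 1 1 = d) (hr : re.eval s = r) (hc : ce.eval s = c) :
    (keyE re ce).eval s = keyEntry d r c := by
  have hd' : (get 1 (const 1)).eval s = d := hd
  have e1 : (ltInd (const 4) ce).eval s = ind (4 < c) := eval_ltInd rfl hc
  have e2 : (ltInd ce (add (const 5) (get 1 (const 1)))).eval s = ind (c < 5 + d) :=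
    eval_ltInd hc (eval_add_nat rfl hd')
  simp only [keyE, eval, eval_eqInd, e1, e2, hr, hc, hd, ind_natCast_eq, ind_natCast_eq_add,
    ind_natCast_eq_one, ind_natCast_eq_literal, keyEntry]

theorem eval_valueE (hr : re.eval s = r) (hc : ce.eval s = c) :
    (valueE re ce).eval s = valueEntry r c := by
  simp only [valueE, eval, eval_eqInd, hr, hc, ind_natCast_eq_zero,
    ind_natCast_eq_one, ind_natCast_eq_literal, valueEntry]

theorem eval_w₁E (hm : s 5 3 = m) (hr : re.eval s = r) (hc : ce.eval s = c)
    (ht : te.eval s = t) : (w₁E re ce te).eval s = w₁Cell m r c t := by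
  simp only [w₁E, eval, eval_intE rfl ht, eval_eqInd, hr, hc, hm, ht, eval_var, ind_natCast_eq,
    ind_natCast_eq_one, ind_natCast_eq_literal, w₁Cell]

theorem eval_w₂E (hm : s 5 3 = m) (hr : re.eval s = r) (hc : ce.eval s = c)
    (ht : te.eval s = t) : (w₂E re ce te).eval s = w₂Cell m r c t := by
  simp only [w₂E, eval, eval_eqInd, hr, hc, hm, ht, eval_var, ind_natCast_eq,
    ind_natCast_eq_zero, ind_natCast_eq_literal, w₂Cell]

theorem eval_out₁E (hm : s 5 3 = m) (hr : re.eval s = r) (hc : ce.eval s = c)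
    (ht : te.eval s = t) : (out₁E re ce te).eval s = out₁Cell m r c t := by
  simp only [out₁E, eval, eval_intE rfl ht, eval_eqInd, hr, hc, hm, ht, eval_var, ind_natCast_eq,
    ind_natCast_eq_zero, ind_natCast_eq_one, ind_natCast_eq_literal, out₁Cell]

theorem eval_out₂E (hm : s 5 3 = m) (hr : re.eval s = r) (ht : te.eval s = t) :
    (out₂E re te).eval s = out₂Cell m r t := by
  simp only [out₂E, eval, eval_eqInd, hr, hm, ht, eval_var, ind_natCast_eq,
    ind_natCast_eq_zero, ind_natCast_eq_literal, out₂Cell]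

end Eval

/-! ### Expressions for whole arrays -/

/-- The position `x` is the scalar `8`; it is split into digits. -/
def q₁ : RExpr := div (var 8) (const 12)
def q₂ : RExpr := div q₁ (var 3)
def q₃ : RExpr := div q₂ (var 3)
def q₄ : RExpr := div q₃ (var 5)
def tE : RExpr := rem (var 8) (const 12)
def cE : RExpr := rem q₁ (var 3)
def rE : RExpr := rem q₂ (var 3)
def rE' : RExpr := rem q₂ (add (var 3) (const 1))
def hE : RExpr := rem q₃ (var 5)

def headLen : RExpr := mul (var 4) (mul (var 5) (mul (var 3) (mul (var 3) (const 12))))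
def outLen : RExpr := mul (add (var 3) (const 1)) (mul (var 3) (const 12))
def mlpLen : RExpr := mul (var 4) outLen

def guarded (len e : RExpr) : RExpr := mul (ltInd (var 8) len) e

/-- The content of cell `x` of the array `a` in the memory of the transformer. -/
def arrayE : ℕ → RExpr
  | 1 => add (add (add (add (mul (eqInd (var 8) (const 0)) (var 0))
      (mul (eqInd (var 8) (const 1)) (var 3))) (mul (eqInd (var 8) (const 2)) (var 4)))
      (mul (eqInd (var 8) (const 3)) (var 5))) (mul (eqInd (var 8) (const 4)) (var 3))
  | 2 => guarded (mul (var 0) (mul (var 3) (const 12))) (intE (inputE q₂ cE) tE)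
  | 3 => guarded headLen (intE (queryE q₄ hE rE cE) tE)
  | 4 => guarded headLen (intE (keyE rE cE) tE)
  | 5 => guarded headLen (intE (valueE rE cE) tE)
  | 6 => guarded mlpLen (w₁E rE' cE tE)
  | 7 => guarded mlpLen (w₂E rE' cE tE)
  | 8 => guarded outLen (out₁E q₂ cE tE)
  | 9 => guarded (mul (add (var 3) (const 1)) (const 12)) (out₂E q₁ tE)
  | _ => const 0

theorem isLow_arrayE (a : ℕ) : (arrayE a).IsLow := by
  unfold arrayE
  split <;>
    simp [RExpr.IsLow, guarded, headLen, mlpLen, outLen, intE, inputE, queryE, keyE, valueE, w₁E,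
      w₂E, out₁E, out₂E, q₁, q₂, q₃, q₄, tE, cE, rE, rE', hE, rem, eqInd, ltInd, var, vectorExpr]

theorem eval_guarded {s : Memory} {len e : RExpr} {b x : ℕ} {z : ℤ} (hx : s 5 8 = x)
    (hlen : len.eval s = b) (he : e.eval s = z) :
    (guarded len e).eval s = if x < b then z else 0 := by
  have : (ltInd (var 8) len).eval s = ind (x < b) := eval_ltInd hx hlen
  simp [guarded, eval, this, he, ind]

/-- The mixed-radix digits of the position `x` are cell, column, row, head and layer. Each entry is
then a branch-free combination of indicators in these digits, so one expression per array suffices,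
at cost `O(β)` per cell. -/
theorem eval_arrayE {s : Memory} {n d N m L H o₁ o₂ o₃ x : ℕ} (hn : s 1 0 = n) (hd : s 1 1 = d)
    (h₁ : s 5 11 = o₁) (h₂ : s 5 12 = o₂) (h₃ : s 5 13 = o₃) (hN : s 5 0 = N) (hm : s 5 3 = m)
    (hL : s 5 4 = L) (hH : s 5 5 = H) (hx : s 5 8 = x) (hm0 : 0 < m) (hH0 : 0 < H) (a : ℕ) :
    (arrayE a).eval s = transformerMemory
      (searchCode m L H N d fun ℓ h => vectorAt (s 4) n d (o₃ + (ℓ * H + h)))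
      (searchInput N m d (fun i => vectorAt (s 2) n d (o₁ + i))
        fun i => vectorAt (s 3) n d (o₂ + i)) a x := by
  have e1 : q₁.eval s = (x / 12 : ℕ) := eval_div_nat hx rfl
  have e2 : q₂.eval s = (x / 12 / m : ℕ) := eval_div_nat e1 hm
  have e3 : q₃.eval s = (x / 12 / m / m : ℕ) := eval_div_nat e2 hm
  have e4 : q₄.eval s = (x / 12 / m / m / H : ℕ) := eval_div_nat e3 hH
  have et : tE.eval s = (x % 12 : ℕ) := eval_rem_nat hx rfl
  have ec : cE.eval s = (x / 12 % m : ℕ) := eval_rem_nat e1 hm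
  have er : rE.eval s = (x / 12 / m % m : ℕ) := eval_rem_nat e2 hm
  have er' : rE'.eval s = (x / 12 / m % (m + 1) : ℕ) :=
    eval_rem_nat e2 (eval_add_nat (u := var 3) hm rfl)
  have eh : hE.eval s = (x / 12 / m / m % H : ℕ) := eval_rem_nat e3 hH
  have hl : headLen.eval s = (L * (H * (m * (m * 12))) : ℕ) :=
    eval_mul_nat (u := var 4) hL (eval_mul_nat (u := var 5) hH
      (eval_mul_nat (u := var 3) hm (eval_mul_nat (u := var 3) hm rfl)))
  have ol : outLen.eval s = ((m + 1) * (m * 12) : ℕ) :=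
    eval_mul_nat (eval_add_nat (u := var 3) hm rfl) (eval_mul_nat (u := var 3) hm rfl)
  have ml : mlpLen.eval s = (L * ((m + 1) * (m * 12)) : ℕ) := eval_mul_nat (u := var 4) hL ol
  unfold arrayE transformerMemory
  split
  · simp only [eval, eval_eqInd, hx, hN, hm, hL, hH, eval_var, arrayOf, listCells, ind]
    rcases x with _ | _ | _ | _ | _ | x <;> simp
    omega
  · refine (eval_guarded hx (eval_mul_nat (u := var 0) hN (eval_mul_nat (u := var 3) hm rfl))
      (eval_intE (eval_inputE hn hd h₁ h₂ e2 ec) et)).trans ?_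
    exact (matrixCells_codeOf hm0 (fun i k t => intCell (inputEntry d _ _ i k) t) x).symm
  · refine (eval_guarded hx hl (eval_intE (eval_queryE hn hd h₃ hN hH e4 eh er ec) et)).trans ?_
    exact (blocks_blocks_matrixCells_codeOf hH0 hm0 hm0 (fun ℓ h r c t =>
      intCell (queryEntry d N (vectorAt (s 4) n d (o₃ + (ℓ * H + h))) r c) t) x).symm
  · refine (eval_guarded hx hl (eval_intE (eval_keyE hd er ec) et)).trans ?_
    exact (blocks_blocks_matrixCells_codeOf hH0 hm0 hm0 (fun ℓ h r c t =>
      intCell (keyEntry d r c) t) x).symm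
  · refine (eval_guarded hx hl (eval_intE (eval_valueE er ec) et)).trans ?_
    exact (blocks_blocks_matrixCells_codeOf hH0 hm0 hm0 (fun ℓ h r c t =>
      intCell (valueEntry r c) t) x).symm
  · refine (eval_guarded hx ml (eval_w₁E hm er' ec et)).trans ?_
    exact (blocks_matrixCells_codeOf (by omega) hm0 (fun ℓ r c t => w₁Cell m r c t) x).symm
  · refine (eval_guarded hx ml (eval_w₂E hm er' ec et)).trans ?_
    exact (blocks_matrixCells_codeOf (by omega) hm0 (fun ℓ r c t => w₂Cell m r c t) x).symm
  · refine (eval_guarded hx ol (eval_out₁E hm e2 ec et)).trans ?_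
    exact (matrixCells_codeOf hm0 (fun r c t => out₁Cell m r c t) x).symm
  · refine (eval_guarded hx (eval_mul_nat (eval_add_nat (u := var 3) hm rfl) rfl)
      (eval_out₂E hm e1 et)).trans ?_
    have := matrixCells_codeOf (n := m + 1) (p := 1) one_pos (fun r c t => out₂Cell m r t) x
    rw [Nat.div_one, one_mul] at this
    exact this.symm
  · simp [eval, arrayOf, listCells]

/-- All arrays vanish beyond a common length, so a single loop fills them in parallel, and the cells
of a fresh generation that it does not reach are already correct. -/
theorem transformerMemory_searchCode_of_le {n N m L H : ℕ} {A B : ℕ → ℤ → ℤ}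
    {C : ℕ → ℕ → ℤ → ℤ} {d : ℕ} (hm0 : 0 < m) (hL0 : 0 < L) (hH0 : 0 < H) (hN0 : 0 < N) (a : ℕ)
    (hx : 12 * ((N + L * H) * ((m + 1) * (m + 1))) ≤ n) :
    transformerMemory (searchCode m L H N d C) (searchInput N m d A B) a n = 0 := by
  have hLH : 1 ≤ L * H := Nat.mul_pos hL0 hH0
  have b1 : N * (m * 12) ≤ n := by
    refine le_trans ?_ hx
    calc N * (m * 12) = 12 * (N * (m * 1)) := by ring
      _ ≤ _ := by gcongr <;> omega
  have b2 : L * (H * (m * (m * 12))) ≤ n := by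
    refine le_trans ?_ hx
    calc L * (H * (m * (m * 12))) = 12 * ((L * H) * (m * m)) := by ring
      _ ≤ _ := by gcongr <;> omega
  have b3 : L * ((m + 1) * (m * 12)) ≤ n := by
    refine le_trans ?_ hx
    calc L * ((m + 1) * (m * 12)) = 12 * ((0 + L * 1) * ((m + 1) * m)) := by ring
      _ ≤ _ := by gcongr <;> omega
  have b4 : (m + 1) * (m * 12) ≤ n :=
    le_trans (Nat.le_mul_of_pos_left _ hL0) b3
  have b5 : (m + 1) * (1 * 12) ≤ n := le_trans (by gcongr <;> omega) b4
  unfold transformerMemory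
  split
  · change listCells _ n = 0
    have : 5 ≤ n := by omega
    simp only [listCells]
    rw [List.getD_eq_default]
    simpa using this
  · exact (matrixCells_codeOf hm0 (fun i k t => intCell (inputEntry d _ _ i k) t) n).trans
      (if_neg (by omega))
  · exact (blocks_blocks_matrixCells_codeOf hH0 hm0 hm0 (fun ℓ h r c t =>
      intCell (queryEntry d N (C ℓ h) r c) t) n).trans (if_neg (by omega))
  · exact (blocks_blocks_matrixCells_codeOf hH0 hm0 hm0 (fun ℓ h r c t =>
      intCell (keyEntry d r c) t) n).trans (if_neg (by omega))
  · exact (blocks_blocks_matrixCells_codeOf hH0 hm0 hm0 (fun ℓ h r c t =>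
      intCell (valueEntry r c) t) n).trans (if_neg (by omega))
  · exact (blocks_matrixCells_codeOf (by omega) hm0 (fun ℓ r c t => w₁Cell m r c t) n).trans
      (if_neg (by omega))
  · exact (blocks_matrixCells_codeOf (by omega) hm0 (fun ℓ r c t => w₂Cell m r c t) n).trans
      (if_neg (by omega))
  · exact (matrixCells_codeOf hm0 (fun r c t => out₁Cell m r c t) n).trans (if_neg (by omega))
  · exact (matrixCells_codeOf (n := m + 1) (p := 1) one_pos (fun r c t => out₂Cell m r t) n).trans
      (if_neg (by omega))
  · simp [arrayOf, listCells]

end Entry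

open RExpr Entry

/-! ### One run of the transformer program -/

theorem bitLen_le_of_le_two_pow {β : ℕ} (hβ : 1 ≤ β) {z : ℤ} (h : z.natAbs ≤ 2 ^ β) :
    bitLen z ≤ 3 * β := by
  have := bitLen_le_of_natAbs_le_two_pow (β := β) (D := 1) hβ (by simpa using h)
  omega

theorem natAbs_natCast_add_one (i : ℕ) : ((i : ℤ) + 1).natAbs = i + 1 := by omega

theorem isLow_cellIndex {e : RExpr} (he : e.IsLow) : e.cellIndex.IsLow :=
  ⟨⟨he, isLow_var 1⟩, isLow_var 2⟩

theorem eval_cellIndex {s : Memory} {G g : ℤ} (hG : s 5 1 = G) (hg : s 5 2 = g) (e : RExpr) :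
    e.cellIndex.eval s = e.eval s * G + g := by
  simp [cellIndex, eval, hG, hg]

/-- Writes cell `x` of the first `j` arrays of the input of the transformer program. -/
def fillBody : ℕ → Program
  | 0 => .skip
  | j + 1 => .seq (fillBody j) (.set (j + 1 + 6) (var 8).cellIndex (arrayE (j + 1)))

def fillWeight : ℕ → ℕ
  | 0 => 1
  | j + 1 => fillWeight j + ((var 8).cellIndex.weight + (arrayE (j + 1)).weight + 1)

/-- The number of cells that are written in each array. -/
def lenE : RExpr :=
  mul (const 12) (mul (add (var 0) (mul (var 4) (var 5)))
    (mul (add (var 3) (const 1)) (add (var 3) (const 1))))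

def inputLen (N m L H : ℕ) : ℕ := 12 * ((N + L * H) * ((m + 1) * (m + 1)))

/-- The memory contains the input `w` in the arrays `1` to `4` and the parameters in the
scalars. -/
structure Ready (β : ℕ) (w : Memory) (N G m L H ux : ℕ) (s : Memory) : Prop where
  low : LowBounded β s
  input : ∀ a, 1 ≤ a → a < 5 → s a = w a
  len : s 5 0 = N
  gens : s 5 1 = G
  dim : s 5 3 = m
  layers : s 5 4 = L
  heads : s 5 5 = H
  groups : s 5 10 = ux

/-- Only array `0`, the scalars in `V` and generation `g` may differ. -/
def SameExcept (V : Set ℤ) (G g : ℤ) (s s' : Memory) : Prop :=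
  (∀ a, 1 ≤ a → a < 5 → s' a = s a) ∧ (∀ v, v ∉ V → s' 5 v = s 5 v) ∧
    ∀ g', 0 ≤ g' → g' < G → g' ≠ g → view G g' s' = view G g' s

theorem SameExcept.trans {V : Set ℤ} {G g : ℤ} {s s' s'' : Memory} (h : SameExcept V G g s s')
    (h' : SameExcept V G g s' s'') : SameExcept V G g s s'' :=
  ⟨fun a h1 h2 => (h'.1 a h1 h2).trans (h.1 a h1 h2),
    fun v hv => (h'.2.1 v hv).trans (h.2.1 v hv),
    fun g' h1 h2 h3 => (h'.2.2 g' h1 h2 h3).trans (h.2.2 g' h1 h2 h3)⟩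

theorem SameExcept.mono {V V' : Set ℤ} {G g : ℤ} {s s' : Memory} (h : SameExcept V G g s s') (hV : V ⊆ V') :
    SameExcept V' G g s s' :=
  ⟨h.1, fun v hv => h.2.1 v fun h' => hv (hV h'), h.2.2⟩

theorem SameOutside.sameExcept {V : Set ℤ} {G g : ℤ} {s s' : Memory} (h : SameOutside G g s s') :
    SameExcept V G g s s' :=
  ⟨fun a _ h2 => h.1 a (by omega), fun v _ => by rw [h.1 5 (by omega)], h.2⟩

theorem SameExcept.write_scalar {V : Set ℤ} {G g : ℤ} (s : Memory) {v : ℤ} (hv : v ∈ V) (z : ℤ) :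
    SameExcept V G g s (s.write 5 v z) := by
  refine ⟨fun a _ h2 => Memory.write_apply_of_ne _ _ _ (by omega), fun v' hv' => ?_,
    fun g' _ _ _ => view_write_low _ (by omega) _ _⟩
  rw [Memory.write_apply, if_neg]
  rintro ⟨-, rfl⟩
  exact hv' hv

/-- The listed scalars are scratch: `2` is the generation, `6` and `7` are the number of runs and
its counter, `8` and `9` are inner counters, and `11`, `12`, `13` are the offsets of the groups. -/
theorem Ready.of_sameExcept {β : ℕ} {w : Memory} {N G m L H ux : ℕ} {s s' : Memory} {V : Set ℤ} {G' g : ℤ}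
    (h : Ready β w N G m L H ux s) (hr : SameExcept V G' g s s') (hlow : LowBounded β s')
    (hV : ∀ v ∈ V, v = 2 ∨ v = 6 ∨ v = 7 ∨ v = 8 ∨ v = 9 ∨ 11 ≤ v) :
    Ready β w N G m L H ux s' := by
  have key : ∀ v : ℤ, ¬ (v = 2 ∨ v = 6 ∨ v = 7 ∨ v = 8 ∨ v = 9 ∨ 11 ≤ v) → s' 5 v = s 5 v :=
    fun v hv => hr.2.1 v fun h' => hv (hV v h')
  exact ⟨hlow, fun a h1 h2 => (hr.1 a h1 h2).trans (h.input a h1 h2),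
    (key 0 (by norm_num)).trans h.len, (key 1 (by norm_num)).trans h.gens,
    (key 3 (by norm_num)).trans h.dim, (key 4 (by norm_num)).trans h.layers,
    (key 5 (by norm_num)).trans h.heads, (key 10 (by norm_num)).trans h.groups⟩

theorem LowBounded.of_sameOutside {β : ℕ} {G g : ℤ} {s s' : Memory} (h : LowBounded β s)
    (hs : SameOutside G g s s') : LowBounded β s' :=
  fun a i ha => by rw [hs.1 a ha]; exact h a i ha

section Run

variable {β : ℕ} {w : Memory} {n d N G m L H ux g o₁ o₂ o₃ : ℕ}

/-- The transformer of the current run. -/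
def runCode (w : Memory) (n d N m L H o₃ : ℕ) : TransformerCode m L H m :=
  searchCode m L H N d fun ℓ h => vectorAt (w 4) n d (o₃ + (ℓ * H + h))

/-- The input of the transformer in the current run. -/
def runInput (w : Memory) (n d N m o₁ o₂ : ℕ) : Matrix (Fin N) (Fin m) RealCode :=
  searchInput N m d (fun i => vectorAt (w 2) n d (o₁ + i)) fun i => vectorAt (w 3) n d (o₂ + i)

/-- Writing into the private arrays changes neither the input nor the scalars, so the formulas for
the later arrays still see the same parameters. -/
theorem haltsIn_fillBody (hβ : 1 ≤ β) (hn : w 1 0 = n) (hd : w 1 1 = d) (hm0 : 0 < m) (hH0 : 0 < H)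
    (hgG : g < G) {x : ℕ} (j : ℕ) {s : Memory} (hs : Ready β w N G m L H ux s) (hg : s 5 2 = g)
    (h₁ : s 5 11 = o₁) (h₂ : s 5 12 = o₂) (h₃ : s 5 13 = o₃) (hx : s 5 8 = x) :
    HaltsIn (fillBody j) s (β * fillWeight j) fun s' => SameOutside G g s s' ∧
      ∀ a i, view G g s' a i = if (1 ≤ a ∧ a ≤ j) ∧ i = x then
        transformerMemory (runCode w n d N m L H o₃) (runInput w n d N m o₁ o₂) a x
        else view G g s a i := by
  induction j with
  | zero =>
    refine (haltsIn_skip (post := fun s' => s' = s) rfl).mono (by simpa [fillWeight] using hβ) ?_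
    rintro s' rfl
    refine ⟨.refl _ _ _, fun a i => ?_⟩
    rw [if_neg]
    omega
  | succ j ih =>
    refine ((ih.seq fun s' hs' => ?_).mono (T := β * fillWeight j +
      β * ((var 8).cellIndex.weight + (arrayE (j + 1)).weight + 1)) ?_ fun _ h => h)
    swap
    · simp only [fillWeight]
      nlinarith
    obtain ⟨hsame, hview⟩ := hs'
    have hsc : ∀ v, s' 5 v = s 5 v := fun v => by rw [hsame.1 5 (by omega)]
    have hin : ∀ a, 1 ≤ a → a < 5 → s' a = w a := fun a h1 h2 => by
      rw [hsame.1 a (by omega), hs.input a h1 h2]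
    refine haltsIn_set_low hβ (hs.low.of_sameOutside hsame) (isLow_cellIndex (isLow_var 8))
      (isLow_arrayE _) ?_
    rw [eval_cellIndex ((hsc 1).trans hs.gens) ((hsc 2).trans hg), eval_var, hsc 8, hx,
      eval_arrayE (n := n) (d := d) (N := N) (m := m) (L := L) (H := H) (o₁ := o₁) (o₂ := o₂)
        (o₃ := o₃) (x := x) (by rw [hin 1 (by omega) (by omega), hn])
        (by rw [hin 1 (by omega) (by omega), hd])
        ((hsc 11).trans h₁) ((hsc 12).trans h₂) ((hsc 13).trans h₃) ((hsc 0).trans hs.len)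
        ((hsc 3).trans hs.dim) ((hsc 4).trans hs.layers) ((hsc 5).trans hs.heads)
        ((hsc 8).trans hx) hm0 hH0, hin 2 (by omega) (by omega), hin 3 (by omega) (by omega),
      hin 4 (by omega) (by omega)]
    refine ⟨hsame.trans (.write (by positivity) (by exact_mod_cast hgG) _ _ _ _), fun a i => ?_⟩
    rw [view_write (by positivity) (by exact_mod_cast hgG), Memory.write_apply, hview a i]
    by_cases ha : a = j + 1
    · subst ha
      by_cases hi : i = x
      · simp [hi, runCode, runInput]
      · simp [hi]
    · have : a ≤ j + 1 ↔ a ≤ j := by omega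
      simp [ha, this]

theorem isLow_lenE : lenE.IsLow := by
  simp [lenE, IsLow, isLow_var]

theorem eval_lenE {s : Memory} (hs : Ready β w N G m L H ux s) :
    lenE.eval s = inputLen N m L H := by
  simp [lenE, eval, inputLen, hs.len, hs.layers, hs.heads, hs.dim]

theorem transformerMemory_eq_zero {M L' H' hid : ℕ} (T : TransformerCode M L' H' hid)
    (X : Matrix (Fin N) (Fin M) RealCode) {a : ℕ} (ha : ¬ (1 ≤ a ∧ a ≤ 9)) (i : ℤ) :
    transformerMemory T X a i = 0 := by
  unfold transformerMemory
  split <;> first | omega | (cases i <;> simp [arrayOf, listCells])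

theorem transformerMemory_neg {M L' H' hid : ℕ} (T : TransformerCode M L' H' hid)
    (X : Matrix (Fin N) (Fin M) RealCode) (a : ℕ) {i : ℤ} (hi : i < 0) :
    transformerMemory T X a i = 0 := by
  obtain ⟨k, rfl⟩ := Int.eq_negSucc_of_lt_zero hi
  unfold transformerMemory
  split <;> rfl

/-- Writes the input of the transformer program. -/
def fillProgram : Program := .forLoop 8 lenE (fillBody 9)

def fillTime (β len : ℕ) : ℕ :=
  ∑ _l ∈ Finset.range len, (β * fillWeight 9 + β * forWeight 8 lenE) + β * forWeight 8 lenE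

/-- The generation must be blank beforehand: this supplies the negative cells, array `0`, the arrays
beyond `9` and the cells beyond `inputLen`, none of which is written. -/
theorem haltsIn_fillProgram (hβ : 1 ≤ β) (hn : w 1 0 = n) (hd : w 1 1 = d) (hN0 : 0 < N)
    (hm0 : 0 < m) (hL0 : 0 < L) (hH0 : 0 < H)
    (hgG : g < G) {s : Memory} (hs : Ready β w N G m L H ux s) (hg : s 5 2 = g)
    (h₁ : s 5 11 = o₁) (h₂ : s 5 12 = o₂) (h₃ : s 5 13 = o₃)
    (hlen : inputLen N m L H ≤ 2 ^ β) (hzero : view G g s = fun _ _ => 0) :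
    HaltsIn fillProgram s (fillTime β (inputLen N m L H)) fun s' => SameExcept {8} G g s s' ∧
      s' 0 = s 0 ∧ LowBounded β s' ∧ view G g s' =
        transformerMemory (runCode w n d N m L H o₃) (runInput w n d N m o₁ o₂) := by
  have hready : ∀ s', SameExcept {8} G g s s' → LowBounded β s' → Ready β w N G m L H ux s' :=
    fun s' hr hlow => hs.of_sameExcept hr hlow (by rintro v rfl; norm_num)
  refine (haltsIn_forLoop hβ isLow_lenE (n := inputLen N m L H)
    (fun x s' => x ≤ inputLen N m L H ∧ SameExcept {8} G g s s' ∧ s' 0 = s 0 ∧ LowBounded β s' ∧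
      s' 5 8 = x ∧ ∀ a i, view G g s' a i = if 0 ≤ i ∧ i < x then
        transformerMemory (runCode w n d N m L H o₃) (runInput w n d N m o₁ o₂) a i else 0)
    (fun _ => β * fillWeight 9) hs.low (fun x s' h => h.2.2.2.1) (fun x s' h => h.2.2.2.2.1)
    (fun x s' h => eval_lenE (hready s' h.2.1 h.2.2.2.1)) ?_ ?_).mono le_rfl ?_
  · refine ⟨by omega, .write_scalar s (by simp) 0, Memory.write_apply_of_ne _ _ _ (by omega),
      hs.low.write (.inr (by simp)), by simp [Memory.write_apply], fun a i => ?_⟩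
    rw [view_write_low _ (by omega), hzero, if_neg]
    simp
  · rintro x s' hx ⟨-, hrel, h0, hlow, hx8, hview⟩
    have hsc : ∀ v, v ≠ 8 → s' 5 v = s 5 v := fun v hv => hrel.2.1 v hv
    refine (haltsIn_fillBody (n := n) (d := d) hβ hn hd hm0 hH0 hgG 9 (hready s' hrel hlow)
      ((hsc 2 (by norm_num)).trans hg) ((hsc 11 (by norm_num)).trans h₁)
      ((hsc 12 (by norm_num)).trans h₂) ((hsc 13 (by norm_num)).trans h₃) hx8).mono le_rfl ?_
    rintro s'' ⟨hsame, hview'⟩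
    have hlow'' := hlow.of_sameOutside hsame
    refine ⟨hlow'', by rw [hsame.1 5 (by omega), hx8], by omega,
      (hrel.trans hsame.sameExcept).trans (.write_scalar _ (by simp) _), ?_, hlow''.write (.inr ?_),
      by simp [Memory.write_apply], fun a i => ?_⟩
    · rw [Memory.write_apply_of_ne _ _ _ (by omega), hsame.1 0 (by omega), h0]
    · rw [natAbs_natCast_add_one]
      omega
    · rw [view_write_low _ (by omega), hview', hview]
      by_cases hi : i = x
      · subst hi
        by_cases ha : 1 ≤ a ∧ a ≤ 9
        · simp [ha]
        · simp [ha, transformerMemory_eq_zero]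
      · have : (0 ≤ i ∧ i < ((x + 1 : ℕ) : ℤ)) ↔ (0 ≤ i ∧ i < x) := by push_cast; omega
        simp only [hi, and_false, if_false, this]
  · rintro s' ⟨-, hrel, h0, hlow, -, hview⟩
    refine ⟨hrel, h0, hlow, ?_⟩
    funext a i
    rw [hview a i]
    split_ifs with hi
    · rfl
    · rcases lt_or_ge i 0 with hneg | hpos
      · rw [transformerMemory_neg _ _ _ hneg]
      · lift i to ℕ using hpos
        exact (transformerMemory_searchCode_of_le hm0 hL0 hH0 hN0 a
          (by simp at hi; exact hi)).symm

/-! ### Reading the output -/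

/-- The number of the numerator of output `i + 2`, where `i` is the scalar `9`. -/
def outIndexE : RExpr := mul (const 2) (add (var 9) (const 2))

def numE : RExpr := get 6 outIndexE.cellIndex

def denE : RExpr := get 6 (add outIndexE (const 1)).cellIndex

/-- Tests whether an output is below `1/2` without dividing. The answer cell is only ever raised to
`1`, so successive checks form a disjunction. -/
def checkBody : Program := .ite (sub denE (mul (const 2) numE)) (.set 0 (const 0) (const 1)) .skip

def checkLoop : Program := .forLoop 9 (sub (var 0) (const 2)) checkBody

def checkWeight : ℕ := outIndexE.cellIndex.weight + (add outIndexE (const 1)).cellIndex.weight + 20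

theorem isLow_outIndexE : outIndexE.IsLow := by
  simp [outIndexE, IsLow, isLow_var]

/-- The two output cells are not bounded by `β`, so their bit lengths appear explicitly; the factor
`3` covers reading, doubling and subtracting. The `11` pays for the branch and the test. -/
theorem cost_check_le (hβ : 1 ≤ β) {s : Memory} (hs : LowBounded β s) (hG : s 5 1 = G)
    (hg : s 5 2 = g) {i : ℕ} (hi : s 5 9 = i) :
    (sub denE (mul (const 2) numE)).cost s + 11 ≤ β * checkWeight +
      3 * (bitLen (view G g s 0 (2 * (i + 2))) + bitLen (view G g s 0 (2 * (i + 2) + 1))) := by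
  have h1 := cost_le hβ hs _ (isLow_cellIndex isLow_outIndexE)
  have h2 := cost_le hβ hs _ (isLow_cellIndex (IsLow.add isLow_outIndexE (isLow_const 1)))
  have e1 : outIndexE.cellIndex.eval s = 2 * (i + 2) * G + g := by
    rw [eval_cellIndex hG hg]
    simp [outIndexE, eval, hi]
  have e2 : (add outIndexE (const 1)).cellIndex.eval s = (2 * (i + 2) + 1) * G + g := by
    rw [eval_cellIndex hG hg]
    simp [outIndexE, eval, hi]
  have b2 : bitLen 2 = 3 := by simp [bitLen, Nat.size, Nat.binaryRec]
  simp only [numE, denE, cost, eval, e1, e2, view, b2]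
  have h3 := bitLen_mul_le 2 (s 6 (2 * (i + 2) * G + g))
  have h4 := bitLen_sub_le (s 6 ((2 * (i + 2) + 1) * G + g)) (2 * s 6 (2 * (i + 2) * G + g))
  rw [b2] at h3
  have hw : β * checkWeight = β * outIndexE.cellIndex.weight +
      β * (add outIndexE (const 1)).cellIndex.weight + β * 20 := by
    unfold checkWeight
    ring
  rw [hw]
  simp only [Nat.zero_add]
  have : 20 ≤ β * 20 := by omega
  omega

theorem haltsIn_checkLoop (hβ : 1 ≤ β) (hN3 : 3 ≤ N) {s : Memory} (hN : s 5 0 = N) (hG : s 5 1 = G)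
    (hg : s 5 2 = g) (hlow : LowBounded β s) (hNβ : N ≤ 2 ^ β) (P : ℕ → Prop)
    (hP : ∀ i : ℕ, 2 ≤ i → i < N →
      (0 < view G g s 0 (2 * i + 1) - 2 * view G g s 0 (2 * i) ↔ P i)) :
    HaltsIn checkLoop s
      (∑ i ∈ Finset.range (N - 2), ((β * checkWeight +
        3 * (bitLen (view G g s 0 (2 * ((i : ℤ) + 2))) +
          bitLen (view G g s 0 (2 * ((i : ℤ) + 2) + 1)))) +
        β * forWeight 9 (sub (var 0) (const 2))) + β * forWeight 9 (sub (var 0) (const 2)))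
      fun s' => (∀ a, 1 ≤ a → a < 5 → s' a = s a) ∧ (∀ v, v ≠ 9 → s' 5 v = s 5 v) ∧
        (∀ g', view G g' s' = view G g' s) ∧ LowBounded β s' ∧
        ((∃ i, 2 ≤ i ∧ i < N ∧ P i) → s' 0 0 = 1) ∧
        ((¬ ∃ i, 2 ≤ i ∧ i < N ∧ P i) → s' 0 0 = s 0 0) := by
  refine (haltsIn_forLoop hβ (e := sub (var 0) (const 2)) (IsLow.sub (isLow_var 0) (isLow_const 2))
    (n := N - 2)
    (fun i s' => i ≤ N - 2 ∧ (∀ a, 1 ≤ a → a < 5 → s' a = s a) ∧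
        (∀ v, v ≠ 9 → s' 5 v = s 5 v) ∧
        (∀ g', view G g' s' = view G g' s) ∧ LowBounded β s' ∧ s' 5 9 = i ∧
        ((∃ j, 2 ≤ j ∧ j < i + 2 ∧ P j) → s' 0 0 = 1) ∧
        ((¬ ∃ j, 2 ≤ j ∧ j < i + 2 ∧ P j) → s' 0 0 = s 0 0))
    (fun i => β * checkWeight +
        3 * (bitLen (view G g s 0 (2 * ((i : ℤ) + 2))) +
          bitLen (view G g s 0 (2 * ((i : ℤ) + 2) + 1)))) hlow
    (fun i s' h => h.2.2.2.2.1) (fun i s' h => h.2.2.2.2.2.1) ?_ ?_ ?_).mono le_rfl ?_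
  · intro i s' h
    simp only [eval, eval_var, h.2.2.1 0 (by norm_num), hN]
    omega
  · refine ⟨by omega, fun a _ h2 => Memory.write_apply_of_ne _ _ _ (by omega),
      fun v hv => by simp [Memory.write_apply, hv], fun g' => view_write_low _ (by omega) _ _,
      hlow.write (.inr (by simp)), by simp [Memory.write_apply], ?_, ?_⟩
    · rintro ⟨j, h1, h2, -⟩
      omega
    · intro _
      simp [Memory.write_apply]
  · rintro i s' hi ⟨-, hin, hsc, hview, hlow', h9, hyes, hno⟩
    have hG' : s' 5 1 = G := (hsc 1 (by norm_num)).trans hG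
    have hg' : s' 5 2 = g := (hsc 2 (by norm_num)).trans hg
    have e1 : numE.eval s' = view G g s 0 (2 * ((i : ℤ) + 2)) := by
      rw [← hview]
      simp only [numE, eval, eval_cellIndex hG' hg', outIndexE, eval_var, h9, view]
    have e2 : denE.eval s' = view G g s 0 (2 * ((i : ℤ) + 2) + 1) := by
      rw [← hview]
      simp only [denE, eval, eval_cellIndex hG' hg', outIndexE, eval_var, h9, view]
    have hcost := cost_check_le hβ hlow' hG' hg' h9
    rw [hview] at hcost
    have hPi := hP (i + 2) (by omega) (by omega)
    push_cast at hPi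
    have hone : ((i : ℤ) + 1).natAbs ≤ 2 ^ β := by
      rw [natAbs_natCast_add_one]
      exact (Nat.succ_le_of_lt (hi.trans_le (Nat.sub_le N 2))).trans hNβ
    refine (haltsIn_ite (T := 10) (post := fun s' => LowBounded β s' ∧ s' 5 9 = i ∧ _)
      (fun hpos => ?_) (fun hneg => ?_)).mono (by omega) fun _ h => h
    · simp only [eval, e1, e2] at hpos
      have hPi' := hPi.1 hpos
      have hlow'' : LowBounded β (s'.write 0 0 1) :=
        hlow'.write (.inr (by simpa using Nat.one_le_two_pow))
      refine haltsIn_set ?_ ⟨hlow'', ?_, by omega, fun a h1 h2 => ?_, fun v hv => ?_, fun g' => ?_,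
        hlow''.write (.inr hone), ?_, fun _ => ?_, fun h => ?_⟩
      · simp [cost, bitLen]
      · simp [Memory.write_apply, h9]
      · rw [Memory.write_apply_of_ne _ _ _ (by omega), Memory.write_apply_of_ne _ _ _ (by omega),
          hin a h1 h2]
      · simp [Memory.write_apply, hv, hsc]
      · rw [view_write_low _ (by omega), view_write_low _ (by omega), hview]
      · simp [Memory.write_apply]
      · simp [Memory.write_apply, eval]
      · exact (h ⟨i + 2, by omega, by omega, hPi'⟩).elim
    · simp only [eval, e1, e2] at hneg
      have hPi' : ¬ P (i + 2) := fun h => hneg (hPi.2 h)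
      have hiff : (∃ j, 2 ≤ j ∧ j < i + 1 + 2 ∧ P j) ↔ ∃ j, 2 ≤ j ∧ j < i + 2 ∧ P j := by
        constructor
        · rintro ⟨j, h1, h2, h3⟩
          refine ⟨j, h1, ?_, h3⟩
          have : j ≠ i + 2 := by
            rintro rfl
            exact hPi' h3
          omega
        · rintro ⟨j, h1, h2, h3⟩
          exact ⟨j, h1, by omega, h3⟩
      refine (haltsIn_skip ⟨hlow', h9, by omega, fun a h1 h2 => ?_, fun v hv => ?_, fun g' => ?_,
        hlow'.write (.inr hone), ?_, fun h => ?_, fun h => ?_⟩).mono (by omega) fun _ h => h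
      · rw [Memory.write_apply_of_ne _ _ _ (by omega), hin a h1 h2]
      · simp [Memory.write_apply, hv, hsc]
      · rw [view_write_low _ (by omega), hview]
      · simp [Memory.write_apply]
      · rw [Memory.write_apply_of_ne _ _ _ (by omega)]
        exact hyes (hiff.1 h)
      · rw [Memory.write_apply_of_ne _ _ _ (by omega)]
        exact hno fun h' => h (hiff.2 h')
  · rintro s' ⟨-, hin, hsc, hview, hlow', -, hyes, hno⟩
    have : N - 2 + 2 = N := by omega
    rw [this] at hyes hno
    exact ⟨hin, hsc, hview, hlow', hyes, hno⟩

end Run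

/-! ### Assembling a single run and iterating over all groups -/

section Solver

variable {β : ℕ} {w : Memory} {n d N G m L H ux o₁ o₂ o₃ : ℕ}

theorem haltsIn_assign (hβ : 1 ≤ β) {s : Memory} (hs : LowBounded β s) {v : ℤ} {e : RExpr}
    (he : e.IsLow) {z : ℤ} (hz : e.eval s = z) {post : Memory → Prop} (h : post (s.write 5 v z)) :
    HaltsIn (.assign v e) s (β * ((const v).weight + e.weight + 1)) post :=
  haltsIn_set_low hβ hs (isLow_const v) he (by rw [hz]; exact h)

/-- A relocated program, together with a bound for the sizes of the numbers that it leaves. -/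
theorem haltsIn_relocate (hβ : 1 ≤ β) {g : ℕ} (hgG : g < G) (hG2 : G ≤ 2 ^ β) {p : Program}
    {v : Memory} {t : ℕ} {post : Memory → Prop} (h : HaltsIn p v t post) {s : Memory}
    (hv : view G g s = v) (hG : s 5 1 = G) (hg : s 5 2 = g) :
    HaltsIn p.relocate s (23 * β * t) fun s' => SameOutside G g s s' ∧ post (view G g s') ∧
      ∀ (b : ℕ) (F : Finset ℤ),
        ∑ i ∈ F, bitLen (view G g s' b i) ≤ ∑ i ∈ F, bitLen (v b i) + t := by
  obtain ⟨t₀, v', hex, ht, hpost⟩ := h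
  have b1 := bitLen_le_of_le_two_pow (z := (G : ℤ)) hβ (by simpa using hG2)
  have b2 := bitLen_le_of_le_two_pow (z := (g : ℤ)) hβ (by simp; omega)
  obtain ⟨t', s', h1, h2, h3, h4⟩ := hex.relocate (G := G) (g := g) (F := 23 * β) (by positivity)
    (by exact_mod_cast hgG) (by omega) s hv hG hg
  refine ⟨t', s', h1, h2.trans (Nat.mul_le_mul_left _ ht), h4, by rwa [h3], fun b F => ?_⟩
  rw [h3]
  exact (hex.sum_bitLen_le b F).trans (by omega)

/-- One run: choose a fresh generation and the groups of vectors, prepare the input, run the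
program, read the output. -/
def runProgram (p : Program) : Program :=
  .seq (.assign 2 (add (var 7) (const 3)))
  (.seq (.assign 11 (mul (rem (var 7) (var 10)) (sub (var 0) (const 2))))
  (.seq (.assign 12 (mul (rem (div (var 7) (var 10)) (var 10)) (sub (var 0) (const 2))))
  (.seq (.assign 13 (mul (div (div (var 7) (var 10)) (var 10)) (mul (var 4) (var 5))))
  (.seq fillProgram (.seq p.relocate checkLoop)))))

def runWeight : ℕ :=
  ((const 2).weight + (add (var 7) (const 3)).weight + 1) +
  ((const 11).weight + (mul (rem (var 7) (var 10)) (sub (var 0) (const 2))).weight + 1) +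
  ((const 12).weight +
    (mul (rem (div (var 7) (var 10)) (var 10)) (sub (var 0) (const 2))).weight + 1) +
  ((const 13).weight +
    (mul (div (div (var 7) (var 10)) (var 10)) (mul (var 4) (var 5))).weight + 1) +
  (fillWeight 9 + 2 * forWeight 8 lenE) + 23 +
  (checkWeight + 6 + 2 * forWeight 9 (sub (var 0) (const 2))) + 6

/-- Injectivity of `f` turns the sum over positions into a sum over a set of distinct cells, to
which the accounting by running time applies. -/
theorem sum_bitLen_output_le {v : Memory} {t K : ℕ} (f : ℕ → ℤ) (hf : Function.Injective f)
    (h : ∀ F : Finset ℤ, ∑ i ∈ F, bitLen (v 0 i) ≤ F.card + t) :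
    ∑ i ∈ Finset.range K, bitLen (v 0 (f i)) ≤ K + t := by
  have := h ((Finset.range K).image f)
  rw [Finset.sum_image hf.injOn, Finset.card_image_of_injective _ hf, Finset.card_range] at this
  exact this

theorem transformerMemory_zero {M L' H' hid : ℕ} (T : TransformerCode M L' H' hid)
    (X : Matrix (Fin N) (Fin M) RealCode) (i : ℤ) : transformerMemory T X 0 i = 0 :=
  transformerMemory_eq_zero T X (by omega) i

/-- Preparing the input costs `O(β)` per cell, the simulation `O(β t)`, and reading the outputs `O(β
N + t)` because their total size is charged to the simulated run. Everything is thus `O(β (inputLen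
+ t))`. -/
theorem haltsIn_runProgram (hβ : 1 ≤ β) (hn : w 1 0 = n) (hd : w 1 1 = d) (hN3 : 3 ≤ N)
    (hm0 : 0 < m) (hL0 : 0 < L) (hH0 : 0 < H) {γ : ℕ} (hγ : γ + 3 < G) (hG2 : G ≤ 2 ^ β)
    (hlen : inputLen N m L H ≤ 2 ^ β) {s : Memory} (hs : Ready β w N G m L H ux s)
    (h7 : s 5 7 = γ) (ho₁ : o₁ = γ % ux * (N - 2)) (ho₂ : o₂ = γ / ux % ux * (N - 2))
    (ho₃ : o₃ = γ / ux / ux * (L * H)) (h₁ : o₁ ≤ 2 ^ β) (h₂ : o₂ ≤ 2 ^ β) (h₃ : o₃ ≤ 2 ^ β)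
    (hzero : view G (γ + 3 : ℕ) s = fun _ _ => 0) {p : Program} {t : ℕ} {P : ℕ → Prop}
    (hp : HaltsIn p (transformerMemory (runCode w n d N m L H o₃) (runInput w n d N m o₁ o₂)) t
      fun v => ∀ i : ℕ, 2 ≤ i → i < N → (0 < v 0 (2 * i + 1) - 2 * v 0 (2 * i) ↔ P i)) :
    HaltsIn (runProgram p) s (runWeight * (β * (inputLen N m L H + t))) fun s' =>
      SameExcept {2, 8, 9, 11, 12, 13} G (γ + 3 : ℕ) s s' ∧ LowBounded β s' ∧
        ((∃ i, 2 ≤ i ∧ i < N ∧ P i) → s' 0 0 = 1) ∧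
        ((¬ ∃ i, 2 ≤ i ∧ i < N ∧ P i) → s' 0 0 = s 0 0) := by
  have hN2 : ((N - 2 : ℕ) : ℤ) = N - 2 := by omega
  set V : Set ℤ := {2, 8, 9, 11, 12, 13} with hV
  have hready : ∀ s', SameExcept V G (γ + 3 : ℕ) s s' → LowBounded β s' →
      Ready β w N G m L H ux s' := by
    refine fun s' hr hlow => hs.of_sameExcept hr hlow ?_
    rintro v (rfl | rfl | rfl | rfl | rfl | rfl) <;> norm_num
  have hNlen : N ≤ inputLen N m L H := by
    unfold inputLen
    have : 1 ≤ (m + 1) * (m + 1) := Nat.mul_pos (by omega) (by omega)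
    nlinarith [Nat.zero_le (L * H)]
  refine HaltsIn.mono (T := β * ((const 2).weight + (add (var 7) (const 3)).weight + 1) +
    (β * ((const 11).weight +
      (mul (rem (var 7) (var 10)) (sub (var 0) (const 2))).weight + 1) +
    (β * ((const 12).weight +
      (mul (rem (div (var 7) (var 10)) (var 10)) (sub (var 0) (const 2))).weight + 1) +
    (β * ((const 13).weight +
      (mul (div (div (var 7) (var 10)) (var 10)) (mul (var 4) (var 5))).weight + 1) +
    (fillTime β (inputLen N m L H) + (23 * β * t +
      ((N - 2) * (β * checkWeight) + 3 * (2 * (N + t)) +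
        (N - 2) * (β * forWeight 9 (sub (var 0) (const 2))) +
        β * forWeight 9 (sub (var 0) (const 2)))))))))
    ?_ ?_ fun _ h => h
  · refine (haltsIn_assign hβ hs.low (z := (γ + 3 : ℕ)) (IsLow.add (isLow_var 7) (isLow_const 3))
      (by simp [eval, h7]) (post := fun s' => SameExcept V G (γ + 3 : ℕ) s s' ∧ LowBounded β s' ∧
        s' 5 2 = (γ + 3 : ℕ) ∧ s' 0 = s 0 ∧ view G (γ + 3 : ℕ) s' = fun _ _ => 0) ?_).seq ?_
    · refine ⟨.write_scalar _ (by simp [hV]) _, hs.low.write (.inr (by simp; omega)),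
        by simp [Memory.write_apply], Memory.write_apply_of_ne _ _ _ (by omega), ?_⟩
      rw [view_write_low _ (by omega), hzero]
    rintro s₁ ⟨hr₁, hlow₁, hg₁, h0₁, hz₁⟩
    have h7₁ : s₁ 5 7 = γ := (hr₁.2.1 7 (by norm_num [hV])).trans h7
    have hs₁ := hready s₁ hr₁ hlow₁
    refine (haltsIn_assign hβ hs₁.low (z := o₁)
      (IsLow.mul (IsLow.rem (isLow_var 7) (isLow_var 10)) (IsLow.sub (isLow_var 0) (isLow_const 2)))
      (by simp [eval, eval_rem, h7₁, hs₁.groups, hs₁.len, ho₁, hN2])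
      (post := fun s' => SameExcept V G (γ + 3 : ℕ) s s' ∧ LowBounded β s' ∧
        s' 5 2 = (γ + 3 : ℕ) ∧ s' 5 11 = o₁ ∧ s' 0 = s 0 ∧
        view G (γ + 3 : ℕ) s' = fun _ _ => 0) ?_).seq ?_
    · refine ⟨hr₁.trans (.write_scalar _ (by simp [hV]) _), hlow₁.write (.inr (by simpa using h₁)),
        by simp [Memory.write_apply, hg₁], by simp [Memory.write_apply],
        (Memory.write_apply_of_ne _ _ _ (by omega)).trans h0₁, ?_⟩
      rw [view_write_low _ (by omega), hz₁]
    rintro s₂ ⟨hr₂, hlow₂, hg₂, h11₂, h0₂, hz₂⟩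
    have h7₂ : s₂ 5 7 = γ := (hr₂.2.1 7 (by norm_num [hV])).trans h7
    have hs₂ := hready s₂ hr₂ hlow₂
    refine (haltsIn_assign hβ hs₂.low (z := o₂)
      (IsLow.mul (IsLow.rem (IsLow.div (isLow_var 7) (isLow_var 10)) (isLow_var 10))
        (IsLow.sub (isLow_var 0) (isLow_const 2)))
      (by simp [eval, eval_rem, h7₂, hs₂.groups, hs₂.len, ho₂, hN2])
      (post := fun s' => SameExcept V G (γ + 3 : ℕ) s s' ∧ LowBounded β s' ∧
        s' 5 2 = (γ + 3 : ℕ) ∧ s' 5 11 = o₁ ∧ s' 5 12 = o₂ ∧ s' 0 = s 0 ∧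
        view G (γ + 3 : ℕ) s' = fun _ _ => 0) ?_).seq ?_
    · refine ⟨hr₂.trans (.write_scalar _ (by simp [hV]) _), hlow₂.write (.inr (by simpa using h₂)),
        by simp [Memory.write_apply, hg₂], by simp [Memory.write_apply, h11₂],
        by simp [Memory.write_apply], (Memory.write_apply_of_ne _ _ _ (by omega)).trans h0₂, ?_⟩
      rw [view_write_low _ (by omega), hz₂]
    rintro s₃ ⟨hr₃, hlow₃, hg₃, h11₃, h12₃, h0₃, hz₃⟩
    have h7₃ : s₃ 5 7 = γ := (hr₃.2.1 7 (by norm_num [hV])).trans h7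
    have hs₃ := hready s₃ hr₃ hlow₃
    refine (haltsIn_assign hβ hs₃.low (z := o₃)
      (IsLow.mul (IsLow.div (IsLow.div (isLow_var 7) (isLow_var 10)) (isLow_var 10))
        (IsLow.mul (isLow_var 4) (isLow_var 5)))
      (by simp [eval, h7₃, hs₃.groups, hs₃.layers, hs₃.heads, ho₃])
      (post := fun s' => SameExcept V G (γ + 3 : ℕ) s s' ∧ LowBounded β s' ∧
        s' 5 2 = (γ + 3 : ℕ) ∧ s' 5 11 = o₁ ∧ s' 5 12 = o₂ ∧ s' 5 13 = o₃ ∧ s' 0 = s 0 ∧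
        view G (γ + 3 : ℕ) s' = fun _ _ => 0) ?_).seq ?_
    · refine ⟨hr₃.trans (.write_scalar _ (by simp [hV]) _), hlow₃.write (.inr (by simpa using h₃)),
        by simp [Memory.write_apply, hg₃], by simp [Memory.write_apply, h11₃],
        by simp [Memory.write_apply, h12₃], by simp [Memory.write_apply],
        (Memory.write_apply_of_ne _ _ _ (by omega)).trans h0₃, ?_⟩
      rw [view_write_low _ (by omega), hz₃]
    rintro s₄ ⟨hr₄, hlow₄, hg₄, h11₄, h12₄, h13₄, h0₄, hz₄⟩
    refine (haltsIn_fillProgram (n := n) (d := d) hβ hn hd (by omega) hm0 hL0 hH0 hγ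
      (hready s₄ hr₄ hlow₄) hg₄ h11₄ h12₄ h13₄ hlen hz₄).seq ?_
    rintro s₅ ⟨hr₅, h0₅, hlow₅, hv₅⟩
    have hr₅' : SameExcept V G (γ + 3 : ℕ) s s₅ :=
      hr₄.trans (hr₅.mono (by simp [hV]))
    have hg₅ : s₅ 5 2 = (γ + 3 : ℕ) := (hr₅.2.1 2 (by simp)).trans hg₄
    refine (haltsIn_relocate hβ hγ hG2 hp hv₅ (hready s₅ hr₅' hlow₅).gens hg₅).seq ?_
    rintro s₆ ⟨hsame, hpost, hbits⟩
    have hr₆ : SameExcept V G (γ + 3 : ℕ) s s₆ := hr₅'.trans hsame.sameExcept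
    have hlow₆ := hlow₅.of_sameOutside hsame
    have hs₆ := hready s₆ hr₆ hlow₆
    have hg₆ : s₆ 5 2 = (γ + 3 : ℕ) := by rw [hsame.1 5 (by omega), hg₅]
    refine (haltsIn_checkLoop (g := γ + 3) hβ hN3 hs₆.len hs₆.gens hg₆ hlow₆
      (hNlen.trans hlen) P hpost).mono ?_ ?_
    -- The output array is blank at the start, where each cell has bit length `1`; hence the
    -- cardinality.
    · have hb : ∀ F : Finset ℤ, ∑ i ∈ F, bitLen (view G (γ + 3 : ℕ) s₆ 0 i) ≤ F.card + t := by
        intro F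
        refine (hbits 0 F).trans ?_
        simp [transformerMemory_zero, bitLen]
      have b1 := sum_bitLen_output_le (K := N - 2) (fun i : ℕ => 2 * ((i : ℤ) + 2))
        (fun i j h => by simp at h; exact h) hb
      have b2 := sum_bitLen_output_le (K := N - 2) (fun i : ℕ => 2 * ((i : ℤ) + 2) + 1)
        (fun i j h => by simp at h; exact h) hb
      simp only [Finset.sum_add_distrib, ← Finset.mul_sum, Finset.sum_const, Finset.card_range,
        smul_eq_mul]
      have c1 : (N - 2) * (β * checkWeight) = β * ((N - 2) * checkWeight) := by ring
      have c2 : (N - 2) * (β * forWeight 9 (sub (var 0) (const 2))) =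
        β * ((N - 2) * forWeight 9 (sub (var 0) (const 2))) := by ring
      omega
    · rintro s' ⟨hin, hsc, hview, hlow', hyes, hno⟩
      refine ⟨hr₆.trans ⟨hin, fun v hv => hsc v ?_, fun g' _ _ _ => hview g'⟩, hlow', hyes,
        fun h => ?_⟩
      · rintro rfl
        simp [hV] at hv
      · rw [hno h, hsame.1 0 (by omega), h0₅, h0₄]
  · have hlen1 : 1 ≤ inputLen N m L H := by omega
    have hN2' : N - 2 ≤ inputLen N m L H := by omega
    simp only [fillTime, Finset.sum_const, Finset.card_range, smul_eq_mul]
    unfold runWeight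
    generalize inputLen N m L H = l at *
    generalize (const 2).weight + (add (var 7) (const 3)).weight + 1 = a₁
    generalize (const 11).weight +
      (mul (rem (var 7) (var 10)) (sub (var 0) (const 2))).weight + 1 = a₂
    generalize (const 12).weight +
      (mul (rem (div (var 7) (var 10)) (var 10)) (sub (var 0) (const 2))).weight + 1 = a₃
    generalize (const 13).weight +
      (mul (div (div (var 7) (var 10)) (var 10)) (mul (var 4) (var 5))).weight + 1 = a₄
    generalize forWeight 8 lenE = a₅
    generalize forWeight 9 (sub (var 0) (const 2)) = a₆
    generalize fillWeight 9 = a₇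
    generalize checkWeight = a₈
    have e0 : β ≤ β * (l + t) := Nat.le_mul_of_pos_right _ (by omega)
    have e1 : ∀ a, β * a ≤ a * (β * (l + t)) := fun a => by
      rw [mul_comm]; exact Nat.mul_le_mul_left _ e0
    have e2 : ∀ a, l * (β * a) ≤ a * (β * (l + t)) := fun a => by
      calc l * (β * a) = a * (β * l) := by ring
        _ ≤ _ := by gcongr; omega
    have e3 : ∀ a, (N - 2) * (β * a) ≤ a * (β * (l + t)) := fun a =>
      (Nat.mul_le_mul_right _ hN2').trans (e2 a)
    have e4 : 23 * β * t ≤ 23 * (β * (l + t)) := by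
      rw [mul_assoc]; gcongr; omega
    have e5 : N + t ≤ β * (l + t) :=
      (Nat.add_le_add_right hNlen t).trans (Nat.le_mul_of_pos_left _ (by omega))
    have := e1 a₁
    have := e1 a₂
    have := e1 a₃
    have := e1 a₄
    have := e1 a₅
    have := e1 a₆
    have := e2 a₅
    have := e2 a₇
    have := e3 a₆
    have := e3 a₈
    simp only [add_mul, mul_add l, two_mul] at *
    omega

/-! ### All runs -/

/-- Some vector of the current group in `A` is orthogonal to some pair of vectors of the current
groups in `B` and `C`. -/
def RunHits (w : Memory) (n d N L H o₁ o₂ o₃ : ℕ) : Prop :=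
  ∃ i, 2 ≤ i ∧ i < N ∧ ∃ ℓ < L, ∃ h < H, HitsAt N d (fun i => vectorAt (w 2) n d (o₁ + i))
    (fun i => vectorAt (w 3) n d (o₂ + i)) (vectorAt (w 4) n d (o₃ + (ℓ * H + h))) i

def runsProgram (p : Program) : Program := .forLoop 7 (var 6) (runProgram p)

/-- The program `p` finds all hits in all transformers that encode groups of vectors of `w`. -/
def SolvesRuns (p : Program) (w : Memory) (n d N m L H t : ℕ) : Prop :=
  ∀ o₁ o₂ o₃ : ℕ,
    HaltsIn p (transformerMemory (runCode w n d N m L H o₃) (runInput w n d N m o₁ o₂)) t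
      fun v => ∀ i : ℕ, 2 ≤ i → i < N → (0 < v 0 (2 * i + 1) - 2 * v 0 (2 * i) ↔
        ∃ ℓ < L, ∃ h < H, HitsAt N d (fun i => vectorAt (w 2) n d (o₁ + i))
          (fun i => vectorAt (w 3) n d (o₂ + i)) (vectorAt (w 4) n d (o₃ + (ℓ * H + h))) i)

theorem runScalars_subset : ({2, 8, 9, 11, 12, 13} : Set ℤ) ⊆ {2, 7, 8, 9, 11, 12, 13} := by
  intro v hv
  simp only [Set.mem_insert_iff, Set.mem_singleton_iff] at hv ⊢
  omega

/-- The invariant records that all generations from `γ + 3` on are still blank, so run `γ` starts on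
clean memory; the generations `0, 1, 2` belong to the computation of the parameters. -/
theorem haltsIn_runsProgram (hβ : 1 ≤ β) (hn : w 1 0 = n) (hd : w 1 1 = d) (hN3 : 3 ≤ N)
    (hm0 : 0 < m) (hL0 : 0 < L) (hH0 : 0 < H) {uz : ℕ} (hGR : ux * ux * uz + 3 ≤ G)
    (hG2 : G ≤ 2 ^ β) (hux : ux * (N - 2) ≤ 2 ^ β) (huz : uz * (L * H) ≤ 2 ^ β)
    (hlen : inputLen N m L H ≤ 2 ^ β) {s : Memory} (hs : Ready β w N G m L H ux s)
    (h6 : s 5 6 = (ux * ux * uz : ℕ)) (h0 : s 0 0 = 0)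
    (hzero : ∀ g : ℕ, 3 ≤ g → g < G → view G g s = fun _ _ => 0) {p : Program} {t : ℕ}
    (hp : SolvesRuns p w n d N m L H t) :
    HaltsIn (runsProgram p) s
      ((runWeight + 2 * forWeight 7 (var 6)) * (β * ((ux * ux * uz + 1) *
        (inputLen N m L H + t)))) fun s' =>
      ((∃ γ < ux * ux * uz, RunHits w n d N L H (γ % ux * (N - 2)) (γ / ux % ux * (N - 2))
        (γ / ux / ux * (L * H))) → s' 0 0 = 1) ∧
      ((¬ ∃ γ < ux * ux * uz, RunHits w n d N L H (γ % ux * (N - 2)) (γ / ux % ux * (N - 2))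
        (γ / ux / ux * (L * H))) → s' 0 0 = 0) := by
  set R := ux * ux * uz with hR
  have hNlen : 1 ≤ inputLen N m L H := by
    unfold inputLen
    have : 1 ≤ (m + 1) * (m + 1) := Nat.mul_pos (by omega) (by omega)
    nlinarith [Nat.zero_le (L * H)]
  refine (haltsIn_forLoop hβ (isLow_var 6) (n := R)
    (fun γ s' => γ ≤ R ∧ Ready β w N G m L H ux s' ∧ s' 5 7 = γ ∧ s' 5 6 = R ∧
      (∀ g : ℕ, γ + 3 ≤ g → g < G → view G g s' = fun _ _ => 0) ∧
      ((∃ γ' < γ, RunHits w n d N L H (γ' % ux * (N - 2)) (γ' / ux % ux * (N - 2))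
        (γ' / ux / ux * (L * H))) → s' 0 0 = 1) ∧
      ((¬ ∃ γ' < γ, RunHits w n d N L H (γ' % ux * (N - 2)) (γ' / ux % ux * (N - 2))
        (γ' / ux / ux * (L * H))) → s' 0 0 = 0))
    (fun _ => runWeight * (β * (inputLen N m L H + t))) hs.low (fun γ s' h => h.2.1.low)
    (fun γ s' h => h.2.2.1) (fun γ s' h => h.2.2.2.1) ?_ ?_).mono ?_ ?_
  · have hrel : SameExcept {7} G 0 s (s.write 5 7 0) := .write_scalar s (by simp) 0
    refine ⟨by omega, hs.of_sameExcept hrel (hs.low.write (.inr (by simp)))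
      (by rintro v rfl; norm_num), by simp [Memory.write_apply], by simp [Memory.write_apply, h6],
      fun g h1 h2 => ?_, by simp, fun _ => by simp [Memory.write_apply, h0]⟩
    rw [view_write_low _ (by omega), hzero g (by omega) h2]
  · rintro γ s' hγ ⟨-, hs', h7', h6', hz', hyes, hno⟩
    have hux0 : 0 < ux := by
      clear hp
      rcases Nat.eq_zero_or_pos ux with h | h
      · rw [hR, h] at hγ; simp at hγ
      · exact h
    have hγz : γ / ux / ux < uz := by
      rw [Nat.div_div_eq_div_mul, Nat.div_lt_iff_lt_mul (by positivity)]
      rw [hR] at hγ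
      calc γ < ux * ux * uz := hγ
        _ = uz * (ux * ux) := by ring
    have o1 : γ % ux * (N - 2) ≤ 2 ^ β :=
      (Nat.mul_le_mul_right _ (Nat.mod_lt _ hux0).le).trans hux
    have o2 : γ / ux % ux * (N - 2) ≤ 2 ^ β :=
      (Nat.mul_le_mul_right _ (Nat.mod_lt _ hux0).le).trans hux
    have o3 : γ / ux / ux * (L * H) ≤ 2 ^ β := (Nat.mul_le_mul_right _ hγz.le).trans huz
    refine (haltsIn_runProgram hβ hn hd hN3 hm0 hL0 hH0 (γ := γ) (by omega) hG2 hlen hs' h7' rfl rfl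
      rfl o1 o2 o3 (hz' _ le_rfl (by omega)) (hp _ _ _)).mono le_rfl ?_
    rintro s'' ⟨hrel, hlow, hyes', hno'⟩
    have h7'' : s'' 5 7 = γ := (hrel.2.1 7 (by norm_num)).trans h7'
    have hlow' : LowBounded β (s''.write 5 7 ((γ : ℤ) + 1)) :=
      hlow.write (.inr (by rw [natAbs_natCast_add_one]; omega))
    have hrel' : SameExcept {2, 7, 8, 9, 11, 12, 13} G (γ + 3 : ℕ) s'
        (s''.write 5 7 ((γ : ℤ) + 1)) :=
      (hrel.mono runScalars_subset).trans (.write_scalar _ (by simp) _)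
    refine ⟨hlow, h7'', by omega, hs'.of_sameExcept hrel' hlow' ?_, by simp [Memory.write_apply],
      ?_, ?_, ?_, ?_⟩
    · rintro v (rfl | rfl | rfl | rfl | rfl | rfl | rfl) <;> norm_num
    · rw [hrel'.2.1 6 (by norm_num), h6']
    · intro g h1 h2
      rw [hrel'.2.2 g (by positivity) (by exact_mod_cast h2)
        (by intro h; have : g = γ + 3 := by exact_mod_cast h
            omega), hz' g (by omega) h2]
    · rintro ⟨γ', hlt, hit⟩
      rw [Memory.write_apply_of_ne _ _ _ (by omega)]
      by_cases hcur : RunHits w n d N L H (γ % ux * (N - 2)) (γ / ux % ux * (N - 2))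
        (γ / ux / ux * (L * H))
      · exact hyes' hcur
      · rw [hno' hcur]
        refine hyes ⟨γ', ?_, hit⟩
        have : γ' ≠ γ := by
          rintro rfl
          exact hcur hit
        omega
    · intro h
      rw [Memory.write_apply_of_ne _ _ _ (by omega), hno' fun hcur => h ⟨γ, by omega, hcur⟩]
      exact hno fun ⟨γ', hlt, hit⟩ => h ⟨γ', by omega, hit⟩
  · simp only [Finset.sum_const, Finset.card_range, smul_eq_mul]
    generalize inputLen N m L H = l at *
    generalize forWeight 7 (var 6) = a
    have e1 : β * a ≤ a * (β * ((R + 1) * (l + t))) := by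
      rw [mul_comm]
      exact Nat.mul_le_mul_left _ (Nat.le_mul_of_pos_right _ (Nat.mul_pos (by omega) (by omega)))
    have e2 : R * (β * a) ≤ a * (β * ((R + 1) * (l + t))) := by
      calc R * (β * a) = a * (β * (R * 1)) := by ring
        _ ≤ _ := by gcongr <;> omega
    have e3 : R * (runWeight * (β * (l + t))) ≤ runWeight * (β * ((R + 1) * (l + t))) := by
      calc R * (runWeight * (β * (l + t))) = runWeight * (β * (R * (l + t))) := by ring
        _ ≤ _ := by gcongr; omega
    generalize β * ((R + 1) * (l + t)) = Z at *
    rw [mul_add, add_mul, two_mul, add_mul]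
    omega
  · rintro s' ⟨-, -, -, -, -, hyes, hno⟩
    exact ⟨hyes, hno⟩

end Solver

/-! ### The parameters `N, m, L, H` and the complete program for 3-OV -/

section Preamble

variable {β : ℕ} {w : Memory} {n d N G m L H : ℕ}

/-- The input of a program that computes a function of `N`. -/
def natMemory (N : ℕ) : Memory := fun a =>
  match a with
  | 1 => arrayOf (listCells [(N : ℤ)])
  | _ => arrayOf (listCells [])

theorem arrayOf_listCells_nil (i : ℤ) : arrayOf (listCells []) i = 0 := by
  cases i <;> simp [arrayOf, listCells]

theorem write_zero_eq_natMemory (N : ℕ) :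
    Memory.write (fun _ _ => 0) 1 0 (N : ℤ) = natMemory N := by
  funext a i
  by_cases ha : a = 1
  · subst ha
    rw [Memory.write_apply]
    by_cases hi : i = 0
    · subst hi
      simp [natMemory, arrayOf, listCells]
    · rw [if_neg (by simp [hi])]
      rcases i with (_ | i) | i
      · exact (hi rfl).elim
      · simp [natMemory, arrayOf, listCells]
      · rfl
  · rw [Memory.write_apply_of_ne _ _ _ ha]
    unfold natMemory
    split
    · contradiction
    · rw [arrayOf_listCells_nil]

/-- Computes the value of the program `p` at `N` into the scalar `v`. -/
def paramProgram (g : ℕ) (v : ℤ) (p : Program) : Program :=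
  .seq (.assign 2 (const g)) (.seq (.set 7 (const 0).cellIndex (var 0))
    (.seq p.relocate (.assign v (get 6 (const 0).cellIndex))))

def paramWeight (g : ℕ) (v : ℤ) : ℕ :=
  ((const 2).weight + (const g).weight + 1) + ((const 0).cellIndex.weight + (var 0).weight + 1) +
    23 + ((const v).weight + (const 0).cellIndex.weight + 4)

/-- The bound `f ≤ 2 ^ β` makes the result fit among the scalars and pays for copying it out of the
private memory. -/
theorem haltsIn_paramProgram (hβ : 1 ≤ β) {g : ℕ} (hgG : g < G) (hG2 : G ≤ 2 ^ β) {v : ℤ} {p : Program}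
    {f t : ℕ} (hf : f ≤ 2 ^ β) (hp : HaltsIn p (natMemory N) t fun s' => s' 0 0 = f) {s : Memory}
    (hs : LowBounded β s) (hN : s 5 0 = N) (hG : s 5 1 = G) (hzero : view G g s = fun _ _ => 0) :
    HaltsIn (paramProgram g v p) s (paramWeight g v * (β * (t + 1))) fun s' =>
      SameExcept {2, v} G g s s' ∧ s' 0 = s 0 ∧ LowBounded β s' ∧ s' 5 v = f := by
  refine HaltsIn.mono (T := β * ((const 2).weight + (const g).weight + 1) +
    (β * ((const 0).cellIndex.weight + (var 0).weight + 1) + (23 * β * t +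
      β * ((const v).weight + (const 0).cellIndex.weight + 4)))) ?_ ?_ fun _ h => h
  · refine (haltsIn_assign hβ hs (z := g) (isLow_const _) rfl (post := fun s' =>
      s' = s.write 5 2 g) rfl).seq ?_
    rintro s₁ rfl
    have hlow₁ : LowBounded β (s.write 5 2 g) := hs.write (.inr (by simp; omega))
    have hG₁ : s.write 5 2 g 5 1 = G := by simp [Memory.write_apply, hG]
    have hg₁ : s.write 5 2 g 5 2 = g := by simp [Memory.write_apply]
    refine (haltsIn_set_low hβ hlow₁ (isLow_cellIndex (isLow_const 0)) (isLow_var 0) (post :=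
      fun s' => SameOutside G g (s.write 5 2 g) s' ∧ view G g s' = natMemory N) ?_).seq ?_
    · rw [eval_cellIndex hG₁ hg₁]
      refine ⟨.write (by positivity) (by exact_mod_cast hgG) _ _ _ _, ?_⟩
      rw [view_write (a := 1) (by positivity) (by exact_mod_cast hgG), view_write_low _ (by omega),
        hzero, ← write_zero_eq_natMemory]
      simp [eval, Memory.write_apply, hN]
    rintro s₂ ⟨hsame₂, hview₂⟩
    have h₂ : ∀ v, s₂ 5 v = s.write 5 2 g 5 v := fun v => by rw [hsame₂.1 5 (by omega)]
    refine (haltsIn_relocate hβ hgG hG2 hp hview₂ ((h₂ 1).trans hG₁) ((h₂ 2).trans hg₁)).seq ?_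
    rintro s₃ ⟨hsame₃, hval, -⟩
    have hsame := hsame₂.trans hsame₃
    have h₃ : ∀ v, s₃ 5 v = s.write 5 2 g 5 v := fun v => by rw [hsame.1 5 (by omega)]
    have hlow₃ := hlow₁.of_sameOutside hsame
    have hev : (get 6 (const 0).cellIndex).eval s₃ = f := by
      rw [← hval]
      simp only [eval, eval_cellIndex ((h₃ 1).trans hG₁) ((h₃ 2).trans hg₁), view]
    refine haltsIn_set ?_ ?_
    · have b1 := cost_le hβ hlow₃ _ (isLow_const v)
      have b2 := cost_le hβ hlow₃ _ (isLow_cellIndex (isLow_const 0))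
      have b3 := bitLen_le_of_le_two_pow (z := (f : ℤ)) hβ (by simpa using hf)
      have b4 : (get 6 (const 0).cellIndex).cost s₃ = (const 0).cellIndex.cost s₃ + bitLen f := by
        rw [← hev]
        rfl
      rw [b4]
      nlinarith
    · rw [hev]
      refine ⟨?_, ?_, hlow₃.write (.inr (by simpa using hf)), by simp [Memory.write_apply, eval]⟩
      · exact ((SameExcept.write_scalar s (by simp) (g : ℤ)).trans hsame.sameExcept).trans
          (.write_scalar _ (by simp [eval]) _)
      · rw [Memory.write_apply_of_ne _ _ _ (by omega), hsame.1 0 (by omega),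
          Memory.write_apply_of_ne _ _ _ (by omega)]
  · unfold paramWeight
    have e0 : β ≤ β * (t + 1) := Nat.le_mul_of_pos_right _ (by omega)
    have e1 : ∀ a, β * a ≤ a * (β * (t + 1)) := fun a => by
      rw [mul_comm]; exact Nat.mul_le_mul_left _ e0
    have e4 : 23 * β * t ≤ 23 * (β * (t + 1)) := by
      rw [mul_assoc]; gcongr; omega
    have := e1 ((const 2).weight + (const g).weight + 1)
    have := e1 ((const 0).cellIndex.weight + (var 0).weight + 1)
    have := e1 ((const v).weight + (const 0).cellIndex.weight + 4)
    rw [add_mul, add_mul, add_mul]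
    omega

/-- The expression `(N + 1) ^ q`. -/
def succPowE : ℕ → RExpr
  | 0 => const 1
  | q + 1 => mul (succPowE q) (add (var 0) (const 1))

theorem isLow_succPowE (q : ℕ) : (succPowE q).IsLow := by
  induction q with
  | zero => trivial
  | succ q ih => exact ⟨ih, isLow_var 0, trivial⟩

theorem eval_succPowE {s : Memory} {i : ℕ} (h : s 5 0 = i) (q : ℕ) :
    (succPowE q).eval s = (((i + 1) ^ q : ℕ) : ℤ) := by
  induction q with
  | zero => simp [succPowE, eval]
  | succ q ih => simp [succPowE, eval, ih, h, pow_succ]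

/-- Positive exactly if `(N + 1) ^ q ≤ n` for the current candidate `N`. Counting upwards is
affordable, since the root is small compared with `n`. -/
def rootCond (q : ℕ) : RExpr := sub (add (get 1 (const 0)) (const 1)) (succPowE q)

/-- Computes the integer part of the `q`-th root of `n`. -/
def rootProgram (q : ℕ) : Program :=
  .loop (rootCond q) (.assign 0 (add (var 0) (const 1)))

def rootWeight (q : ℕ) : ℕ :=
  ((const 0).weight + (add (var 0) (const 1)).weight + 1) + ((rootCond q).weight + 1)

theorem haltsIn_rootProgram (hβ : 1 ≤ β) {q : ℕ} (hn : w 1 0 = n) (hN : N ^ q ≤ n)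
    (hN' : n < (N + 1) ^ q) (hNβ : N ≤ 2 ^ β) (hw : LowBounded β w) (hw5 : w 5 0 = 0) :
    HaltsIn (rootProgram q) w (rootWeight q * (β * (N + 1))) fun s =>
      (∀ a, a ≠ 5 → s a = w a) ∧ LowBounded β s ∧ s 5 0 = N := by
  have hlow : (rootCond q).IsLow := ⟨⟨⟨by omega, trivial⟩, trivial⟩, isLow_succPowE q⟩
  refine (haltsIn_loop (n := N) (κ := β * (rootCond q).weight) (fun i s => i ≤ N ∧
    (∀ a, a ≠ 5 → s a = w a) ∧ LowBounded β s ∧ s 5 0 = i)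
    (fun _ => β * ((const 0).weight + (add (var 0) (const 1)).weight + 1)) ?_ ?_ ?_ N 0 w
    (by omega) ⟨by omega, fun _ _ => rfl, hw, by simpa using hw5⟩).mono ?_ ?_
  · rintro i s ⟨hi, hin, -, h0⟩
    have : (rootCond q).eval s = (n : ℤ) + 1 - ((i + 1) ^ q : ℕ) := by
      simp only [rootCond, eval, eval_succPowE h0, hin 1 (by omega), hn]
    rw [this]
    constructor
    · intro h
      by_contra hlt
      have : i = N := by omega
      subst this
      omega
    · intro h
      have : (i + 1) ^ q ≤ N ^ q := Nat.pow_le_pow_left h q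
      omega
  · rintro i s ⟨-, -, hs, -⟩
    exact cost_le hβ hs _ hlow
  · rintro i s hi ⟨-, hin, hs, h0⟩
    refine haltsIn_assign hβ hs (z := (i : ℤ) + 1) (IsLow.add (isLow_var 0) (isLow_const 1))
      (by simp [eval, h0]) ⟨by omega, fun a ha => ?_, hs.write (.inr ?_), ?_⟩
    · rw [Memory.write_apply_of_ne _ _ _ ha, hin a ha]
    · rw [natAbs_natCast_add_one]
      omega
    · simp [Memory.write_apply]
  · simp only [Finset.sum_const, Nat.card_Ico, Nat.sub_zero, smul_eq_mul]
    unfold rootWeight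
    generalize (const 0).weight + (add (var 0) (const 1)).weight + 1 = a
    generalize (rootCond q).weight = b
    calc N * (β * a + (β * b + 1)) + (β * b + 1) ≤ N * (β * a + (β * b + β)) + (β * a + (β * b + β)) := by
          have h : β * b + 1 ≤ β * b + β := by omega
          have := Nat.mul_le_mul_left N (Nat.add_le_add_left h (β * a))
          omega
      _ = (a + (b + 1)) * (β * (N + 1)) := by ring
  · rintro s ⟨-, h1, h2, h3⟩
    exact ⟨h1, h2, h3⟩

/-- The number of generations `(n + 1)³ + 3`: at most `(n + 1)³` runs, and three computations of
parameters. -/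
def gensE : RExpr :=
  add (mul (mul (add (get 1 (const 0)) (const 1)) (add (get 1 (const 0)) (const 1)))
    (add (get 1 (const 0)) (const 1))) (const 3)

def groupsE : RExpr := add (div (get 1 (const 0)) (sub (var 0) (const 2))) (const 1)

def runsE : RExpr :=
  mul (mul (var 10) (var 10)) (add (div (get 1 (const 0)) (mul (var 4) (var 5))) (const 1))

/-- The program for 3-OV that uses the program `p` for transformers and the programs `pm`, `pL`,
`pH` for their parameters. -/
def solver (q : ℕ) (pm pL pH p : Program) : Program :=
  .seq (rootProgram q) (.seq (.assign 1 gensE) (.seq (paramProgram 0 3 pm)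
    (.seq (paramProgram 1 4 pL) (.seq (paramProgram 2 5 pH) (.seq (.assign 10 groupsE)
      (.seq (.assign 6 runsE) (runsProgram p)))))))

def solverWeight (q : ℕ) : ℕ :=
  rootWeight q + ((const 1).weight + gensE.weight + 1) + paramWeight 0 3 + paramWeight 1 4 +
    paramWeight 2 5 + ((const 10).weight + groupsE.weight + 1) +
    ((const 6).weight + runsE.weight + 1) + (runWeight + 2 * forWeight 7 (var 6))

/-- The number of runs. -/
def numGroups (n N : ℕ) : ℕ := n / (N - 2) + 1

/-- A run is numbered in mixed radix: its two low digits select the groups in `A` and `B`, the high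
digit the group in `C`. -/
def numRuns (n N L H : ℕ) : ℕ := numGroups n N * numGroups n N * (n / (L * H) + 1)

/-- The size conditions place all scalars, in particular the generation count, the offsets and the
cell counters, below `2 ^ β`, so the program's own bookkeeping costs `O(β)` per operation. -/
theorem haltsIn_solver (hβ : 1 ≤ β) {q : ℕ} (hn : w 1 0 = n) (hd : w 1 1 = d) (hN : N ^ q ≤ n)
    (hN' : n < (N + 1) ^ q) (hNn : N ≤ n) (hN3 : 3 ≤ N) (hm0 : 0 < m) (hL0 : 0 < L) (hH0 : 0 < H)
    (hLH : L * H ≤ n) (hG2 : (n + 1) * (n + 1) * (n + 1) + 3 ≤ 2 ^ β)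
    (hlen : inputLen N m L H ≤ 2 ^ β) (hw : LowBounded β w) (hw0 : w 0 0 = 0)
    (hw5 : ∀ a i, 5 ≤ a → w a i = 0) {pm pL pH p : Program} {tm tL tH t : ℕ}
    (hm : HaltsIn pm (natMemory N) tm fun s' => s' 0 0 = m)
    (hL : HaltsIn pL (natMemory N) tL fun s' => s' 0 0 = L)
    (hH : HaltsIn pH (natMemory N) tH fun s' => s' 0 0 = H)
    (hp : SolvesRuns p w n d N m L H t) :
    HaltsIn (solver q pm pL pH p) w (solverWeight q * (β * ((N + 1) + (tm + 1) + (tL + 1) +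
        (tH + 1) + (numRuns n N L H + 1) * (inputLen N m L H + t)))) fun s' =>
      ((∃ γ < numRuns n N L H, RunHits w n d N L H (γ % numGroups n N * (N - 2))
        (γ / numGroups n N % numGroups n N * (N - 2))
        (γ / numGroups n N / numGroups n N * (L * H))) → s' 0 0 = 1) ∧
      ((¬ ∃ γ < numRuns n N L H, RunHits w n d N L H (γ % numGroups n N * (N - 2))
        (γ / numGroups n N % numGroups n N * (N - 2))
        (γ / numGroups n N / numGroups n N * (L * H))) → s' 0 0 = 0) := by
  set G := (n + 1) * (n + 1) * (n + 1) + 3 with hGdef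
  have hn2 : n + n ≤ 2 ^ β := by
    refine le_trans ?_ hG2
    rw [hGdef]
    nlinarith [Nat.zero_le (n * n), Nat.zero_le (n * n * n)]
  have hLH1 : 1 ≤ L * H := Nat.mul_pos hL0 hH0
  have hL2 : L ≤ 2 ^ β := by
    have : L ≤ L * H := Nat.le_mul_of_pos_right _ hH0
    omega
  have hH2 : H ≤ 2 ^ β := by
    have : H ≤ L * H := Nat.le_mul_of_pos_left _ hL0
    omega
  have hm2 : m ≤ 2 ^ β := by
    refine le_trans ?_ hlen
    unfold inputLen
    have h1 : m ≤ (m + 1) * (m + 1) := by nlinarith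
    have h2 : (m + 1) * (m + 1) ≤ (N + L * H) * ((m + 1) * (m + 1)) :=
      Nat.le_mul_of_pos_left _ (by omega)
    omega
  set ux := numGroups n N with hux
  have hux1 : ux ≤ n + 1 := by
    have := Nat.div_le_self n (N - 2)
    simp only [hux, numGroups]
    omega
  have huxN : ux * (N - 2) ≤ 2 ^ β := by
    have := Nat.div_mul_le_self n (N - 2)
    simp only [hux, numGroups, add_mul, one_mul]
    omega
  have huz1 : n / (L * H) + 1 ≤ n + 1 := Nat.add_le_add_right (Nat.div_le_self n _) 1
  have huzN : (n / (L * H) + 1) * (L * H) ≤ 2 ^ β := by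
    have := Nat.div_mul_le_self n (L * H)
    rw [add_mul, one_mul]
    omega
  have hR : ux * ux * (n / (L * H) + 1) + 3 ≤ G := by
    rw [hGdef]
    gcongr
  refine HaltsIn.mono (T := rootWeight q * (β * (N + 1)) +
    (β * ((const 1).weight + gensE.weight + 1) + (paramWeight 0 3 * (β * (tm + 1)) +
    (paramWeight 1 4 * (β * (tL + 1)) + (paramWeight 2 5 * (β * (tH + 1)) +
    (β * ((const 10).weight + groupsE.weight + 1) + (β * ((const 6).weight + runsE.weight + 1) +
    ((runWeight + 2 * forWeight 7 (var 6)) * (β * ((ux * ux * (n / (L * H) + 1) + 1) *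
      (inputLen N m L H + t))))))))))) ?_ ?_ fun _ h => h
  · refine (haltsIn_rootProgram hβ hn hN hN' (by omega) hw (hw5 5 0 le_rfl)).seq ?_
    rintro s₁ ⟨hin₁, hlow₁, hN₁⟩
    refine (haltsIn_assign hβ hlow₁ (z := G) (by simp [gensE, IsLow])
      (by simp [gensE, eval, hin₁ 1 (by omega), hn, hGdef]) (post := fun s' =>
        (∀ a, a ≠ 5 → s' a = w a) ∧ LowBounded β s' ∧ s' 5 0 = N ∧ s' 5 1 = G) ?_).seq ?_
    · refine ⟨fun a ha => ?_, hlow₁.write (.inr (by simpa using hG2)), ?_, ?_⟩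
      · rw [Memory.write_apply_of_ne _ _ _ ha, hin₁ a ha]
      · simp [Memory.write_apply, hN₁]
      · simp [Memory.write_apply]
    rintro s₂ ⟨hin₂, hlow₂, hN₂, hG₂⟩
    -- So far only scalars were written, hence every private generation is blank.
    have hz₂ : ∀ g : ℕ, view G g s₂ = fun _ _ => 0 := by
      intro g
      funext a i
      simp only [view, hin₂ (a + 6) (by omega)]
      exact hw5 _ _ (by omega)
    refine (haltsIn_paramProgram hβ (g := 0) (by omega) hG2 hm2 hm hlow₂ hN₂ hG₂ (hz₂ 0)).seq ?_
    rintro s₃ ⟨hr₃, h0₃, hlow₃, hm₃⟩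
    have hN₃ : s₃ 5 0 = N := (hr₃.2.1 0 (by norm_num)).trans hN₂
    have hG₃ : s₃ 5 1 = G := (hr₃.2.1 1 (by norm_num)).trans hG₂
    have hz₃ : ∀ g : ℕ, 1 ≤ g → g < G → view G g s₃ = fun _ _ => 0 := by
      intro g hg1 hg2
      rw [hr₃.2.2 g (by positivity) (by exact_mod_cast hg2) (by norm_cast; omega), hz₂]
    refine (haltsIn_paramProgram hβ (g := 1) (by omega) hG2 hL2 hL hlow₃ hN₃ hG₃
      (hz₃ 1 le_rfl (by omega))).seq ?_
    rintro s₄ ⟨hr₄, h0₄, hlow₄, hL₄⟩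
    have hN₄ : s₄ 5 0 = N := (hr₄.2.1 0 (by norm_num)).trans hN₃
    have hG₄ : s₄ 5 1 = G := (hr₄.2.1 1 (by norm_num)).trans hG₃
    have hm₄ : s₄ 5 3 = m := (hr₄.2.1 3 (by norm_num)).trans hm₃
    have hz₄ : ∀ g : ℕ, 2 ≤ g → g < G → view G g s₄ = fun _ _ => 0 := by
      intro g hg1 hg2
      rw [hr₄.2.2 g (by positivity) (by exact_mod_cast hg2) (by norm_cast; omega),
        hz₃ g (by omega) hg2]
    refine (haltsIn_paramProgram hβ (g := 2) (by omega) hG2 hH2 hH hlow₄ hN₄ hG₄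
      (hz₄ 2 le_rfl (by omega))).seq ?_
    rintro s₅ ⟨hr₅, h0₅, hlow₅, hH₅⟩
    have hN₅ : s₅ 5 0 = N := (hr₅.2.1 0 (by norm_num)).trans hN₄
    have hG₅ : s₅ 5 1 = G := (hr₅.2.1 1 (by norm_num)).trans hG₄
    have hm₅ : s₅ 5 3 = m := (hr₅.2.1 3 (by norm_num)).trans hm₄
    have hL₅ : s₅ 5 4 = L := (hr₅.2.1 4 (by norm_num)).trans hL₄
    have hz₅ : ∀ g : ℕ, 3 ≤ g → g < G → view G g s₅ = fun _ _ => 0 := by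
      intro g hg1 hg2
      rw [hr₅.2.2 g (by positivity) (by exact_mod_cast hg2) (by norm_cast; omega),
        hz₄ g (by omega) hg2]
    have hin₅ : ∀ a, 1 ≤ a → a < 5 → s₅ a = w a := fun a h1 h2 => by
      rw [hr₅.1 a h1 h2, hr₄.1 a h1 h2, hr₃.1 a h1 h2, hin₂ a (by omega)]
    have h0₅' : s₅ 0 0 = 0 := by rw [h0₅, h0₄, h0₃, hin₂ 0 (by omega), hw0]
    have hN2 : ((N - 2 : ℕ) : ℤ) = N - 2 := by omega
    refine (haltsIn_assign hβ hlow₅ (z := ux) (by simp [groupsE, IsLow, isLow_var])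
      (by simp [groupsE, eval, hin₅ 1 (by omega) (by omega), hn, hN₅, hux, numGroups, hN2])
      (post := fun s' => s' = s₅.write 5 10 ux) rfl).seq ?_
    rintro s₆ rfl
    have hready : Ready β w N G m L H ux (s₅.write 5 10 ux) := by
      refine ⟨hlow₅.write (.inr (by simp; omega)), fun a h1 h2 => ?_, ?_, ?_, ?_, ?_, ?_, ?_⟩
      · rw [Memory.write_apply_of_ne _ _ _ (by omega), hin₅ a h1 h2]
      all_goals simp [Memory.write_apply, *]
    refine (haltsIn_assign hβ hready.low (z := (ux * ux * (n / (L * H) + 1) : ℕ))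
      (by simp [runsE, IsLow, isLow_var])
      (by simp [runsE, eval, hready.input 1 (by omega) (by omega), hn, hready.groups,
        hready.layers, hready.heads])
      (post := fun s' => Ready β w N G m L H ux s' ∧
        s' 5 6 = (ux * ux * (n / (L * H) + 1) : ℕ) ∧ s' 0 0 = 0 ∧
        ∀ g : ℕ, 3 ≤ g → g < G → view G g s' = fun _ _ => 0) ?_).seq ?_
    · have hrel : SameExcept {6} G 0 (s₅.write 5 10 ux)
          ((s₅.write 5 10 ux).write 5 6 (ux * ux * (n / (L * H) + 1) : ℕ)) :=
        .write_scalar _ (by simp) _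
      refine ⟨hready.of_sameExcept hrel (hready.low.write (.inr ?_))
        (by rintro v rfl; norm_num), by simp [Memory.write_apply], ?_, fun g h1 h2 => ?_⟩
      · rw [Int.natAbs_natCast]
        omega
      · rw [Memory.write_apply_of_ne _ _ _ (by omega), Memory.write_apply_of_ne _ _ _ (by omega),
          h0₅']
      · rw [view_write_low _ (by omega), view_write_low _ (by omega), hz₅ g h1 h2]
    rintro s₇ ⟨hready₇, h6₇, h0₇, hz₇⟩
    exact haltsIn_runsProgram hβ hn hd hN3 hm0 hL0 hH0 hR hG2 huxN huzN hlen hready₇ h6₇ h0₇ hz₇ hp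
  · unfold solverWeight numRuns
    rw [← hux]
    generalize (ux * ux * (n / (L * H) + 1) + 1) * (inputLen N m L H + t) = Z
    set T := (N + 1) + (tm + 1) + (tL + 1) + (tH + 1) + Z with hT
    have e1 : ∀ a, β * a ≤ a * (β * T) := fun a => by
      rw [mul_comm]
      exact Nat.mul_le_mul_left _ (Nat.le_mul_of_pos_right _ (by omega))
    have e2 : ∀ a b, b ≤ T → a * (β * b) ≤ a * (β * T) := fun a b hb => by gcongr
    have := e1 ((const 1).weight + gensE.weight + 1)
    have := e1 ((const 10).weight + groupsE.weight + 1)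
    have := e1 ((const 6).weight + runsE.weight + 1)
    have := e2 (rootWeight q) (N + 1) (by omega)
    have := e2 (paramWeight 0 3) (tm + 1) (by omega)
    have := e2 (paramWeight 1 4) (tL + 1) (by omega)
    have := e2 (paramWeight 2 5) (tH + 1) (by omega)
    have := e2 (runWeight + 2 * forWeight 7 (var 6)) Z (by omega)
    generalize runWeight + 2 * forWeight 7 (var 6) = a₁ at *
    generalize (const 6).weight + runsE.weight + 1 = a₂ at *
    generalize (const 10).weight + groupsE.weight + 1 = a₃ at *
    generalize (const 1).weight + gensE.weight + 1 = a₄ at *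
    simp only [add_mul]
    omega

end Preamble

/-! ### Correctness: orthogonal triples and hits of the runs -/

section Reduction

variable {n d : ℕ} {A B C : Fin n → Fin d → Bool}

theorem arrayOf_vectorCells_bit (A : Fin n → Fin d → Bool) (i : ℤ) :
    arrayOf (vectorCells A) i = 0 ∨ arrayOf (vectorCells A) i = 1 := by
  rcases i with i | i
  · simp only [arrayOf, vectorCells, blocks]
    split_ifs <;> simp
  · exact .inl rfl

theorem vectorAt_arrayOf_bit (A : Fin n → Fin d → Bool) (u : ℕ) (k : ℤ) :
    vectorAt (arrayOf (vectorCells A)) n d u k = 0 ∨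
      vectorAt (arrayOf (vectorCells A)) n d u k = 1 :=
  arrayOf_vectorCells_bit A _

theorem vectorAt_arrayOf_vectorCells (A : Fin n → Fin d → Bool) {u : ℕ} (hu : u % n < n) {k : ℕ}
    (hk : k < d) : vectorAt (arrayOf (vectorCells A)) n d u k =
      if A ⟨u % n, hu⟩ ⟨k, hk⟩ then 1 else 0 := by
  have h1 : (u % n * d + k) / d = u % n := by
    rw [mul_comm, Nat.mul_add_div (by omega), Nat.div_eq_of_lt hk, add_zero]
  have h2 : (u % n * d + k) % d = k := by
    rw [mul_comm, Nat.mul_add_mod, Nat.mod_eq_of_lt hk]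
  have h3 : ((u % n : ℕ) * d + k : ℤ) = Int.ofNat (u % n * d + k) := by push_cast; rfl
  simp only [vectorAt, h3, arrayOf, vectorCells, blocks, h1, h2, hu, hk, Nat.div_one, dite_true]

theorem runHits_ovMemory (hn : 0 < n) {N L H o₁ o₂ o₃ : ℕ} :
    RunHits (ovMemory A B C) n d N L H o₁ o₂ o₃ ↔ ∃ i, 2 ≤ i ∧ i < N ∧ ∃ ℓ < L, ∃ h < H,
      ∃ j, 2 ≤ j ∧ j < N ∧ ∀ k : Fin d, A ⟨(o₁ + i) % n, Nat.mod_lt _ hn⟩ k = false ∨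
        B ⟨(o₂ + j) % n, Nat.mod_lt _ hn⟩ k = false ∨
        C ⟨(o₃ + (ℓ * H + h)) % n, Nat.mod_lt _ hn⟩ k = false := by
  have key : ∀ u v z : ℕ, (∀ k : ℕ, k < d → vectorAt (ovMemory A B C 2) n d u k *
      vectorAt (ovMemory A B C 3) n d v k * vectorAt (ovMemory A B C 4) n d z k = 0) ↔
      ∀ k : Fin d, A ⟨u % n, Nat.mod_lt _ hn⟩ k = false ∨
        B ⟨v % n, Nat.mod_lt _ hn⟩ k = false ∨ C ⟨z % n, Nat.mod_lt _ hn⟩ k = false := by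
    intro u v z
    simp only [ovMemory, Fin.forall_iff]
    refine forall₂_congr fun k hk => ?_
    rw [vectorAt_arrayOf_vectorCells A (Nat.mod_lt _ hn) hk,
      vectorAt_arrayOf_vectorCells B (Nat.mod_lt _ hn) hk,
      vectorAt_arrayOf_vectorCells C (Nat.mod_lt _ hn) hk]
    cases A ⟨u % n, Nat.mod_lt _ hn⟩ ⟨k, hk⟩ <;> cases B ⟨v % n, Nat.mod_lt _ hn⟩ ⟨k, hk⟩ <;>
      cases C ⟨z % n, Nat.mod_lt _ hn⟩ ⟨k, hk⟩ <;> simp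
  simp only [RunHits, HitsAt, key]

/-- Indices are taken modulo `n`. The last group therefore wraps around instead of being padded, and
every slot holds a genuine vector that cannot cause a false hit. -/
theorem exists_group {N : ℕ} (hN : 3 ≤ N) {u : ℕ} (hu : u < n) :
    ∃ x < numGroups n N, ∃ i, 2 ≤ i ∧ i < N ∧ (x * (N - 2) + i) % n = u := by
  -- `r` is `u - 2` modulo `n`, since vectors sit on the tokens from `2` on; the inner remainder
  -- keeps the natural subtraction exact for `n ≤ 2`.
  set r := (u + (n - 2 % n)) % n with hr
  have hn : 0 < n := by omega
  have hrn : r < n := Nat.mod_lt _ hn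
  refine ⟨r / (N - 2), Nat.lt_succ_of_le (Nat.div_le_div_right hrn.le), r % (N - 2) + 2, by omega,
    ?_, ?_⟩
  · have := Nat.mod_lt r (show 0 < N - 2 by omega)
    omega
  · rw [← add_assoc, Nat.div_add_mod', hr, Nat.mod_add_mod, add_assoc]
    have h2 : 2 % n < n := Nat.mod_lt _ hn
    have h3 : n - 2 % n + 2 = n * (1 + 2 / n) := by
      have := Nat.div_add_mod 2 n
      rw [mul_add, mul_one]
      omega
    rw [h3, Nat.add_mul_mod_self_left, Nat.mod_eq_of_lt hu]

/-- Some run finds an orthogonal triple if and only if there is one. -/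
theorem exists_runHits_iff (hn : 0 < n) {N L H : ℕ} (hN : 3 ≤ N) (hL : 0 < L) (hH : 0 < H) :
    (∃ γ < numRuns n N L H, RunHits (ovMemory A B C) n d N L H (γ % numGroups n N * (N - 2))
      (γ / numGroups n N % numGroups n N * (N - 2))
      (γ / numGroups n N / numGroups n N * (L * H))) ↔ HasOrthogonalTriple A B C := by
  simp only [runHits_ovMemory hn]
  constructor
  -- A hit of any run names three actual vectors, so there are no false positives.
  · rintro ⟨_, -, _, -, -, _, -, _, -, _, -, -, h⟩
    exact ⟨_, _, _, h⟩
  · rintro ⟨a, b, c, h⟩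
    obtain ⟨x, hx, i, hi2, hiN, hi⟩ := exists_group hN a.2
    obtain ⟨y, hy, j, hj2, hjN, hj⟩ := exists_group hN b.2
    set u := numGroups n N
    have hu : 0 < u := by omega
    have hLH : 0 < L * H := Nat.mul_pos hL hH
    have hz : c / (L * H) < n / (L * H) + 1 := Nat.lt_succ_of_le (Nat.div_le_div_right c.2.le)
    have e1 : ((c / (L * H) * u + y) * u + x) % u = x := by
      rw [Nat.mul_add_mod', Nat.mod_eq_of_lt hx]
    have e2 : ((c / (L * H) * u + y) * u + x) / u = c / (L * H) * u + y := by
      rw [mul_comm, Nat.mul_add_div hu, Nat.div_eq_of_lt hx, add_zero]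
    have e3 : (c / (L * H) * u + y) % u = y := by
      rw [Nat.mul_add_mod', Nat.mod_eq_of_lt hy]
    have e4 : (c / (L * H) * u + y) / u = c / (L * H) := by
      rw [mul_comm, Nat.mul_add_div hu, Nat.div_eq_of_lt hy, add_zero]
    -- The run with digits `x`, `y`, `c / (L H)`; within its group, `c` is held by the layer and
    -- head given by the digits of `c % (L H)` to base `H`.
    refine ⟨(c / (L * H) * u + y) * u + x, ?_, i, hi2, hiN, c % (L * H) / H, ?_,
      c % (L * H) % H, Nat.mod_lt _ hH, j, hj2, hjN, fun k => ?_⟩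
    · have h1 : c / (L * H) * u + y + 1 ≤ (n / (L * H) + 1) * u := by nlinarith
      have h2 : (c / (L * H) * u + y + 1) * u ≤ (n / (L * H) + 1) * u * u :=
        Nat.mul_le_mul_right _ h1
      calc (c / (L * H) * u + y) * u + x < (c / (L * H) * u + y + 1) * u := by
            rw [add_mul _ 1, one_mul]; omega
        _ ≤ numRuns n N L H := by
            unfold numRuns
            linarith
    · rw [Nat.div_lt_iff_lt_mul hH]
      exact Nat.mod_lt _ hLH
    · have e5 : (c / (L * H) * (L * H) + (c % (L * H) / H * H + c % (L * H) % H)) % n = c := by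
        rw [Nat.div_add_mod', Nat.div_add_mod', Nat.mod_eq_of_lt c.2]
      have h := h k
      simp only [e1, e2, e3, e4, e5, hi, hj]
      exact h

/-- A program for transformers decides which tokens find an orthogonal triple. -/
theorem ComputesTransformers.solvesRuns {σ : ℝ → ℝ} {cs : ℝ} (hc : Continuous σ)
    (hσ : GapPreservingAt σ cs) (k : ℕ) : ∀ᶠ N : ℕ in Filter.atTop, ∀ (p : Program)
      (n d m L H : ℕ) (A B C : Fin n → Fin d → Bool) (t : ℝ), 2 * d + 5 ≤ m → 1 ≤ H → H ≤ N ^ k →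
      ComputesTransformers p σ cs (N ^ 2) N m L H m t →
      SolvesRuns p (ovMemory A B C) n d N m L H ⌊t⌋₊ := by
  filter_upwards [apply_searchCode hc hσ k, Filter.eventually_ge_atTop 8] with N hN hN8
  intro p n d m L H A B C t hm hH hHk hp o₁ o₂ o₃
  have hM : 8 * N ≤ N ^ 2 := by nlinarith
  obtain ⟨t', s', hex, ht, hpost⟩ := hp (runCode (ovMemory A B C) n d N m L H o₃)
    (runInput (ovMemory A B C) n d N m o₁ o₂)
    (searchCode_valid hσ (fun _ _ _ => vectorAt_arrayOf_bit C _ _) hM (by omega))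
    (searchInput_valid (fun _ _ => vectorAt_arrayOf_bit A _ _)
      (fun _ _ => vectorAt_arrayOf_bit B _ _) (by omega))
  refine ⟨t', s', hex, Nat.le_floor ht, fun i hi2 hiN => ?_⟩
  obtain ⟨hpos, herr⟩ := hpost ⟨i, hiN⟩
  obtain ⟨hyes, hno⟩ := hN m L H d (fun i => vectorAt (ovMemory A B C 2) n d (o₁ + i))
    (fun i => vectorAt (ovMemory A B C 3) n d (o₂ + i))
    (fun ℓ h => vectorAt (ovMemory A B C 4) n d (o₃ + (ℓ * H + h)))
    (fun _ _ => vectorAt_arrayOf_bit A _ _) (fun _ _ => vectorAt_arrayOf_bit B _ _)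
    (fun _ _ _ => vectorAt_arrayOf_bit C _ _) hm hH hHk ⟨i, hiN⟩
  unfold runCode runInput at herr
  simp only at hpos herr hyes hno
  generalize ((searchCode m L H N d fun ℓ h => vectorAt (ovMemory A B C 4) n d
    (o₃ + (ℓ * H + h))).transformer σ cs).apply (realMatrix σ cs (searchInput N m d
      (fun i => vectorAt (ovMemory A B C 2) n d (o₁ + i))
      fun i => vectorAt (ovMemory A B C 3) n d (o₂ + i))) ⟨i, hiN⟩ 0 = y at herr hyes hno
  generalize s' 0 (2 * (i : ℤ) + 1) = D at *
  generalize s' 0 (2 * (i : ℤ)) = E at *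
  have hD : (0 : ℝ) < D := by exact_mod_cast hpos
  have hNR : (8 : ℝ) ≤ N := by exact_mod_cast hN8
  have hsmall : 1 / (10 * (N : ℝ)) ≤ 1 / 80 := by
    apply one_div_le_one_div_of_le <;> linarith
  have herr := abs_le.1 (herr.trans hsmall)
  -- The threshold `1/2` separates exact outputs at most `0` from those at least `3/4`, even with
  -- the error `1/(10N) ≤ 1/80`.
  have hiff : 0 < D - 2 * E ↔ (E : ℝ) / D < 1 / 2 := by
    rw [div_lt_iff₀ hD, ← Int.cast_pos (R := ℝ)]
    push_cast
    constructor <;> intro h <;> linarith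
  rw [hiff]
  constructor
  · intro h
    by_contra hcon
    have := hno hcon
    linarith
  · intro h
    have := hyes h
    linarith

end Reduction

/-! ### Growth estimates -/

section Asymptotics

/-- The integer root tends to infinity with `n`, which transports statements about large `N` to
large `n`. -/
theorem eventually_exists_root {q : ℕ} (hq : q ≠ 0) {P : ℕ → Prop}
    (h : ∀ᶠ N in Filter.atTop, P N) :
    ∀ᶠ n : ℕ in Filter.atTop, ∃ N : ℕ, N ^ q ≤ n ∧ n < (N + 1) ^ q ∧ P N := by
  obtain ⟨N₀, hN₀⟩ := Filter.eventually_atTop.1 h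
  filter_upwards [Filter.eventually_ge_atTop (N₀ ^ q)] with n hn
  have hex : ∃ N, n < (N + 1) ^ q :=
    ⟨n, (Nat.lt_succ_self n).trans_le (Nat.le_self_pow hq _)⟩
  have hlt : n < (Nat.find hex + 1) ^ q := Nat.find_spec hex
  refine ⟨Nat.find hex, ?_, hlt, hN₀ _ ?_⟩
  · rcases hc : Nat.find hex with _ | N
    · simp [hq]
    · exact not_lt.1 (Nat.find_min hex (by omega : N < Nat.find hex))
  · exact Nat.le_of_lt_succ (lt_of_pow_lt_pow_left₀ q (Nat.zero_le _) (hn.trans_lt hlt))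

/-- Since `N ≥ 3`, groups of `N - 2` vectors are at least a third as large as `N`; together with the
rounding this gives at most `4n/N` groups in `A` and in `B`, and at most `2n/(L H)` in `C`. The
additional run is paid for by doubling. -/
theorem numRuns_add_one_le {n N L H : ℕ} (hN : 3 ≤ N) (hNn : N ≤ n) (hL : 1 ≤ L) (hH : 1 ≤ H)
    (hLH : L * H ≤ n) :
    (numRuns n N L H + 1 : ℝ) ≤ 64 * (n : ℝ) ^ 3 / ((N : ℝ) ^ 2 * (L * H)) := by
  have hN0 : (3 : ℝ) ≤ N := by exact_mod_cast hN
  have hNn' : (N : ℝ) ≤ n := by exact_mod_cast hNn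
  have hL0 : (1 : ℝ) ≤ L := by exact_mod_cast hL
  have hH0 : (1 : ℝ) ≤ H := by exact_mod_cast hH
  have hLH' : (L * H : ℝ) ≤ n := by exact_mod_cast hLH
  have hLH0 : (0 : ℝ) < L * H := by positivity
  have hu : (numGroups n N : ℝ) ≤ 4 * n / N := by
    have h1 : ((n / (N - 2) : ℕ) : ℝ) ≤ (n : ℝ) / ((N - 2 : ℕ) : ℝ) := Nat.cast_div_le
    rw [Nat.cast_sub (by omega)] at h1
    have h2 : (n : ℝ) / (N - (2 : ℕ)) ≤ 3 * n / N := by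
      rw [div_le_div_iff₀ (by push_cast; linarith) (by linarith)]
      push_cast
      nlinarith
    have h3 : 1 ≤ (n : ℝ) / N := by rwa [one_le_div (by linarith)]
    have h4 : 4 * (n : ℝ) / N = 3 * n / N + n / N := by ring
    unfold numGroups
    push_cast
    linarith
  have hz : ((n / (L * H) : ℕ) : ℝ) + 1 ≤ 2 * n / (L * H) := by
    have h1 : ((n / (L * H) : ℕ) : ℝ) ≤ (n : ℝ) / ((L * H : ℕ) : ℝ) := Nat.cast_div_le
    push_cast at h1
    have h3 : 1 ≤ (n : ℝ) / (L * H) := by rwa [one_le_div hLH0]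
    have h4 : 2 * (n : ℝ) / (L * H) = n / (L * H) + n / (L * H) := by ring
    linarith
  have h1 : (1 : ℝ) ≤ numRuns n N L H := by
    have : 0 < numRuns n N L H := by unfold numRuns numGroups; positivity
    exact_mod_cast this
  calc (numRuns n N L H + 1 : ℝ) ≤ 2 * numRuns n N L H := by linarith
    _ = 2 * (numGroups n N * numGroups n N * (((n / (L * H) : ℕ) : ℝ) + 1)) := by
      unfold numRuns
      push_cast
      ring
    _ ≤ 2 * (4 * n / N * (4 * n / N) * (2 * n / (L * H))) := by gcongr
    _ = 64 * (n : ℝ) ^ 3 / ((N : ℝ) ^ 2 * (L * H)) := by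
      field_simp
      ring

/-- The factor `N² L H` of triples tested per run cancels against the time `L H N^(2-ε)`, which
leaves `n³ / N^ε`. Writing the weights is not dominant: `N + L H ≤ 2 L H N` and, as `ε ≤ 1`, `N ≤
N^(2-ε)`. -/
theorem runs_time_le {n N m L H : ℕ} {K ε t : ℝ} (hε1 : ε ≤ 1) (hK : 0 ≤ K) (hN : 3 ≤ N)
    (hNn : N ≤ n) (hL : 1 ≤ L) (hH : 1 ≤ H) (hLH : L * H ≤ n)
    (ht : t ≤ K * L * H * (N : ℝ) ^ (2 - ε)) :
    (numRuns n N L H + 1 : ℝ) * (inputLen N m L H + t) ≤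
      64 * (24 + K) * ((m + 1 : ℝ) ^ 2 * (n ^ 3 / (N : ℝ) ^ ε)) := by
  have hN0 : (3 : ℝ) ≤ N := by exact_mod_cast hN
  have hNpos : (0 : ℝ) < N := by linarith
  have hL0 : (1 : ℝ) ≤ L := by exact_mod_cast hL
  have hH0 : (1 : ℝ) ≤ H := by exact_mod_cast hH
  have hLH0 : (1 : ℝ) ≤ L * H := one_le_mul_of_one_le_of_one_le hL0 hH0
  have hN1 : (N : ℝ) ≤ (N : ℝ) ^ (2 - ε) := by
    simpa using Real.rpow_le_rpow_of_exponent_le (x := N) (by linarith) (by linarith : 1 ≤ 2 - ε)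
  have hm1 : (1 : ℝ) ≤ (m + 1) ^ 2 := one_le_pow₀ (by linarith [(Nat.cast_nonneg m : (0 : ℝ) ≤ m)])
  have hlen : (inputLen N m L H : ℝ) ≤ 24 * (L * H) * (N : ℝ) ^ (2 - ε) * (m + 1) ^ 2 := by
    have h1 : (N + L * H : ℝ) ≤ 2 * (L * H * N) := by nlinarith
    unfold inputLen
    push_cast
    calc (12 : ℝ) * ((N + L * H) * ((m + 1) * (m + 1)))
        ≤ 12 * (2 * (L * H * (N : ℝ) ^ (2 - ε)) * ((m + 1) * (m + 1))) := by
          gcongr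
          exact h1.trans (by gcongr)
      _ = _ := by ring
  have hsum : (inputLen N m L H : ℝ) + t ≤ (24 + K) * (L * H) * (N : ℝ) ^ (2 - ε) * (m + 1) ^ 2 := by
    have : K * L * H * (N : ℝ) ^ (2 - ε) ≤ K * L * H * (N : ℝ) ^ (2 - ε) * (m + 1) ^ 2 :=
      le_mul_of_one_le_right (by positivity) hm1
    nlinarith
  calc (numRuns n N L H + 1 : ℝ) * (inputLen N m L H + t)
      ≤ (numRuns n N L H + 1 : ℝ) * ((24 + K) * (L * H) * (N : ℝ) ^ (2 - ε) * (m + 1) ^ 2) := by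
        gcongr
    _ ≤ 64 * (n : ℝ) ^ 3 / ((N : ℝ) ^ 2 * (L * H)) *
        ((24 + K) * (L * H) * (N : ℝ) ^ (2 - ε) * (m + 1) ^ 2) := by
        gcongr
        exact numRuns_add_one_le hN hNn hL hH hLH
    _ = _ := by
        rw [Real.rpow_sub hNpos, Real.rpow_two]
        field_simp

/-- The bit length of the numbers that are handled. -/
def wordLen (q N : ℕ) : ℕ := 4 * q * (Nat.log 2 N + 1)

theorem pow_le_two_pow_wordLen (q N : ℕ) : (N + 1) ^ (4 * q) ≤ 2 ^ wordLen q N := by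
  rw [wordLen, mul_comm _ (_ + 1), pow_mul 2]
  exact Nat.pow_le_pow_left (Nat.lt_pow_succ_log_self (by norm_num : 1 < 2) N) _

theorem natLog_two_le (N : ℕ) : (Nat.log 2 N : ℝ) ≤ 2 * Real.log N := by
  rcases Nat.eq_zero_or_pos N with rfl | hN
  · simp
  have h1 : ((2 ^ Nat.log 2 N : ℕ) : ℝ) ≤ N := by
    exact_mod_cast Nat.pow_log_le_self 2 hN.ne'
  have h2 := Real.log_le_log (by positivity) h1
  push_cast at h2
  rw [Real.log_pow] at h2
  have h3 := Real.log_two_gt_d9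
  have h4 : (0 : ℝ) ≤ Nat.log 2 N := Nat.cast_nonneg _
  nlinarith

/-- A polylogarithmic factor is absorbed by a power. -/
theorem eventually_wordLen_mul_le {q : ℕ} {m : ℕ → ℕ} {ε : ℝ} (hε : 0 < ε)
    (hm : (fun N : ℕ => (m N : ℝ)) =O[Filter.atTop] (fun N : ℕ => Real.log (N : ℝ))) :
    ∀ᶠ N : ℕ in Filter.atTop, (wordLen q N : ℝ) * (m N + 1 : ℝ) ^ 2 ≤ (N : ℝ) ^ ε := by
  have hone : (fun _ : ℕ => (1 : ℝ)) =O[Filter.atTop] (fun N : ℕ => Real.log (N : ℝ)) := by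
    refine Asymptotics.IsBigO.of_bound 1 ?_
    filter_upwards [Filter.eventually_ge_atTop 3] with N hN
    have h3 : (3 : ℝ) ≤ N := by exact_mod_cast hN
    have h1 : 1 ≤ Real.log N := by
      rw [Real.le_log_iff_exp_le (by linarith)]
      exact Real.exp_one_lt_d9.le.trans (by linarith)
    rw [norm_one, Real.norm_of_nonneg (by linarith)]
    linarith
  have hlog : (fun N : ℕ => (Nat.log 2 N : ℝ)) =O[Filter.atTop]
      (fun N : ℕ => Real.log (N : ℝ)) := by
    refine Asymptotics.IsBigO.of_bound 2 (Filter.Eventually.of_forall fun N => ?_)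
    rw [Real.norm_of_nonneg (Nat.cast_nonneg _)]
    exact (natLog_two_le N).trans (by gcongr; exact le_abs_self _)
  have hw : (fun N : ℕ => (wordLen q N : ℝ)) =O[Filter.atTop]
      (fun N : ℕ => Real.log (N : ℝ)) := by
    have : (fun N : ℕ => (wordLen q N : ℝ)) =
        fun N : ℕ => (4 * q : ℝ) * ((Nat.log 2 N : ℝ) + 1) := by
      funext N
      simp [wordLen]
    rw [this]
    exact (hlog.add hone).const_mul_left _
  -- The word length and the two factors `m + 1` are each `O(log N)`, so the product is `O(log³ N)`.
  have hall := (hw.mul ((hm.add hone).pow 2)).trans_isLittleO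
    (g := fun N : ℕ => Real.log (N : ℝ) * Real.log (N : ℝ) ^ 2) (k := fun N : ℕ => (N : ℝ) ^ ε) (by
      have := (isLittleO_log_rpow_rpow_atTop 3 hε).comp_tendsto tendsto_natCast_atTop_atTop
      refine this.congr_left fun N => ?_
      simp only [Function.comp]
      norm_cast
      ring)
  filter_upwards [hall.bound one_pos] with N hN
  rw [one_mul, Real.norm_of_nonneg (by positivity), Real.norm_of_nonneg (by positivity)] at hN
  exact hN

end Asymptotics

/-! ### The reduction and the theorem -/

section Main

theorem RunsWithin.haltsIn {p : Program} {s : Memory} {T : ℝ} {post : Memory → Prop}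
    (h : RunsWithin p s T post) : HaltsIn p s ⌊T⌋₊ post := by
  obtain ⟨t, s', hex, ht, hpost⟩ := h
  exact ⟨t, s', hex, Nat.le_floor ht, hpost⟩

theorem arrayOf_listCells_bit_or {l : List ℤ} (i : ℤ) :
    arrayOf (listCells l) i = 0 ∨ arrayOf (listCells l) i ∈ l := by
  rcases i with i | i
  · simp only [arrayOf, listCells, List.getD_eq_getElem?_getD]
    by_cases hi : i < l.length
    · right
      simp [hi]
    · left
      simp [not_lt.1 hi]
  · exact .inl rfl

theorem lowBounded_ovMemory {n d β : ℕ} (A B C : Fin n → Fin d → Bool) (hn : n ≤ 2 ^ β)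
    (hd : d ≤ 2 ^ β) : LowBounded β (ovMemory A B C) := by
  intro a i _
  have h1 : 1 ≤ 2 ^ β := Nat.one_le_two_pow
  unfold ovMemory
  split
  · rcases arrayOf_listCells_bit_or (l := [(n : ℤ), (d : ℤ)]) i with h | h
    · simp [h]
    · rcases List.mem_pair.1 h with h | h <;> rw [h] <;> simpa
  · rcases arrayOf_vectorCells_bit A i with h | h <;> simp [h, h1]
  · rcases arrayOf_vectorCells_bit B i with h | h <;> simp [h, h1]
  · rcases arrayOf_vectorCells_bit C i with h | h <;> simp [h, h1]
  · simp [arrayOf_listCells_nil]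

/-- From `n < (N + 1)^q ≤ (2N)^q`: a saving in terms of `N` is a saving in terms of `n`, with the
exponent divided by `q`. -/
theorem rpow_le_two_mul_rpow {n N q : ℕ} {ε : ℝ} (hε : 0 < ε) (hε1 : ε ≤ 1) (hq : q ≠ 0)
    (hN : 1 ≤ N) (hn : n < (N + 1) ^ q) :
    (n : ℝ) ^ (ε / (2 * q)) ≤ 2 * (N : ℝ) ^ (ε / 2) := by
  have hN1 : (1 : ℝ) ≤ N := by exact_mod_cast hN
  have hq0 : (q : ℝ) ≠ 0 := by exact_mod_cast hq
  have h1 : (n : ℝ) ≤ (2 * N : ℝ) ^ q := by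
    have : (n : ℝ) ≤ ((N : ℝ) + 1) ^ q := by exact_mod_cast hn.le
    exact this.trans (by gcongr; linarith)
  calc (n : ℝ) ^ (ε / (2 * q)) ≤ ((2 * N : ℝ) ^ q) ^ (ε / (2 * q)) := by gcongr
    _ = (2 * N : ℝ) ^ (ε / 2) := by
      rw [← Real.rpow_natCast, ← Real.rpow_mul (by positivity)]
      congr 1
      field_simp
    _ = 2 ^ (ε / 2) * (N : ℝ) ^ (ε / 2) := Real.mul_rpow (by norm_num) (by positivity)
    _ ≤ 2 * (N : ℝ) ^ (ε / 2) := by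
      gcongr
      simpa using Real.rpow_le_rpow_of_exponent_le (x := 2) (by norm_num) (by linarith : ε / 2 ≤ 1)

/-- Half of the saving `N^ε` absorbs the polylogarithmic factor, and the other half becomes
`n^(ε/(2q))`. The computation of the root and of the parameters is linear in `n` up to the word
length and hence negligible. -/
theorem solver_time_le {q k n N m L H : ℕ} {K C₁ C₂ C₃ ε t : ℝ} (hε : 0 < ε) (hε1 : ε ≤ 1)
    (hq : q ≠ 0) (hK : 0 ≤ K) (hC₁ : 0 ≤ C₁) (hC₂ : 0 ≤ C₂) (hC₃ : 0 ≤ C₃) (hN : 3 ≤ N)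
    (hNn : N ≤ n) (hNk : (N + 1) ^ k ≤ n) (hn : n < (N + 1) ^ q) (hL : 1 ≤ L) (hH : 1 ≤ H)
    (hLH : L * H ≤ n) (ht : t ≤ K * L * H * (N : ℝ) ^ (2 - ε)) {tm tL tH : ℝ}
    (hm : tm ≤ C₁ * ((N : ℝ) + 1) ^ k) (htL : tL ≤ C₂ * ((N : ℝ) + 1) ^ k)
    (htH : tH ≤ C₃ * ((N : ℝ) + 1) ^ k)
    (hlog : (wordLen q N : ℝ) * (m + 1 : ℝ) ^ 2 ≤ (N : ℝ) ^ (ε / 2)) :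
    (solverWeight q : ℝ) * (wordLen q N * ((N + 1) + (tm + 1) + (tL + 1) + (tH + 1) +
      (numRuns n N L H + 1) * (inputLen N m L H + t))) ≤
    2 * solverWeight q * (5 + (C₁ + C₂ + C₃) + 64 * (24 + K)) * (n : ℝ) ^ (3 - ε / (2 * q)) := by
  have hN0 : (3 : ℝ) ≤ N := by exact_mod_cast hN
  have hNpos : (0 : ℝ) < N := by linarith
  have hNn' : (N : ℝ) ≤ n := by exact_mod_cast hNn
  have hnpos : (0 : ℝ) < n := by linarith
  have hNk' : ((N : ℝ) + 1) ^ k ≤ n := by exact_mod_cast hNk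
  have hm1 : (1 : ℝ) ≤ (m + 1) ^ 2 := one_le_pow₀ (by linarith [(Nat.cast_nonneg m : (0 : ℝ) ≤ m)])
  have hNε : (N : ℝ) ^ ε ≤ n := by
    refine le_trans ?_ hNn'
    simpa using Real.rpow_le_rpow_of_exponent_le (x := N) (by linarith) hε1
  have hbig : (n : ℝ) ≤ (m + 1 : ℝ) ^ 2 * (n ^ 3 / (N : ℝ) ^ ε) := by
    have : (n : ℝ) ≤ n ^ 3 / (N : ℝ) ^ ε := by
      rw [le_div_iff₀ (by positivity)]
      have : (n : ℝ) * (N : ℝ) ^ ε ≤ n * n := by gcongr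
      nlinarith [sq_nonneg ((n : ℝ) - 1)]
    nlinarith
  have hfirst : ((N : ℝ) + 1) + (tm + 1) + (tL + 1) + (tH + 1) ≤ (5 + (C₁ + C₂ + C₃)) * n := by
    have h1 := mul_le_mul_of_nonneg_left hNk' hC₁
    have h2 := mul_le_mul_of_nonneg_left hNk' hC₂
    have h3 := mul_le_mul_of_nonneg_left hNk' hC₃
    nlinarith
  have hsecond := runs_time_le (m := m) hε1 hK hN hNn hL hH hLH ht
  have hsum : ((N : ℝ) + 1) + (tm + 1) + (tL + 1) + (tH + 1) +
      (numRuns n N L H + 1) * (inputLen N m L H + t) ≤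
      (5 + (C₁ + C₂ + C₃) + 64 * (24 + K)) * ((m + 1 : ℝ) ^ 2 * (n ^ 3 / (N : ℝ) ^ ε)) := by
    have : (5 + (C₁ + C₂ + C₃)) * (n : ℝ) ≤
        (5 + (C₁ + C₂ + C₃)) * ((m + 1 : ℝ) ^ 2 * (n ^ 3 / (N : ℝ) ^ ε)) := by gcongr
    linarith
  set D := 5 + (C₁ + C₂ + C₃) + 64 * (24 + K) with hD
  have hD0 : 0 ≤ D := by positivity
  have hsplit : (N : ℝ) ^ ε = (N : ℝ) ^ (ε / 2) * (N : ℝ) ^ (ε / 2) := by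
    rw [← Real.rpow_add hNpos, add_halves]
  have hroot := rpow_le_two_mul_rpow hε hε1 hq (by omega) hn
  calc (solverWeight q : ℝ) * (wordLen q N * ((N + 1) + (tm + 1) + (tL + 1) + (tH + 1) +
        (numRuns n N L H + 1) * (inputLen N m L H + t)))
      ≤ solverWeight q * (wordLen q N * (D * ((m + 1 : ℝ) ^ 2 * (n ^ 3 / (N : ℝ) ^ ε)))) := by
        gcongr
    _ = solverWeight q * D * (wordLen q N * (m + 1 : ℝ) ^ 2) * (n ^ 3 / (N : ℝ) ^ ε) := by ring
    _ ≤ solverWeight q * D * (N : ℝ) ^ (ε / 2) * (n ^ 3 / (N : ℝ) ^ ε) := by gcongr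
    _ = solverWeight q * D * ((n : ℝ) ^ 3 / (N : ℝ) ^ (ε / 2)) := by
        rw [hsplit]
        field_simp
    _ ≤ solverWeight q * D * (2 * ((n : ℝ) ^ 3 / (n : ℝ) ^ (ε / (2 * q)))) := by
        gcongr
        rw [← mul_div_assoc, div_le_div_iff₀ (by positivity) (by positivity)]
        have h3 : (0 : ℝ) ≤ (n : ℝ) ^ 3 := by positivity
        nlinarith
    _ = _ := by
        have h3 : (n : ℝ) ^ (3 : ℝ) = (n : ℝ) ^ 3 := by simp
        rw [Real.rpow_sub hnpos, h3]
        ring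

/-- A fast program for transformers yields a fast program for 3-OV. -/
theorem solvesThreeOV_solver {σ : ℝ → ℝ} {cs : ℝ} (hc : Continuous σ) (hσ : GapPreservingAt σ cs)
    {k c q : ℕ} (hq : q = 2 * k + 6) {ε : ℝ} (hε : 0 < ε) (hε1 : ε ≤ 1) {m L H : ℕ → ℕ}
    (hmO : (fun N : ℕ => (m N : ℝ)) =O[Filter.atTop] (fun N : ℕ => Real.log (N : ℝ)))
    (hm : ∀ᶠ N : ℕ in Filter.atTop, (6 * q * c + 5 : ℝ) * Real.log (N : ℝ) ≤ (m N : ℝ))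
    (hLH : ∀ᶠ N : ℕ in Filter.atTop, 1 ≤ L N ∧ L N ≤ N ^ k ∧ 1 ≤ H N ∧ H N ≤ N ^ k)
    {pm pL pH p : Program} {C₁ C₂ C₃ K : ℝ} (hC₁ : 0 ≤ C₁) (hC₂ : 0 ≤ C₂) (hC₃ : 0 ≤ C₃)
    (hK : 0 ≤ K)
    (hpm : ∀ N : ℕ, RunsWithin pm (natMemory N) (C₁ * ((N : ℝ) + 1) ^ k) fun s' => s' 0 0 = m N)
    (hpL : ∀ N : ℕ, RunsWithin pL (natMemory N) (C₂ * ((N : ℝ) + 1) ^ k) fun s' => s' 0 0 = L N)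
    (hpH : ∀ N : ℕ, RunsWithin pH (natMemory N) (C₃ * ((N : ℝ) + 1) ^ k) fun s' => s' 0 0 = H N)
    (hp : ∀ᶠ N : ℕ in Filter.atTop, ComputesTransformers p σ cs (N ^ 2) N (m N) (L N) (H N) (m N)
      (K * (L N : ℝ) * (H N : ℝ) * (N : ℝ) ^ (2 - ε))) :
    SolvesThreeOV (solver q pm pL pH p) c fun n =>
      2 * solverWeight q * (5 + (C₁ + C₂ + C₃) + 64 * (24 + K)) * (n : ℝ) ^ (3 - ε / (2 * q)) := by
  have hq0 : q ≠ 0 := by omega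
  have hpre := ((ComputesTransformers.solvesRuns hc hσ k).and hm).and ((hLH.and hp).and
    ((eventually_wordLen_mul_le (q := q) (ε := ε / 2) (by positivity) hmO).and
      (Filter.eventually_ge_atTop 27)))
  filter_upwards [eventually_exists_root hq0 hpre] with n hn d hd A B C
  obtain ⟨N, hNq, hnN, ⟨hruns, hmN⟩, ⟨⟨hL1, hLk, hH1, hHk⟩, hpN⟩, hlog, hN⟩ := hn
  have hN0 : (27 : ℝ) ≤ N := by exact_mod_cast hN
  have hβ : 1 ≤ wordLen q N := by unfold wordLen; exact Nat.mul_pos (by omega) (by omega)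
  -- The polylogarithmic estimate already implies that `m N` is below `N`.
  have hmlt : m N + 1 ≤ N := by
    have h1 : (1 : ℝ) ≤ wordLen q N := by exact_mod_cast hβ
    have h2 : (N : ℝ) ^ (ε / 2) ≤ N := by
      simpa using Real.rpow_le_rpow_of_exponent_le (x := N) (by linarith) (by linarith : ε / 2 ≤ 1)
    have h3 : (m N + 1 : ℝ) ≤ (m N + 1) ^ 2 := by
      have : (0 : ℝ) ≤ m N := Nat.cast_nonneg _
      nlinarith
    have h4 : (m N + 1 : ℝ) ^ 2 ≤ wordLen q N * (m N + 1 : ℝ) ^ 2 :=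
      le_mul_of_one_le_left (by positivity) h1
    exact_mod_cast h3.trans (h4.trans (hlog.trans h2))
  have hpow : ∀ j ≤ q, N ^ j ≤ n := fun j hj => (Nat.pow_le_pow_right (by omega) hj).trans hNq
  have hNn : N ≤ n := by simpa using hpow 1 (by omega)
  have hLHn : L N * H N ≤ N ^ (2 * k) := by
    rw [two_mul, pow_add]
    exact Nat.mul_le_mul hLk hHk
  -- The exponent `2k + 6` is chosen so that `L H ≤ N^(2k)`, the time `(N + 1)^k ≤ N^(2k)` of the
  -- parameters and the input length, at most `N^(2k+4)`, are all at most `n`.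
  have hNk : (N + 1) ^ k ≤ n := by
    refine le_trans ?_ (hpow (2 * k) (by omega))
    rw [pow_mul]
    exact Nat.pow_le_pow_left (by nlinarith) _
  -- With `x = (N + 1)^q > n` the generation count is at most `x³ + 3 ≤ x⁴`, which explains the `4q`
  -- in `wordLen`.
  have hG : (n + 1) * (n + 1) * (n + 1) + 3 ≤ 2 ^ wordLen q N := by
    refine le_trans ?_ (pow_le_two_pow_wordLen q N)
    have h1 : n + 1 ≤ (N + 1) ^ q := hnN
    rw [mul_comm 4 q, pow_mul]
    set x := (N + 1) ^ q
    calc (n + 1) * (n + 1) * (n + 1) + 3 ≤ x * x * x + 3 := by gcongr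
      _ ≤ x ^ 4 := by
        have : 1 ≤ x := by omega
        have : 1 ≤ x * x * x := Nat.mul_pos (Nat.mul_pos this this) this
        have h4 : 4 ≤ x := by omega
        calc x * x * x + 3 ≤ x * x * x * 4 := by omega
          _ ≤ x * x * x * x := Nat.mul_le_mul_left _ h4
          _ = x ^ 4 := by ring
  have hn2 : n ≤ 2 ^ wordLen q N := by
    refine le_trans ?_ hG
    nlinarith [Nat.zero_le (n * n), Nat.zero_le (n * n * n)]
  have hlen : inputLen N (m N) (L N) (H N) ≤ 2 ^ wordLen q N := by
    refine le_trans ?_ hn2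
    have h1 : N + N ^ (2 * k) ≤ 2 * N ^ (2 * k + 1) := by
      have e1 : N ≤ N ^ (2 * k + 1) := Nat.le_self_pow (by omega) _
      have e2 : N ^ (2 * k) ≤ N ^ (2 * k + 1) := Nat.pow_le_pow_right (by omega) (by omega)
      omega
    unfold inputLen
    calc 12 * ((N + L N * H N) * ((m N + 1) * (m N + 1)))
        ≤ 12 * (2 * N ^ (2 * k + 1) * (N * N)) := by
          gcongr
          exact (Nat.add_le_add_left hLHn N).trans h1
      _ = 24 * N ^ (2 * k + 3) := by ring
      _ ≤ N * N ^ (2 * k + 3) := by gcongr; omega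
      _ = N ^ (2 * k + 4) := by ring
      _ ≤ n := hpow _ (by omega)
  -- Here `d ≤ c log₂ n ≤ 3 q c ln N`, so two blocks and five special coordinates fit into `(6 q c +
  -- 5) ln N ≤ m N`.
  have hdm : 2 * d + 5 ≤ m N := by
    have h1 : Nat.log 2 n < q * (Nat.log 2 N + 1) := by
      refine Nat.log_lt_of_lt_pow (by omega) (hnN.trans_le ?_)
      rw [mul_comm, pow_mul 2]
      exact Nat.pow_le_pow_left (Nat.lt_pow_succ_log_self (by norm_num : 1 < 2) N) _
    have h2 : (Nat.log 2 n : ℝ) ≤ q * (Nat.log 2 N + 1) := by exact_mod_cast h1.le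
    have h3 := natLog_two_le N
    have h4 : 1 ≤ Real.log N := by
      rw [Real.le_log_iff_exp_le (by linarith)]
      exact Real.exp_one_lt_d9.le.trans (by linarith)
    have h5 : (Nat.log 2 n : ℝ) ≤ 3 * q * Real.log N := by
      refine h2.trans ?_
      have : (q : ℝ) * (Nat.log 2 N + 1) ≤ q * (3 * Real.log N) := by gcongr; linarith
      linarith
    have h6 : (d : ℝ) ≤ c * (3 * q * Real.log N) := by
      have : (d : ℝ) ≤ c * Nat.log 2 n := by exact_mod_cast hd
      exact this.trans (by gcongr)
    have h7 : (2 * d + 5 : ℝ) ≤ m N := by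
      refine le_trans ?_ hmN
      linarith
    exact_mod_cast h7
  have hlow : LowBounded (wordLen q N) (ovMemory A B C) :=
    lowBounded_ovMemory A B C hn2 (by omega)
  set t := K * (L N : ℝ) * (H N : ℝ) * (N : ℝ) ^ (2 - ε) with ht
  have ht0 : 0 ≤ t := by positivity
  have hmain := haltsIn_solver (n := n) (d := d) hβ rfl rfl hNq hnN hNn (by omega) (by omega)
    hL1 hH1 (hLHn.trans (hpow _ (by omega))) hG hlen hlow rfl
    (fun a i ha => ?_) (hpm N).haltsIn (hpL N).haltsIn (hpH N).haltsIn
    (hruns p n d (m N) (L N) (H N) A B C t hdm hH1 hHk hpN)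
  · obtain ⟨T, s', hex, hT, hyes, hno⟩ := hmain
    refine ⟨T, s', hex, ?_, ?_⟩
    · refine le_trans (Nat.cast_le.2 hT) (le_trans ?_ (solver_time_le hε hε1 hq0 hK hC₁ hC₂ hC₃
        (m := m N) (L := L N) (H := H N) (by omega) hNn hNk hnN hL1 hH1
        (hLHn.trans (hpow _ (by omega)))
        (t := (⌊t⌋₊ : ℝ)) (Nat.floor_le ht0)
        (Nat.floor_le (show 0 ≤ C₁ * ((N : ℝ) + 1) ^ k by positivity))
        (Nat.floor_le (show 0 ≤ C₂ * ((N : ℝ) + 1) ^ k by positivity))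
        (Nat.floor_le (show 0 ≤ C₃ * ((N : ℝ) + 1) ^ k by positivity)) hlog))
      push_cast
      exact le_rfl
    · rw [exists_runHits_iff (by omega) (by omega) hL1 hH1] at hyes hno
      by_cases h : HasOrthogonalTriple A B C
      · exact .inl ⟨h, hyes h⟩
      · exact .inr ⟨h, hno h⟩
  · obtain ⟨a, rfl⟩ := Nat.exists_eq_add_of_le' ha
    exact arrayOf_listCells_nil i

theorem ComputableInTime.exists_runsWithin {k : ℕ} {f : ℕ → ℕ} (h : ComputableInTime k f) :
    ∃ (p : Program) (C : ℝ), 0 ≤ C ∧ ∀ N : ℕ,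
      RunsWithin p (natMemory N) (C * ((N : ℝ) + 1) ^ k) fun s' => s' 0 0 = f N := by
  obtain ⟨p, C, h⟩ := h
  refine ⟨p, |C|, abs_nonneg C, fun N => ?_⟩
  obtain ⟨t, s', hex, ht, hpost⟩ := h N
  exact ⟨t, s', hex, ht.trans (by gcongr; exact le_abs_self C), hpost⟩

theorem gapPreservingAt_sigmoid : GapPreservingAt Real.sigmoid 0 := by
  refine ⟨(Real.sigmoid_strictMono zero_lt_one).ne, Real.sigmoid_strictMono (by norm_num),
    fun x hx => Real.sigmoid_monotone hx⟩

end Main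

theorem mainTheorem6 :
    (Continuous Real.sigmoid ∧ GapPreservingAt Real.sigmoid 0) ∧
    (ThreeOVHypothesis →
      ∃ a : ℕ, ∀ (k : ℕ) (ε : ℝ), 0 < ε →
        ∃ (c : ℝ) (B : ℕ), ∀ m L H : ℕ → ℕ,
          (fun N : ℕ => (m N : ℝ)) =Θ[Filter.atTop] (fun N : ℕ => Real.log (N : ℝ)) →
          (∀ᶠ N : ℕ in Filter.atTop, c * Real.log (N : ℝ) ≤ (m N : ℝ)) →
          (∀ᶠ N : ℕ in Filter.atTop, 1 ≤ L N ∧ L N ≤ N ^ k ∧ 1 ≤ H N ∧ H N ≤ N ^ k) →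
          ComputableInTime k m → ComputableInTime k L → ComputableInTime k H →
          ∀ (σ : ℝ → ℝ) (cs : ℝ), Continuous σ → GapPreservingAt σ cs →
            ¬ ∃ (p : Program) (K : ℝ), ∀ᶠ N : ℕ in Filter.atTop,
              ComputesTransformers p σ cs (N ^ B) N (m N) (L N) (H N) (a * m N)
                (K * (L N : ℝ) * (H N : ℝ) * (N : ℝ) ^ (2 - ε))) := by
  -- One hidden unit per coordinate is enough, so `a = 1`.
  refine ⟨⟨continuous_sigmoid, gapPreservingAt_sigmoid⟩, fun h3 => ⟨1, fun k ε hε => ?_⟩⟩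
  -- Replacing `ε` by `min ε 1` only relaxes the assumed time bound, and the estimates need an
  -- exponent at most `1`.
  have hε₀ : 0 < min ε 1 := lt_min hε one_pos
  obtain ⟨c, hc⟩ := h3 (min ε 1 / (2 * (2 * k + 6 : ℕ))) (by positivity)
  -- `B = 2` suffices because the largest coefficient `8N` is at most `N²` for large `N`.
  refine ⟨6 * (2 * k + 6 : ℕ) * c + 5, 2, fun m L H hmΘ hm hLH hpm hpL hpH σ cs hσc hσ hex => hc ?_⟩
  obtain ⟨p, K, hp⟩ := hex
  obtain ⟨pm, C₁, hC₁, hpm⟩ := hpm.exists_runsWithin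
  obtain ⟨pL, C₂, hC₂, hpL⟩ := hpL.exists_runsWithin
  obtain ⟨pH, C₃, hC₃, hpH⟩ := hpH.exists_runsWithin
  refine ⟨_, _, solvesThreeOV_solver hσc hσ rfl hε₀ (min_le_right _ _) hmΘ.1 hm hLH hC₁ hC₂ hC₃
    (abs_nonneg K) hpm hpL hpH (p := p) ?_⟩
  filter_upwards [hp, Filter.eventually_ge_atTop 1] with N hN hN1 T X hT hX
  rw [one_mul] at hN
  obtain ⟨t, s', hex, ht, hpost⟩ := hN T X hT hX
  have hN1' : (1 : ℝ) ≤ N := by exact_mod_cast hN1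
  refine ⟨t, s', hex, ht.trans ?_, hpost⟩
  gcongr
  · exact le_abs_self K
  · exact min_le_left _ _
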